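/- Let $(a_k)_{k\ge 0}$ be independent standard complex Gaussian random variables ($a_k\sim N_{\mathbb C}(0,1)$), let $$F(z)=\sum_{k=0}^{\infty}a_k\frac{z^k}{\sqrt{k!}},\qquad H(z)=|F(z)|^2e^{-|z|^2},\qquad \nabla'F(z)=\partial_zF(z)-\bar z\,F(z)\qquad(z\in\mathbb C),$$ where $\partial_z=\tfrac12(\partial_x-i\partial_y)$. A saddle point is a critical point that is neither a local maximum nor a local minimum. A random set $\mathcal X\subset\mathbb C$ has expected density $\rho$ if, for every Borel set $B\subseteq\mathbb C$, the number $\#(\mathcal X\cap B)$ is a random variable (up to a null set) and $\mathbb E\,\#(\mathcal X\cap B)=\int_B\rho\,d\nu$, where $d\nu=\frac1\pi\,dz$ and $dz$ is Lebesgue measure. Almost surely, the series converges for all $z$, $F$ is entire, and: (i) every local minimum of $H$ is a zero of $F$ and is not a zero of $\nabla'F$; (ii) the remaining critical points of $H$ (those that are not local minima) are exactly the zeros of $\nabla'F$, and they are exactly the local maxima and the saddle points of $H$. The remaining critical points of $H$ have expected density $5/3$; the local maxima of $H$ have expected density $1/3$ and the saddle points of $H$ have expected density $4/3$. In the same normalization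 the zeros of $F$ have expected density $1$. The same holds for the spectrogram of white noise with Gaussian window, because it is equal to $H$: let $g(t)=2^{1/4}e^{-\pi t^2}$, let $$h_r(t)=\frac{2^{1/4}}{\sqrt{r!}}\Big(\frac{-1}{2\sqrt\pi}\Big)^r e^{\pi t^2}\frac{d^r}{dt^r}\big(e^{-2\pi t^2}\big)\qquad(r\ge 0)$$ be the Hermite functions, and let $V_gf(x+i\xi)=\int_{\mathbb R}f(t)\overline{g(t-x)}e^{-2\pi i\xi t}\,dt$. Then almost surely, for all $z\in\mathbb C$, the series $\sum_k a_kV_gh_k(\bar z/\sqrt\pi)$ (the short-time Fourier transform at $\bar z/\sqrt\pi$ of the white noise $\sum_k a_kh_k$) converges and $\big|\sum_k a_kV_gh_k(\bar z/\sqrt\pi)\big|^2=H(z)$. -/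

import Mathlib

open MeasureTheory ProbabilityTheory
open scoped ENNReal NNReal ComplexConjugate

noncomputable section

namespace GEF

/-- The standard complex Gaussian law `N_ℂ(0,1)`: real and imaginary part are independent centred
real Gaussians of variance `1/2`. -/
def stdComplexGaussian : Measure ℂ :=
  ((gaussianReal 0 (1 / 2)).prod (gaussianReal 0 (1 / 2))).map
    (fun p : ℝ × ℝ => (⟨p.1, p.2⟩ : ℂ))

/-- The `k`-th term `c k * z ^ k / √(k!)` of the series of the Gaussian entire function. -/
def term (c : ℕ → ℂ) (z : ℂ) (k : ℕ) : ℂ :=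
  c k * z ^ k / ((Real.sqrt (k.factorial : ℝ) : ℝ) : ℂ)

/-- The sum `F(z) = ∑ₖ c k * z ^ k / √(k!)`. -/
def F (c : ℕ → ℂ) (z : ℂ) : ℂ := ∑' k, term c z k

/-- `H(z) = |F(z)|² exp(-|z|²)`. -/
def H (c : ℕ → ℂ) (z : ℂ) : ℝ := ‖F c z‖ ^ 2 * Real.exp (-‖z‖ ^ 2)

/-- The Wirtinger derivative `∂_z f = (∂_x f - i ∂_y f) / 2`. -/
def wirtinger (f : ℂ → ℂ) (z : ℂ) : ℂ :=
  (fderiv ℝ f z 1 - Complex.I * fderiv ℝ f z Complex.I) / 2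

/-- The translation-invariant derivative `∇' f = ∂_z f - z̄ f`. -/
def chernDeriv (f : ℂ → ℂ) (z : ℂ) : ℂ := wirtinger f z - conj z * f z

/-- `z` is a critical point of `h`: `h` is (real) differentiable at `z` with zero derivative. -/
def IsCriticalPoint (h : ℂ → ℝ) (z : ℂ) : Prop := HasFDerivAt h (0 : ℂ →L[ℝ] ℝ) z

/-- A saddle point: a critical point that is neither a local maximum nor a local minimum. -/
def IsSaddlePoint (h : ℂ → ℝ) (z : ℂ) : Prop :=
  IsCriticalPoint h z ∧ ¬ IsLocalMax h z ∧ ¬ IsLocalMin h z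

/-- The reference measure `dν(z) = dz / π` on the plane. -/
def ν : Measure ℂ := (ENNReal.ofReal Real.pi)⁻¹ • (volume : Measure ℂ)

/-- The random set `X` has the one-point intensity (expected density) `ρ` with respect to `ν`: for
each Borel set `B`, the number of points of `X` in `B` is a random variable with expectation
`∫_B ρ dν`. -/
def HasIntensity {Ω : Type*} [MeasurableSpace Ω] (P : Measure Ω) (X : Ω → Set ℂ)
    (ρ : ℂ → ℝ≥0∞) : Prop :=
  ∀ B : Set ℂ, MeasurableSet B →
    AEMeasurable (fun ω => ((X ω ∩ B).encard : ℝ≥0∞)) P ∧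
      ∫⁻ ω, ((X ω ∩ B).encard : ℝ≥0∞) ∂P = ∫⁻ z in B, ρ z ∂ν

/-- The short-time Fourier transform `V_g f (x, ξ)` at `w = x + i ξ`. -/
def stft (g f : ℝ → ℂ) (w : ℂ) : ℂ :=
  ∫ t : ℝ, f t * conj (g (t - w.re)) *
    Complex.exp (-2 * (Real.pi : ℂ) * Complex.I * (w.im : ℂ) * (t : ℂ))

/-- The `L²`-normalized Gaussian window `g(t) = 2^{1/4} exp(-π t²)`. -/
def gaussWindow (t : ℝ) : ℝ := (2 : ℝ) ^ (1 / 4 : ℝ) * Real.exp (-Real.pi * t ^ 2)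

/-- The `r`-th Hermite function, normalized in `L²`. -/
def hermiteFn (r : ℕ) (t : ℝ) : ℝ :=
  (2 : ℝ) ^ (1 / 4 : ℝ) / Real.sqrt (r.factorial : ℝ) * (-1 / (2 * Real.sqrt Real.pi)) ^ r *
    Real.exp (Real.pi * t ^ 2) *
    iteratedDeriv r (fun s : ℝ => Real.exp (-2 * Real.pi * s ^ 2)) t

/-- The `k`-th term of the short-time Fourier transform with window `g` of the white noise
`∑ₖ c k * h_k`, evaluated at `z̄ / √π`. -/
def whiteNoiseTerm (c : ℕ → ℂ) (z : ℂ) (k : ℕ) : ℂ :=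
  c k * stft (fun t => (gaussWindow t : ℂ)) (fun t => (hermiteFn k t : ℂ))
    (conj z / ((Real.sqrt Real.pi : ℝ) : ℂ))

/-- The spectrogram of white noise with Gaussian window, in the coordinate `z`. -/
def spectrogram (c : ℕ → ℂ) (z : ℂ) : ℝ := ‖∑' k, whiteNoiseTerm c z k‖ ^ 2

end GEF

end

noncomputable section

namespace GEF

/-! ### Sequences of at most exponential growth and the entire functions they define -/

/-! Critical points. The differential of `H` at `z` is h ↦ 2 exp(-|z|²) Re(∇'F(z) · conj F(z) · h),
so a critical point is a zero of F, where H = 0 is minimal, or a zero of ∇'F. At a zero of ∇'F with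
F(z) ≠ 0, the holomorphic function F(z+h) exp(-z̄h)/F(z) equals 1 + κh²/2 + o(h²) with κ =
∇'∇'F(z)/F(z), whence H(z+h)/H(z) = 1 + Re(κh²) - |h|² + o(|h|²) (`H_add_isLittleO`). Some direction
makes κh² nonpositive, so z is never a local minimum; it is a local maximum if |κ| < 1 and a saddle
if |κ| > 1. Simplicity of the zeros of F and |κ| ≠ 1 hold almost surely.

Densities. The Kac-Rice formula is obtained by randomizing the coefficient a₀ alone. Both F and ∇'F
have the form U = v(z) a₀ + (terms in the other coefficients), so with the others fixed the zeros of
U away from the origin are the points where the map `level` takes the value a₀. The area formula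
with multiplicities (`lintegral_encard_fiber_mul`) turns the expected count into an integral of the
Jacobian of `level` against the Gaussian density. Averaging over the other coefficients yields a
conditional expectation on U = 0, identified by continuity in the level u
(`lintegral_conditional_density`). Sard's theorem for the same map gives the almost sure
nondegeneracy (`IsKacRice.ae_nondegenerate`).

The local law (`map_jet`): at each z, the values (F, ∇'F, ∇'∇'F) are distributed as exp(|z|²/2) (N₀,
N₁, √2 N₂) with independent standard complex Gaussians. At a zero of ∇'F the Jacobian of `level` is
|∇'∇'F|² - |F|² up to the factor |v|⁻². Hence maxima have density E(|N₀|² - 2|N₂|²)₊ = E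
exp(-2|N₂|²) = 1/3, saddles have density E(2|N₂|² - |N₀|²)₊ = 1/3 + 2 - 1 = 4/3, and zeros of F have
density E|N₁|² = 1.

Spectrogram. Repeated integration by parts in the short-time Fourier transform of a Hermite function
gives z^k/√(k!) times a factor independent of k, whose squared modulus is exp(-|z|²)
(`whiteNoiseTerm_eq`). -/

/-- The sequence `c` grows at most exponentially. -/
def ExpBounded (c : ℕ → ℂ) : Prop := ∃ C r : ℝ, 0 ≤ C ∧ 0 ≤ r ∧ ∀ k, ‖c k‖ ≤ C * r ^ k

/-- The coefficient sequence of the derivative of `F c`. -/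
def derivCoeff (c : ℕ → ℂ) (k : ℕ) : ℂ := ((Real.sqrt ((k : ℝ) + 1) : ℝ) : ℂ) * c (k + 1)

/-- Prepend a coefficient. -/
def cons (x : ℂ) (c : ℕ → ℂ) : ℕ → ℂ
  | 0 => x
  | k + 1 => c k

/-- The value at `z` of the translation-invariant derivative of `F c`. -/
def chern1 (c : ℕ → ℂ) (z : ℂ) : ℂ := F (derivCoeff c) z - conj z * F c z

/-- The value at `z` of the second translation-invariant derivative of `F c`. -/
def chern2 (c : ℕ → ℂ) (z : ℂ) : ℂ :=
  F (derivCoeff (derivCoeff c)) z - 2 * conj z * F (derivCoeff c) z + conj z ^ 2 * F c z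

lemma sqrt_factorial_pos (k : ℕ) : 0 < Real.sqrt (k.factorial : ℝ) :=
  Real.sqrt_pos.2 (by exact_mod_cast k.factorial_pos)

/-- By the arithmetic-geometric mean inequality: the modulus of the term is the product of (1/2)^k
and (2|x|)^k/√(k!), hence at most half the sum of their squares, which belong to a geometric and an
exponential series. -/
lemma summable_pow_div_sqrt_factorial (x : ℝ) :
    Summable fun k : ℕ => x ^ k / Real.sqrt (k.factorial : ℝ) := by
  have h1 : Summable fun k : ℕ => ((1 / 4 : ℝ) ^ k + (4 * x ^ 2) ^ k / (k.factorial : ℝ)) / 2 :=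
    ((summable_geometric_of_lt_one (by norm_num) (by norm_num)).add
      (Real.summable_pow_div_factorial _)).div_const 2
  refine Summable.of_norm_bounded h1 fun k => ?_
  have hs := sqrt_factorial_pos k
  have hsq : Real.sqrt (k.factorial : ℝ) ^ 2 = k.factorial := Real.sq_sqrt (by positivity)
  have e1 : ‖x ^ k / Real.sqrt (k.factorial : ℝ)‖ =
      (1 / 2 : ℝ) ^ k * ((2 * |x|) ^ k / Real.sqrt (k.factorial : ℝ)) := by
    rw [norm_div, norm_pow, Real.norm_eq_abs, Real.norm_eq_abs, abs_of_pos hs, mul_pow]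
    rw [mul_div_assoc', ← mul_assoc, ← mul_pow]
    norm_num
  have e2 : (1 / 4 : ℝ) ^ k = ((1 / 2 : ℝ) ^ k) ^ 2 := by rw [← pow_mul, mul_comm, pow_mul]; norm_num
  have e3 : (4 * x ^ 2) ^ k / (k.factorial : ℝ) =
      ((2 * |x|) ^ k / Real.sqrt (k.factorial : ℝ)) ^ 2 := by
    rw [div_pow, hsq, ← pow_mul, mul_comm k 2, pow_mul, mul_pow 2 |x| 2, sq_abs]; norm_num
  rw [e1, e2, e3]
  nlinarith [sq_nonneg ((1 / 2 : ℝ) ^ k - (2 * |x|) ^ k / Real.sqrt (k.factorial : ℝ))]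

lemma norm_term (c : ℕ → ℂ) (z : ℂ) (k : ℕ) :
    ‖term c z k‖ = ‖c k‖ * ‖z‖ ^ k / Real.sqrt (k.factorial : ℝ) := by
  rw [term, norm_div, norm_mul, norm_pow, Complex.norm_real, Real.norm_eq_abs,
    abs_of_pos (sqrt_factorial_pos k)]

lemma ExpBounded.exists_norm_term_le {c : ℕ → ℂ} (hc : ExpBounded c) (R : ℝ) :
    ∃ u : ℕ → ℝ, Summable u ∧ ∀ k z, ‖z‖ ≤ R → ‖term c z k‖ ≤ u k := by
  obtain ⟨C, r, hC, hr, h⟩ := hc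
  refine ⟨fun k => C * ((r * R) ^ k / Real.sqrt (k.factorial : ℝ)),
    (summable_pow_div_sqrt_factorial _).mul_left C, fun k z hz => ?_⟩
  rw [norm_term]
  beta_reduce
  rw [mul_div_assoc', mul_pow, ← mul_assoc]
  have hR : 0 ≤ R := (norm_nonneg z).trans hz
  gcongr
  exact h k

lemma ExpBounded.summable_term {c : ℕ → ℂ} (hc : ExpBounded c) (z : ℂ) : Summable (term c z) := by
  obtain ⟨u, hu, h⟩ := hc.exists_norm_term_le ‖z‖
  exact Summable.of_norm_bounded hu fun k => h k z le_rfl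

lemma ExpBounded.derivCoeff {c : ℕ → ℂ} (hc : ExpBounded c) : ExpBounded (derivCoeff c) := by
  obtain ⟨C, r, hC, hr, h⟩ := hc
  refine ⟨C * r, 2 * r, by positivity, by positivity, fun k => ?_⟩
  rw [GEF.derivCoeff, norm_mul, Complex.norm_real, Real.norm_eq_abs, abs_of_nonneg (Real.sqrt_nonneg _)]
  have h1 : Real.sqrt ((k : ℝ) + 1) ≤ 2 ^ k := by
    rw [Real.sqrt_le_left (by positivity)]
    have h2 : (k : ℝ) + 1 ≤ 2 ^ k := by exact_mod_cast Nat.lt_two_pow_self (n := k)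
    have h3 : (1 : ℝ) ≤ 2 ^ k := one_le_pow₀ (by norm_num)
    nlinarith
  calc _ ≤ 2 ^ k * (C * r ^ (k + 1)) := by gcongr; exact h _
    _ = _ := by rw [mul_pow]; ring

lemma ExpBounded.cons {c : ℕ → ℂ} (hc : ExpBounded c) (x : ℂ) : ExpBounded (cons x c) := by
  obtain ⟨C, r, hC, hr, h⟩ := hc
  refine ⟨C + ‖x‖, r + 1, by positivity, by positivity, fun k => ?_⟩
  have h1 : (1 : ℝ) ≤ (r + 1) ^ k := one_le_pow₀ (by linarith)
  cases k with
  | zero => simp [GEF.cons, hC]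
  | succ k =>
    have h2 : r ^ k ≤ (r + 1) ^ (k + 1) :=
      (pow_le_pow_left₀ hr (by linarith) k).trans
        (pow_le_pow_right₀ (by linarith) (Nat.le_succ k))
    calc ‖c k‖ ≤ C * r ^ k := h k
      _ ≤ (C + ‖x‖) * (r + 1) ^ (k + 1) :=
        mul_le_mul (by linarith [norm_nonneg x]) h2 (by positivity) (by positivity)

lemma expBounded_zero : ExpBounded (fun _ => 0) := ⟨0, 0, le_rfl, le_rfl, by simp⟩

lemma hasDerivAt_F {c : ℕ → ℂ} (hc : ExpBounded c) (z : ℂ) :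
    HasDerivAt (F c) (F (derivCoeff c) z) z := by
  let g' : ℕ → ℂ → ℂ := fun n y =>
    c n * (n * y ^ (n - 1)) / ((Real.sqrt (n.factorial : ℝ) : ℝ) : ℂ)
  have hg' : ∀ k y, g' (k + 1) y = term (derivCoeff c) y k := by
    intro k y
    have h1 : (0 : ℝ) < (k : ℝ) + 1 := by positivity
    have hs : Real.sqrt ((k + 1).factorial : ℝ) = Real.sqrt ((k : ℝ) + 1) * Real.sqrt k.factorial := by
      rw [Nat.factorial_succ]; push_cast; rw [Real.sqrt_mul h1.le]
    have hk : ((k : ℂ) + 1) = ((Real.sqrt ((k : ℝ) + 1) : ℝ) : ℂ) * ((Real.sqrt ((k : ℝ) + 1) : ℝ) : ℂ) := by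
      rw [← Complex.ofReal_mul, Real.mul_self_sqrt h1.le]; push_cast; rfl
    have hne : ((Real.sqrt ((k : ℝ) + 1) : ℝ) : ℂ) ≠ 0 := by
      exact_mod_cast (Real.sqrt_pos.2 h1).ne'
    have hne' : ((Real.sqrt (k.factorial : ℝ) : ℝ) : ℂ) ≠ 0 := by
      exact_mod_cast (sqrt_factorial_pos k).ne'
    simp only [g', term, GEF.derivCoeff, hs, Nat.add_sub_cancel]
    push_cast
    rw [hk]
    field_simp
  obtain ⟨u, hu, hle⟩ := hc.derivCoeff.exists_norm_term_le (‖z‖ + 1)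
  -- The constant term has zero derivative, so the majorant of the differentiated series is the one
  -- of `derivCoeff` moved up by one index.
  let v : ℕ → ℝ := fun n => if n = 0 then 0 else u (n - 1)
  have hv : Summable v := by
    rw [← summable_nat_add_iff 1]
    simpa [v] using hu
  have key := hasDerivAt_tsum_of_isPreconnected (𝕜 := ℂ) (g := fun n y => term c y n) (g' := g')
    hv (Metric.isOpen_ball (x := (0 : ℂ)) (ε := ‖z‖ + 1)) (convex_ball _ _).isPreconnected
    (y₀ := z) (y := z) ?_ ?_ (by simp) (hc.summable_term z) (by simp)
  · have h0 : ∑' n, g' n z = F (derivCoeff c) z := by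
      have hsum : Summable fun n => g' n z := by
        rw [← summable_nat_add_iff 1]
        simpa only [hg'] using hc.derivCoeff.summable_term z
      rw [hsum.tsum_eq_zero_add]
      simp only [hg']
      simp [g', F]
    rw [h0] at key
    exact key
  · intro n y _
    exact ((hasDerivAt_pow n y).const_mul (c n)).div_const _
  · intro n y hy
    cases n with
    | zero => simp [g', v]
    | succ k =>
      rw [hg']
      simpa [v] using hle k y (by simpa using (Metric.mem_ball.1 hy).le)

lemma continuous_F {c : ℕ → ℂ} (hc : ExpBounded c) : Continuous (F c) :=
  continuous_iff_continuousAt.2 fun z => (hasDerivAt_F hc z).continuousAt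

lemma continuous_chern1 {c : ℕ → ℂ} (hc : ExpBounded c) : Continuous (chern1 c) :=
  (continuous_F hc.derivCoeff).sub (Complex.continuous_conj.mul (continuous_F hc))

lemma continuous_chern2 {c : ℕ → ℂ} (hc : ExpBounded c) : Continuous (chern2 c) :=
  ((continuous_F hc.derivCoeff.derivCoeff).sub
    ((continuous_const.mul Complex.continuous_conj).mul (continuous_F hc.derivCoeff))).add
    ((Complex.continuous_conj.pow 2).mul (continuous_F hc))

lemma chernDeriv_F {c : ℕ → ℂ} (hc : ExpBounded c) (z : ℂ) :
    chernDeriv (F c) z = chern1 c z := by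
  have h := (hasDerivAt_F hc z).hasFDerivAt.restrictScalars ℝ
  rw [chernDeriv, wirtinger, h.fderiv, chern1]
  simp only [ContinuousLinearMap.coe_restrictScalars', ContinuousLinearMap.toSpanSingleton_apply,
    smul_eq_mul]
  linear_combination (-(1 / 2) * F (derivCoeff c) z) * Complex.I_mul_I

lemma tsum_term_cons {c : ℕ → ℂ} (hc : ExpBounded c) (x z : ℂ) :
    F (cons x c) z = x + ∑' k, term (cons 0 c) z (k + 1) := by
  rw [F, (hc.cons x).summable_term z |>.tsum_eq_zero_add]
  simp [term, cons]

lemma F_cons {c : ℕ → ℂ} (hc : ExpBounded c) (x z : ℂ) :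
    F (cons x c) z = x + F (cons 0 c) z := by
  rw [tsum_term_cons hc, tsum_term_cons hc 0, zero_add]

lemma derivCoeff_cons (x : ℂ) (c : ℕ → ℂ) : derivCoeff (cons x c) = derivCoeff (cons 0 c) := rfl

lemma chern1_cons {c : ℕ → ℂ} (hc : ExpBounded c) (x z : ℂ) :
    chern1 (cons x c) z = -conj z * x + chern1 (cons 0 c) z := by
  rw [chern1, chern1, F_cons hc, derivCoeff_cons]; ring

lemma chern2_cons {c : ℕ → ℂ} (hc : ExpBounded c) (x z : ℂ) :
    chern2 (cons x c) z = conj z ^ 2 * x + chern2 (cons 0 c) z := by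
  rw [chern2, chern2, F_cons hc, derivCoeff_cons]; ring

/-! ### Critical points of `H` -/

lemma hasFDerivAt_H {c : ℕ → ℂ} (hc : ExpBounded c) (z : ℂ) :
    ∃ L : ℂ →L[ℝ] ℝ, HasFDerivAt (H c) L z ∧
      ∀ h, L h = 2 * Real.exp (-‖z‖ ^ 2) * (chern1 c z * conj (F c z) * h).re := by
  have h1 := ((hasDerivAt_F hc z).hasFDerivAt.restrictScalars ℝ).norm_sq
  have h2 := ((hasFDerivAt_id (𝕜 := ℝ) z).norm_sq).neg.exp
  refine ⟨_, h1.mul h2, fun h => ?_⟩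
  have h3 : ‖F c z‖ ^ 2 = (F c z).re ^ 2 + (F c z).im ^ 2 := by
    rw [← Complex.normSq_eq_norm_sq, Complex.normSq_apply]; ring
  simp [chern1, h3]
  ring

lemma isCriticalPoint_H_iff {c : ℕ → ℂ} (hc : ExpBounded c) (z : ℂ) :
    IsCriticalPoint (H c) z ↔ chern1 c z = 0 ∨ F c z = 0 := by
  obtain ⟨L, hL, hL'⟩ := hasFDerivAt_H hc z
  have e : IsCriticalPoint (H c) z ↔ L = 0 := by
    constructor
    · intro h; exact hL.unique h
    · rintro rfl; exact hL
  rw [e]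
  constructor
  · intro h0
    -- Evaluating at the conjugate of the coefficient makes the real part equal to its squared
    -- modulus.
    have h1 := hL' (conj (chern1 c z * conj (F c z)))
    rw [h0, Complex.mul_conj] at h1
    simp only [zero_apply, Complex.ofReal_re, zero_eq_mul] at h1
    have h2 : Complex.normSq (chern1 c z * conj (F c z)) = 0 := by
      rcases h1 with h | h
      · exact absurd h (by positivity)
      · exact h
    rw [Complex.normSq_eq_zero, mul_eq_zero] at h2
    simpa using h2
  · intro h0
    ext h
    rw [hL']
    rcases h0 with h | h <;> simp [h]

lemma H_nonneg (c : ℕ → ℂ) (z : ℂ) : 0 ≤ H c z := by unfold H; positivity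

lemma H_eq_zero {c : ℕ → ℂ} {z : ℂ} : H c z = 0 ↔ F c z = 0 := by
  simp [H, Real.exp_ne_zero]

lemma isLocalMin_H_of_F_eq_zero {c : ℕ → ℂ} {z : ℂ} (h : F c z = 0) : IsLocalMin (H c) z := by
  refine Filter.Eventually.of_forall fun w => ?_
  rw [H_eq_zero.2 h]; exact H_nonneg c w

end GEF

end

noncomputable section

namespace GEF

open Filter Topology Asymptotics

/-! ### Second order expansion of `H` at the zeros of `chern1` -/

lemma isLittleO_second_order {f g : ℂ → ℂ} {κ : ℂ} (hf : ∀ h, HasDerivAt f (g h) h)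
    (hg : HasDerivAt g κ 0) (hg0 : g 0 = 0) :
    (fun h => f h - f 0 - κ * h ^ 2 / 2) =o[𝓝 0] fun h => ‖h‖ ^ 2 := by
  have h1 : (fun h => g h - κ * h) =o[𝓝 0] fun h => h := by
    have := hg.isLittleO
    simpa [hg0, mul_comm] using this
  rw [isLittleO_iff] at h1 ⊢
  intro ε hε
  obtain ⟨δ, hδ, hb⟩ := Metric.eventually_nhds_iff_ball.1 (h1 hε)
  refine Metric.eventually_nhds_iff_ball.2 ⟨δ, hδ, fun h hh => ?_⟩
  rw [mem_ball_zero_iff] at hh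
  -- The derivative of φ is o(w), so the mean value inequality on the ball of radius ‖h‖ bounds the
  -- increment of φ by ε‖h‖².
  let φ : ℂ → ℂ := fun w => f w - κ * w ^ 2 / 2
  have hφ : ∀ w, HasDerivAt φ (g w - κ * w) w := by
    intro w
    have := (hf w).sub (((hasDerivAt_pow 2 w).const_mul κ).div_const 2)
    refine this.congr_deriv ?_
    simp; ring
  have key := (convex_closedBall (0 : ℂ) ‖h‖).norm_image_sub_le_of_norm_hasDerivWithin_le
    (f := φ) (C := ε * ‖h‖) (x := 0) (y := h) (fun w _ => (hφ w).hasDerivWithinAt) ?_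
    (by simp) (by simp)
  · simp only [φ] at key
    rw [Real.norm_eq_abs, abs_of_nonneg (by positivity)]
    calc _ = ‖f h - κ * h ^ 2 / 2 - (f 0 - κ * 0 ^ 2 / 2)‖ := by congr 1; ring
      _ ≤ _ := key
      _ = _ := by rw [sub_zero]; ring
  · intro w hw
    rw [mem_closedBall_zero_iff] at hw
    calc _ ≤ ε * ‖w‖ := hb w (by rw [mem_ball_zero_iff]; linarith)
      _ ≤ ε * ‖h‖ := by gcongr

/-- The cross term 2 Re(z̄h) in |z+h|² is absorbed into the squared modulus of the holomorphic
factor exp(-z̄h). This is what makes ∇' the natural derivative here. -/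
lemma H_add (c : ℕ → ℂ) (z h : ℂ) (hF : F c z ≠ 0) :
    H c (z + h) = H c z * (‖F c (z + h) * Complex.exp (-(conj z * h)) / F c z‖ ^ 2 *
      Real.exp (-‖h‖ ^ 2)) := by
  have h0 : ‖F c z‖ ≠ 0 := norm_ne_zero_iff.2 hF
  have hn : ‖z + h‖ ^ 2 = ‖z‖ ^ 2 + 2 * (conj z * h).re + ‖h‖ ^ 2 := by
    rw [← Complex.normSq_eq_norm_sq, ← Complex.normSq_eq_norm_sq, ← Complex.normSq_eq_norm_sq,
      Complex.normSq_apply, Complex.normSq_apply, Complex.normSq_apply]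
    simp; ring
  have e : Real.exp (-‖z + h‖ ^ 2) =
      Real.exp (-‖z‖ ^ 2) * Real.exp (-(conj z * h).re) ^ 2 * Real.exp (-‖h‖ ^ 2) := by
    rw [hn, sq (Real.exp _), ← Real.exp_add, ← Real.exp_add, ← Real.exp_add]
    congr 1; ring
  rw [H, H, norm_div, norm_mul, Complex.norm_exp, Complex.neg_re, e]
  field_simp

/-- The holomorphic factor f of `H_add` has f(0) = 1, derivative ∇'F(z)/F(z) = 0 and second
derivative κ at 0. The expansion of |f|² = 1 + 2 Re(f - 1) + |f - 1|² is multiplied by that of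
exp(-|h|²). -/
lemma H_add_isLittleO {c : ℕ → ℂ} (hc : ExpBounded c) {z : ℂ} (hF : F c z ≠ 0)
    (hG : chern1 c z = 0) :
    (fun h => H c (z + h) / H c z - 1 -
      ((chern2 c z / F c z * h ^ 2).re - ‖h‖ ^ 2)) =o[𝓝 0] fun h : ℂ => ‖h‖ ^ 2 := by
  set κ := chern2 c z / F c z with hκ
  have hH : H c z ≠ 0 := fun h => hF (H_eq_zero.1 h)
  let f : ℂ → ℂ := fun h => F c (z + h) * Complex.exp (-(conj z * h)) / F c z
  let g : ℂ → ℂ := fun h =>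
    (F (derivCoeff c) (z + h) - conj z * F c (z + h)) * Complex.exp (-(conj z * h)) / F c z
  have hE : ∀ h, HasDerivAt (fun h : ℂ => Complex.exp (-(conj z * h)))
      (Complex.exp (-(conj z * h)) * -(conj z)) h := fun h => by
    have := ((hasDerivAt_id h).const_mul (conj z)).neg.cexp
    simpa using this
  have hFs : ∀ {c : ℕ → ℂ}, ExpBounded c → ∀ h,
      HasDerivAt (fun h => F c (z + h)) (F (derivCoeff c) (z + h)) h :=
    fun hc h => by simpa using (hasDerivAt_F hc (z + h)).comp_const_add z h
  have hf : ∀ h, HasDerivAt f (g h) h := fun h => by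
    refine (((hFs hc h).mul (hE h)).div_const (F c z)).congr_deriv ?_
    simp only [g]; ring
  have hg : HasDerivAt g κ 0 := by
    refine (((((hFs hc.derivCoeff 0).sub ((hFs hc 0).const_mul (conj z)))).mul
      (hE 0)).div_const (F c z)).congr_deriv ?_
    simp [hκ, chern2]
    ring
  have hg0 : g 0 = 0 := by simpa [g, chern1] using Or.inl hG
  have hf0 : f 0 = 1 := by simp [f, hF]
  have ho := isLittleO_second_order hf hg hg0
  rw [hf0] at ho
  set e : ℂ → ℂ := fun h => f h - 1 - κ * h ^ 2 / 2 with he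
  have hsq : (fun h : ℂ => κ * h ^ 2) =O[𝓝 0] fun h : ℂ => ‖h‖ ^ 2 :=
    IsBigO.of_bound ‖κ‖ (Eventually.of_forall fun h => by simp)
  have hu : (fun h => f h - 1) =O[𝓝 0] fun h : ℂ => ‖h‖ ^ 2 := by
    have : (fun h => f h - 1) = fun h => e h + (1 / 2 : ℂ) * (κ * h ^ 2) := by
      ext h; simp only [he]; ring
    rw [this]
    exact ho.isBigO.add (hsq.const_mul_left _)
  have hn0 : Tendsto (fun h : ℂ => ‖h‖ ^ 2) (𝓝 0) (𝓝 0) := by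
    have : Continuous fun h : ℂ => ‖h‖ ^ 2 := by fun_prop
    simpa using this.tendsto 0
  have hsmall : (fun h : ℂ => ‖h‖ ^ 2 * ‖h‖ ^ 2) =o[𝓝 0] fun h : ℂ => ‖h‖ ^ 2 := by
    have h1 : (fun h : ℂ => ‖h‖ ^ 2) =o[𝓝 0] fun _ : ℂ => (1 : ℝ) := (isLittleO_one_iff ℝ).2 hn0
    simpa using h1.mul_isBigO (isBigO_refl (fun h : ℂ => ‖h‖ ^ 2) (𝓝 0))
  -- the factor `‖f‖²`
  have hA : (fun h => ‖f h‖ ^ 2 - 1 - (κ * h ^ 2).re) =o[𝓝 0] fun h : ℂ => ‖h‖ ^ 2 := by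
    have e1 : (fun h => ‖f h‖ ^ 2 - 1 - (κ * h ^ 2).re) =
        fun h => 2 * (e h).re + ‖f h - 1‖ * ‖f h - 1‖ := by
      ext h
      simp only [he, ← sq, ← Complex.normSq_eq_norm_sq]
      rw [Complex.normSq_apply, Complex.normSq_apply]
      simp
      ring
    rw [e1]
    refine IsLittleO.add (IsLittleO.const_mul_left ?_ _) ?_
    · exact IsBigO.trans_isLittleO
        (IsBigO.of_bound 1 (Eventually.of_forall fun h => by
          simpa using Complex.abs_re_le_norm (e h))) ho
    · exact (hu.norm_left.mul hu.norm_left).trans_isLittleO hsmall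
  -- the Gaussian factor
  have hB : (fun h : ℂ => Real.exp (-‖h‖ ^ 2) - 1 + ‖h‖ ^ 2) =o[𝓝 0] fun h : ℂ => ‖h‖ ^ 2 := by
    have h1 := (Real.hasDerivAt_exp 0).isLittleO
    have h2 := h1.comp_tendsto (k := fun h : ℂ => -‖h‖ ^ 2) (by simpa using hn0.neg)
    simp only [Function.comp_def] at h2
    have h3 := h2.trans_isBigO (IsBigO.of_bound (g := fun h : ℂ => ‖h‖ ^ 2) 1
      (Eventually.of_forall fun h => by simp))
    refine h3.congr_left fun h => ?_
    simp
  have hA' : (fun h => ‖f h‖ ^ 2 - 1) =O[𝓝 0] fun h : ℂ => ‖h‖ ^ 2 := by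
    have : (fun h => (κ * h ^ 2).re) =O[𝓝 0] fun h : ℂ => ‖h‖ ^ 2 :=
      (IsBigO.of_bound 1 (Eventually.of_forall fun h => by
        rw [one_mul]; exact Complex.abs_re_le_norm (κ * h ^ 2))).trans hsq
    simpa using hA.isBigO.add this
  have hB' : (fun h : ℂ => Real.exp (-‖h‖ ^ 2) - 1) =O[𝓝 0] fun h : ℂ => ‖h‖ ^ 2 := by
    simpa using hB.isBigO.sub (isBigO_refl (fun h : ℂ => ‖h‖ ^ 2) (𝓝 0))
  -- The product of the two deviations from 1 has order ‖h‖⁴.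
  have hAB := (hA'.mul hB').trans_isLittleO hsmall
  refine ((hA.add hB).add hAB).congr_left fun h => ?_
  rw [H_add c z h hF, mul_div_cancel_left₀ _ hH]
  simp only [f]
  ring

lemma eventually_along {c : ℕ → ℂ} (hc : ExpBounded c) {z : ℂ} (hF : F c z ≠ 0)
    (hG : chern1 c z = 0) {u : ℂ} (hu : ‖u‖ = 1) {ε : ℝ} (hε : 0 < ε) :
    ∀ᶠ t : ℝ in 𝓝[>] 0, |H c (z + t * u) / H c z - 1 -
      ((chern2 c z / F c z * u ^ 2).re - 1) * t ^ 2| ≤ ε * t ^ 2 := by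
  have h1 := (H_add_isLittleO hc hF hG).bound hε
  have ht : Tendsto (fun t : ℝ => (t : ℂ) * u) (𝓝[>] 0) (𝓝 0) := by
    have : Continuous fun t : ℝ => (t : ℂ) * u := by fun_prop
    simpa using (this.tendsto 0).mono_left nhdsWithin_le_nhds
  filter_upwards [ht.eventually h1] with t h2
  have e1 : ‖(t : ℂ) * u‖ ^ 2 = t ^ 2 := by simp [hu]
  have e2 : (chern2 c z / F c z * ((t : ℂ) * u) ^ 2).re =
      (chern2 c z / F c z * u ^ 2).re * t ^ 2 := by
    rw [mul_pow, mul_left_comm, ← Complex.ofReal_pow, Complex.re_ofReal_mul, mul_comm]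
  rw [e1, e2, Real.norm_eq_abs, Real.norm_eq_abs, abs_of_nonneg (sq_nonneg t)] at h2
  convert h2 using 2
  ring

lemma H_pos {c : ℕ → ℂ} {z : ℂ} (hF : F c z ≠ 0) : 0 < H c z :=
  (H_nonneg c z).lt_of_ne fun h => hF (H_eq_zero.1 h.symm)

lemma tendsto_add_mul (z u : ℂ) : Tendsto (fun t : ℝ => z + t * u) (𝓝[>] 0) (𝓝 z) := by
  have : Continuous fun t : ℝ => z + (t : ℂ) * u := by fun_prop
  simpa using (this.tendsto 0).mono_left nhdsWithin_le_nhds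

lemma not_isLocalMin_of_re_lt {c : ℕ → ℂ} (hc : ExpBounded c) {z : ℂ} (hF : F c z ≠ 0)
    (hG : chern1 c z = 0) {u : ℂ} (hu : ‖u‖ = 1) (h : (chern2 c z / F c z * u ^ 2).re < 1) :
    ¬ IsLocalMin (H c) z := by
  intro hmin
  have h1 := eventually_along hc hF hG hu (ε := (1 - (chern2 c z / F c z * u ^ 2).re) / 2)
    (by linarith)
  obtain ⟨t, ⟨ht1, ht2⟩, ht3⟩ := ((h1.and ((tendsto_add_mul z u).eventually hmin)).and
    self_mem_nhdsWithin).exists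
  have hH := H_pos hF
  have h4 : 1 ≤ H c (z + t * u) / H c z := by rwa [le_div_iff₀ hH, one_mul]
  have h5 := le_of_abs_le ht1
  have h6 : 0 < t ^ 2 := by have : 0 < t := ht3; positivity
  nlinarith

lemma not_isLocalMax_of_lt_re {c : ℕ → ℂ} (hc : ExpBounded c) {z : ℂ} (hF : F c z ≠ 0)
    (hG : chern1 c z = 0) {u : ℂ} (hu : ‖u‖ = 1) (h : 1 < (chern2 c z / F c z * u ^ 2).re) :
    ¬ IsLocalMax (H c) z := by
  intro hmax
  have h1 := eventually_along hc hF hG hu (ε := ((chern2 c z / F c z * u ^ 2).re - 1) / 2)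
    (by linarith)
  obtain ⟨t, ⟨ht1, ht2⟩, ht3⟩ := ((h1.and ((tendsto_add_mul z u).eventually hmax)).and
    self_mem_nhdsWithin).exists
  have hH := H_pos hF
  have h4 : H c (z + t * u) / H c z ≤ 1 := by rwa [div_le_iff₀ hH, one_mul]
  have h5 := neg_le_of_abs_le ht1
  have h6 : 0 < t ^ 2 := by have : 0 < t := ht3; positivity
  nlinarith

lemma exists_norm_eq_one_mul_sq (κ : ℂ) : ∃ u : ℂ, ‖u‖ = 1 ∧ κ * u ^ 2 = (‖κ‖ : ℂ) := by
  by_cases hκ : κ = 0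
  · exact ⟨1, by simp, by simp [hκ]⟩
  · obtain ⟨u, hu⟩ := IsAlgClosed.exists_pow_nat_eq ((‖κ‖ : ℂ) / κ) (n := 2) (by norm_num)
    refine ⟨u, ?_, by rw [hu]; field_simp⟩
    have h1 : ‖u‖ ^ 2 = 1 := by rw [← norm_pow, hu]; simp [hκ]
    exact (pow_eq_one_iff_of_nonneg (norm_nonneg u) two_ne_zero).1 h1

/-- Turning by a right angle the direction u with κu² = |κ| changes the sign, and -|κ| < 1 whatever
κ is. -/
lemma not_isLocalMin_of_chern1_eq_zero {c : ℕ → ℂ} (hc : ExpBounded c) {z : ℂ} (hF : F c z ≠ 0)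
    (hG : chern1 c z = 0) : ¬ IsLocalMin (H c) z := by
  obtain ⟨u, hu, hκ⟩ := exists_norm_eq_one_mul_sq (chern2 c z / F c z)
  refine not_isLocalMin_of_re_lt hc hF hG (u := Complex.I * u) (by simp [hu]) ?_
  rw [mul_pow, Complex.I_sq, neg_one_mul, mul_neg, hκ, Complex.neg_re, Complex.ofReal_re]
  linarith [norm_nonneg (chern2 c z / F c z)]

lemma not_isLocalMax_of_norm_lt {c : ℕ → ℂ} (hc : ExpBounded c) {z : ℂ} (hF : F c z ≠ 0)
    (hG : chern1 c z = 0) (h : ‖F c z‖ < ‖chern2 c z‖) : ¬ IsLocalMax (H c) z := by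
  obtain ⟨u, hu, hκ⟩ := exists_norm_eq_one_mul_sq (chern2 c z / F c z)
  refine not_isLocalMax_of_lt_re hc hF hG hu ?_
  rwa [hκ, Complex.ofReal_re, norm_div, one_lt_div (norm_pos_iff.2 hF)]

lemma isLocalMax_of_norm_lt {c : ℕ → ℂ} (hc : ExpBounded c) {z : ℂ}
    (hG : chern1 c z = 0) (h : ‖chern2 c z‖ < ‖F c z‖) : IsLocalMax (H c) z := by
  have hF : F c z ≠ 0 := norm_pos_iff.1 ((norm_nonneg _).trans_lt h)
  have hκ : ‖chern2 c z / F c z‖ < 1 := by rwa [norm_div, div_lt_one (norm_pos_iff.2 hF)]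
  have h1 := (H_add_isLittleO hc hF hG).bound (sub_pos.2 hκ)
  have ht : Tendsto (fun w : ℂ => w - z) (𝓝 z) (𝓝 0) := by
    have : Continuous fun w : ℂ => w - z := by fun_prop
    simpa using this.tendsto z
  filter_upwards [ht.eventually h1] with w hw
  rw [add_sub_cancel, Real.norm_eq_abs, Real.norm_eq_abs, abs_of_nonneg (sq_nonneg ‖w - z‖)] at hw
  have h2 := le_of_abs_le hw
  have h3 : (chern2 c z / F c z * (w - z) ^ 2).re ≤ ‖chern2 c z / F c z‖ * ‖w - z‖ ^ 2 := by
    refine (Complex.re_le_norm _).trans ?_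
    rw [norm_mul, norm_pow]
  have h4 : H c w / H c z ≤ 1 := by nlinarith
  rwa [div_le_iff₀ (H_pos hF), one_mul] at h4

/-! ### Classification of the critical points of a generic function -/

lemma chern1_eq_of_F_eq_zero {c : ℕ → ℂ} {z : ℂ} (h : F c z = 0) :
    chern1 c z = F (derivCoeff c) z := by simp [chern1, h]

lemma criticalPoint_not_localMin_iff {c : ℕ → ℂ} (hc : ExpBounded c)
    (hsimple : ∀ z, F c z = 0 → chern1 c z ≠ 0) (z : ℂ) :
    (IsCriticalPoint (H c) z ∧ ¬ IsLocalMin (H c) z) ↔ chern1 c z = 0 := by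
  rw [isCriticalPoint_H_iff hc]
  constructor
  · rintro ⟨h | h, h'⟩
    · exact h
    · exact absurd (isLocalMin_H_of_F_eq_zero h) h'
  · intro h
    exact ⟨Or.inl h, not_isLocalMin_of_chern1_eq_zero hc (fun h0 => hsimple z h0 h) h⟩

lemma isCriticalPoint_of_isLocalExtr {c : ℕ → ℂ} (hc : ExpBounded c) {z : ℂ}
    (h : IsLocalExtr (H c) z) : IsCriticalPoint (H c) z := by
  obtain ⟨L, hL, -⟩ := hasFDerivAt_H hc z
  have := h.hasFDerivAt_eq_zero hL
  rwa [this] at hL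

lemma F_eq_zero_of_isLocalMin {c : ℕ → ℂ} (hc : ExpBounded c) {z : ℂ}
    (h : IsLocalMin (H c) z) : F c z = 0 := by
  by_contra hF
  rcases (isCriticalPoint_H_iff hc z).1 (isCriticalPoint_of_isLocalExtr hc h.isExtr) with h1 | h1
  · exact not_isLocalMin_of_chern1_eq_zero hc hF h1 h
  · exact hF h1

/-- If F also vanished at z, the nonnegative function H would vanish near z, hence so would F, and
its derivative at z would be zero. -/
lemma chern1_eq_zero_of_isLocalMax {c : ℕ → ℂ} (hc : ExpBounded c) {z : ℂ}
    (h : IsLocalMax (H c) z) : chern1 c z = 0 := by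
  by_cases hF : F c z = 0
  · have h1 : F c =ᶠ[𝓝 z] fun _ => 0 := by
      filter_upwards [h] with w hw
      rw [H_eq_zero.2 hF] at hw
      exact H_eq_zero.1 (le_antisymm hw (H_nonneg c w))
    have h2 := (hasDerivAt_F hc z).deriv
    rw [h1.deriv_eq, deriv_const] at h2
    rw [chern1_eq_of_F_eq_zero hF, ← h2]
  · exact ((isCriticalPoint_H_iff hc z).1 (isCriticalPoint_of_isLocalExtr hc h.isExtr)).resolve_right hF

lemma criticalPoint_not_localMin_iff_max_or_saddle {c : ℕ → ℂ} (hc : ExpBounded c)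
    (hsimple : ∀ z, F c z = 0 → chern1 c z ≠ 0) (z : ℂ) :
    (IsCriticalPoint (H c) z ∧ ¬ IsLocalMin (H c) z) ↔
      (IsLocalMax (H c) z ∨ IsSaddlePoint (H c) z) := by
  constructor
  · rintro ⟨h1, h2⟩
    by_cases h : IsLocalMax (H c) z
    · exact Or.inl h
    · exact Or.inr ⟨h1, h, h2⟩
  · rintro (h | h)
    · exact (criticalPoint_not_localMin_iff hc hsimple z).2 (chern1_eq_zero_of_isLocalMax hc h)
    · exact ⟨h.1, h.2.2⟩

lemma isLocalMax_iff {c : ℕ → ℂ} (hc : ExpBounded c)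
    (hsimple : ∀ z, F c z = 0 → chern1 c z ≠ 0)
    (hnondeg : ∀ z, chern1 c z = 0 → ‖F c z‖ ≠ ‖chern2 c z‖) (z : ℂ) :
    IsLocalMax (H c) z ↔ chern1 c z = 0 ∧ ‖chern2 c z‖ < ‖F c z‖ := by
  constructor
  · intro h
    have h1 := chern1_eq_zero_of_isLocalMax hc h
    refine ⟨h1, lt_of_not_ge fun h2 => ?_⟩
    exact not_isLocalMax_of_norm_lt hc (fun h0 => hsimple z h0 h1) h1
      (h2.lt_of_ne (hnondeg z h1)) h
  · rintro ⟨h1, h2⟩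
    exact isLocalMax_of_norm_lt hc h1 h2

lemma isSaddlePoint_iff {c : ℕ → ℂ} (hc : ExpBounded c)
    (hsimple : ∀ z, F c z = 0 → chern1 c z ≠ 0)
    (hnondeg : ∀ z, chern1 c z = 0 → ‖F c z‖ ≠ ‖chern2 c z‖) (z : ℂ) :
    IsSaddlePoint (H c) z ↔ chern1 c z = 0 ∧ ‖F c z‖ < ‖chern2 c z‖ := by
  constructor
  · rintro ⟨h1, h2, h3⟩
    have h4 := (criticalPoint_not_localMin_iff hc hsimple z).1 ⟨h1, h3⟩
    exact ⟨h4, lt_of_le_of_ne (not_lt.1 fun h5 => h2 (isLocalMax_of_norm_lt hc h4 h5))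
      (hnondeg z h4)⟩
  · rintro ⟨h1, h2⟩
    have h3 := (criticalPoint_not_localMin_iff hc hsimple z).2 h1
    exact ⟨h3.1, not_isLocalMax_of_norm_lt hc (fun h0 => hsimple z h0 h1) h1 h2, h3.2⟩

end GEF

end

noncomputable section

namespace GEF

open Set Filter Topology

/-! ### The area formula with multiplicities -/

section AreaFormula

variable {E : Type*} [NormedAddCommGroup E] [NormedSpace ℝ E] [FiniteDimensional ℝ E]

/-- A map closer to an invertible A than the reciprocal of ‖A⁻¹‖ is injective; half of that
reciprocal is used. A value of r is supplied for singular A too, because the partition theorem needs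
a tolerance for every linear map. -/
lemma exists_injOn_of_approximatesLinearOn (f : E → E) (A : E →L[ℝ] E) :
    ∃ r : ℝ≥0, r ≠ 0 ∧ (A.det ≠ 0 → ∀ t, ApproximatesLinearOn f A t r → InjOn f t) := by
  by_cases hA : A.det = 0
  · exact ⟨1, one_ne_zero, fun h => absurd hA h⟩
  · let B := A.toContinuousLinearEquivOfDetNeZero hA
    rcases B.subsingleton_or_nnnorm_symm_pos with h | h
    · exact ⟨1, one_ne_zero, fun _ t _ => fun x _ y _ _ => Subsingleton.elim x y⟩
    · refine ⟨‖(B.symm : E →L[ℝ] E)‖₊⁻¹ / 2, by positivity, fun _ t ht => ?_⟩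
      have ht' : ApproximatesLinearOn f (B : E →L[ℝ] E) t (‖(B.symm : E →L[ℝ] E)‖₊⁻¹ / 2) := ht
      exact ht'.injOn (Or.inr (NNReal.half_lt_self (by positivity)))

/-- The set s splits into countably many measurable pieces on which f is injective. Each fibre meets
a piece in at most one point, so its cardinality is the number of images of pieces containing w, and
the injective change of variables is summed over the pieces. -/
lemma lintegral_encard_fiber_mul [MeasurableSpace E] [BorelSpace E] (μ : Measure E)
    [μ.IsAddHaarMeasure] {f : E → E} {f' : E → E →L[ℝ] E} {s : Set E} (hs : MeasurableSet s)
    (hf' : ∀ x ∈ s, HasFDerivWithinAt f (f' x) s x) (hdet : ∀ x ∈ s, (f' x).det ≠ 0)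
    {g : E → ℝ≥0∞} (hg : Measurable g) :
    ∫⁻ w, ((s ∩ f ⁻¹' {w}).encard : ℝ≥0∞) * g w ∂μ =
      ∫⁻ x in s, ENNReal.ofReal |(f' x).det| * g (f x) ∂μ := by
  rcases s.eq_empty_or_nonempty with rfl | hne
  · simp
  choose r hr0 hr using exists_injOn_of_approximatesLinearOn f
  obtain ⟨t, A, htd, htm, hst, hA, hA'⟩ :=
    exists_partition_approximatesLinearOn_of_hasFDerivWithinAt f s f' hf' r hr0
  have hinj : ∀ n, InjOn f (s ∩ t n) := fun n => by
    obtain ⟨y, hy, e⟩ := hA' hne n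
    exact hr (A n) (e ▸ hdet y hy) _ (hA n)
  have hms : ∀ n, MeasurableSet (s ∩ t n) := fun n => hs.inter (htm n)
  have hder : ∀ n, ∀ x ∈ s ∩ t n, HasFDerivWithinAt f (f' x) (s ∩ t n) x :=
    fun n x hx => (hf' x hx.1).mono inter_subset_left
  have hdisj : Pairwise (Function.onFun Disjoint fun n => s ∩ t n) := fun i j hij =>
    (htd hij).mono inter_subset_right inter_subset_right
  have hU : s = ⋃ n, s ∩ t n := by rw [← inter_iUnion]; exact (inter_eq_left.2 hst).symm
  have hsub : ∀ n w, (s ∩ t n ∩ f ⁻¹' {w}).Subsingleton := fun n w x hx y hy =>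
    hinj n hx.1 hy.1 (by rw [hx.2, hy.2])
  have hone : ∀ n w, Measure.count (s ∩ t n ∩ f ⁻¹' {w}) = (f '' (s ∩ t n)).indicator 1 w := by
    intro n w
    rw [Measure.count_apply (hsub n w).measurableSet]
    by_cases hw : w ∈ f '' (s ∩ t n)
    · obtain ⟨x, hx, rfl⟩ := hw
      have : s ∩ t n ∩ f ⁻¹' {f x} = {x} := (hsub n (f x)).eq_singleton_of_mem ⟨hx, rfl⟩
      rw [this, indicator_of_mem (mem_image_of_mem f hx)]; simp
    · have : s ∩ t n ∩ f ⁻¹' {w} = ∅ := by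
        rw [eq_empty_iff_forall_notMem]
        exact fun x hx => hw ⟨x, hx.1, hx.2⟩
      rw [this, indicator_of_notMem hw]; simp
  have hcount : ∀ w, ((s ∩ f ⁻¹' {w}).encard : ℝ≥0∞) =
      ∑' n, (f '' (s ∩ t n)).indicator 1 w := by
    intro w
    have e : s ∩ f ⁻¹' {w} = ⋃ n, s ∩ t n ∩ f ⁻¹' {w} := by rw [← iUnion_inter, ← hU]
    have hm : MeasurableSet (s ∩ f ⁻¹' {w}) := by
      rw [e]; exact MeasurableSet.iUnion fun n => (hsub n w).measurableSet
    rw [← Measure.count_apply hm, e, measure_iUnion _ fun n => (hsub n w).measurableSet]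
    · simp only [hone]
    · exact fun i j hij => (hdisj hij).mono inter_subset_left inter_subset_left
  have him : ∀ n, MeasurableSet (f '' (s ∩ t n)) := fun n =>
    measurable_image_of_fderivWithin (hms n) (hder n) (hinj n)
  simp only [hcount, ← ENNReal.tsum_mul_right]
  have hmul : ∀ n, Measurable fun w => (f '' (s ∩ t n)).indicator 1 w * g w := fun n =>
    (measurable_one.indicator (him n)).mul hg
  rw [lintegral_tsum fun n => (hmul n).aemeasurable]
  conv_rhs => rw [hU, lintegral_iUnion hms hdisj]
  congr 1; ext n
  rw [← lintegral_image_eq_lintegral_abs_det_fderiv_mul μ (hms n) (hder n) (hinj n),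
    ← lintegral_indicator (him n)]
  congr 1; ext w
  by_cases hw : w ∈ f '' (s ∩ t n) <;> simp [hw]

end AreaFormula

/-! ### Measurability of the number of points of a random set -/

section Counting

variable {T : Type*} [MeasurableSpace T]

lemma exists_injective_of_le_encard {α : Type*} {s : Set α} {m : ℕ} (h : (m : ℕ∞) ≤ s.encard) :
    ∃ x : Fin m → α, Function.Injective x ∧ ∀ i, x i ∈ s := by
  obtain ⟨t, hts, ht⟩ := exists_subset_encard_eq h
  have hfin : t.Finite := finite_of_encard_eq_coe ht
  have hcard : hfin.toFinset.card = m := by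
    rw [hfin.encard_eq_coe_toFinset_card] at ht; exact_mod_cast ht
  let e := hfin.toFinset.equivFinOfCardEq hcard
  exact ⟨fun i => (e.symm i : α), Subtype.val_injective.comp e.symm.injective,
    fun i => hts (hfin.mem_toFinset.1 (e.symm i).2)⟩

lemma le_encard_of_injective {α : Type*} {s : Set α} {m : ℕ} {x : Fin m → α}
    (hx : Function.Injective x) (h : ∀ i, x i ∈ s) : (m : ℕ∞) ≤ s.encard := by
  have := hx.encard_range
  rw [ENat.card_eq_coe_fintype_card, Fintype.card_fin] at this
  exact this.trans (encard_le_encard (range_subset_iff.2 h))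

/-- The number of points of a random subset of the plane in an open set is measurable as soon as
the hitting events of compact sets are. -/
lemma measurable_encard_inter {A : T → Set ℂ}
    (hA : ∀ K : Set ℂ, IsCompact K → MeasurableSet {t | (A t ∩ K).Nonempty})
    {B : Set ℂ} (hB : IsOpen B) : Measurable fun t => ((A t ∩ B).encard : ℝ≥0∞) := by
  let K : ℕ × ℕ → Set ℂ := fun p =>
    Metric.closedBall (TopologicalSpace.denseSeq ℂ p.1) (1 / ((p.2 : ℝ) + 1))
  -- Having at least m points is a countable union of finite intersections of hitting events, for
  -- disjoint closed balls in B taken from a countable family.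
  have key : ∀ (m : ℕ) (t : T), (m : ℕ∞) ≤ (A t ∩ B).encard ↔
      ∃ p : Fin m → ℕ × ℕ, ((∀ i j, i ≠ j → Disjoint (K (p i)) (K (p j))) ∧ ∀ i, K (p i) ⊆ B) ∧
        ∀ i, (A t ∩ K (p i)).Nonempty := by
    intro m t
    constructor
    · intro h
      obtain ⟨x, hx, hxA⟩ := exists_injective_of_le_encard h
      have hlim : ∀ a : ℝ, Tendsto (fun n : ℕ => a * (1 / ((n : ℝ) + 1))) atTop (𝓝 0) :=
        fun a => by simpa using (tendsto_one_div_add_atTop_nhds_zero_nat (𝕜 := ℝ)).const_mul a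
      have h1 : ∀ᶠ n : ℕ in atTop, ∀ i, Metric.closedBall (x i) (2 * (1 / ((n : ℝ) + 1))) ⊆ B := by
        refine eventually_all.2 fun i => ?_
        obtain ⟨ε, hε, hεB⟩ := Metric.isOpen_iff.1 hB (x i) (hxA i).2
        filter_upwards [(hlim 2).eventually (gt_mem_nhds hε)] with n hn
        exact (Metric.closedBall_subset_ball hn).trans hεB
      -- A ball of radius ε = 1/(n+1) about a dense point within ε of x i lies in the ball of radius
      -- 2ε about x i; separation 4ε makes these larger balls disjoint.
      have h2 : ∀ᶠ n : ℕ in atTop, ∀ i j, i ≠ j → 4 * (1 / ((n : ℝ) + 1)) < dist (x i) (x j) := by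
        refine eventually_all.2 fun i => eventually_all.2 fun j => ?_
        by_cases hij : i = j
        · simp [hij]
        · filter_upwards [(hlim 4).eventually (gt_mem_nhds (dist_pos.2 (hx.ne hij)))] with n hn _
          exact hn
      obtain ⟨n, hn1, hn2⟩ := (h1.and h2).exists
      have hpos : (0 : ℝ) < 1 / ((n : ℝ) + 1) := by positivity
      choose q hq using fun i => (TopologicalSpace.denseRange_denseSeq ℂ).exists_dist_lt (x i) hpos
      have hsub : ∀ i, K (q i, n) ⊆ Metric.closedBall (x i) (2 * (1 / ((n : ℝ) + 1))) := by
        intro i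
        refine Metric.closedBall_subset_closedBall' ?_
        have := hq i
        rw [dist_comm] at this
        simp only
        linarith
      refine ⟨fun i => (q i, n), ⟨fun i j hij => ?_, fun i => (hsub i).trans (hn1 i)⟩, fun i =>
        ⟨x i, (hxA i).1, (hq i).le⟩⟩
      refine Disjoint.mono (hsub i) (hsub j) (Metric.closedBall_disjoint_closedBall ?_)
      have := hn2 i j hij
      linarith
    · rintro ⟨p, ⟨hd, hpB⟩, hp⟩
      choose y hyA hyK using hp
      refine le_encard_of_injective (x := y) (fun i j hij => ?_) fun i => ⟨hyA i, hpB i (hyK i)⟩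
      by_contra hne
      exact disjoint_left.1 (hd i j hne) (hyK i) (hij ▸ hyK j)
  have hmeas : ∀ m : ℕ, MeasurableSet {t | (m : ℕ∞) ≤ (A t ∩ B).encard} := by
    intro m
    have e : {t | (m : ℕ∞) ≤ (A t ∩ B).encard} = ⋃ p : Fin m → ℕ × ℕ,
        ⋃ _ : (∀ i j, i ≠ j → Disjoint (K (p i)) (K (p j))) ∧ ∀ i, K (p i) ⊆ B,
          ⋂ i, {t | (A t ∩ K (p i)).Nonempty} := by
      ext t
      simp only [mem_ofPred_eq, key, mem_iUnion, mem_iInter, exists_prop]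
    rw [e]
    exact MeasurableSet.iUnion fun p => MeasurableSet.iUnion fun _ => MeasurableSet.iInter fun i =>
      hA _ (isCompact_closedBall _ _)
  have e : (fun t => ((A t ∩ B).encard : ℝ≥0∞)) = fun t => ⨆ m : ℕ,
      {t | (m : ℕ∞) ≤ (A t ∩ B).encard}.indicator (fun _ => (m : ℝ≥0∞)) t := by
    ext t
    refine le_antisymm ?_ (iSup_le fun m => ?_)
    · by_cases h : (A t ∩ B).encard = ⊤
      · rw [h, ENat.toENNReal_top, ← ENNReal.iSup_natCast]
        refine iSup_mono fun m => ?_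
        rw [indicator_of_mem (by simp [h])]
      · obtain ⟨m, hm⟩ := ENat.ne_top_iff_exists.1 h
        refine le_iSup_of_le m ?_
        rw [indicator_of_mem (by simp [hm]), ← hm]
        simp
    · by_cases h : t ∈ {t | (m : ℕ∞) ≤ (A t ∩ B).encard}
      · rw [indicator_of_mem h]
        have h' : (m : ℕ∞) ≤ (A t ∩ B).encard := h
        have := ENat.toENNReal_le.2 h'
        simpa using this
      · rw [indicator_of_notMem h]; exact zero_le
  rw [e]
  exact Measurable.iSup fun m => measurable_const.indicator (hmeas m)

/-- On a compact set, a continuous function has a zero if and only if its modulus becomes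
arbitrarily small along a countable dense subset, and the latter event is measurable. -/
lemma measurableSet_exists_zero {Z : T → ℂ → ℝ} (hc : ∀ t, Continuous (Z t))
    (hm : ∀ z, Measurable fun t => Z t z) {K : Set ℂ} (hK : IsCompact K) :
    MeasurableSet {t | ∃ z ∈ K, Z t z = 0} := by
  rcases K.eq_empty_or_nonempty with rfl | hne
  · simp
  have : Nonempty K := hne.to_subtype
  have e : {t | ∃ z ∈ K, Z t z = 0} =
      ⋂ n : ℕ, ⋃ i : ℕ, {t | |Z t (TopologicalSpace.denseSeq K i)| < 1 / ((n : ℝ) + 1)} := by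
    ext t
    simp only [mem_ofPred_eq, mem_iInter, mem_iUnion]
    constructor
    · rintro ⟨z, hz, h0⟩ n
      have ho : IsOpen {w : K | |Z t w| < 1 / ((n : ℝ) + 1)} :=
        isOpen_lt ((hc t).comp continuous_subtype_val).abs continuous_const
      exact (TopologicalSpace.denseRange_denseSeq K).exists_mem_open ho
        ⟨⟨z, hz⟩, by simp only [mem_ofPred_eq, h0, abs_zero]; positivity⟩
    · intro h
      obtain ⟨z, hz, hmin⟩ := hK.exists_isMinOn hne (hc t).abs.continuousOn
      refine ⟨z, hz, ?_⟩
      by_contra h0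
      obtain ⟨n, hn⟩ := exists_nat_one_div_lt (abs_pos.2 h0)
      obtain ⟨i, hi⟩ := h n
      have := isMinOn_iff.1 hmin _ (TopologicalSpace.denseSeq K i).2
      linarith
  rw [e]
  exact MeasurableSet.iInter fun n => MeasurableSet.iUnion fun i =>
    measurableSet_lt (continuous_abs.measurable.comp (hm _)) measurable_const

/-- The strict inequality is the union over n of the closed conditions D ≥ 1/(n+1), each of which
combines with U = 0 into the vanishing of one continuous nonnegative function. -/
lemma measurableSet_zero_pos_inter_nonempty {U : T → ℂ → ℂ} {D : T → ℂ → ℝ}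
    (hU : ∀ t, Continuous (U t)) (hUm : ∀ z, Measurable fun t => U t z)
    (hD : ∀ t, Continuous (D t)) (hDm : ∀ z, Measurable fun t => D t z)
    {K : Set ℂ} (hK : IsCompact K) :
    MeasurableSet {t | ({z | U t z = 0 ∧ 0 < D t z} ∩ K).Nonempty} := by
  have e : {t | ({z | U t z = 0 ∧ 0 < D t z} ∩ K).Nonempty} =
      ⋃ n : ℕ, {t | ∃ z ∈ K, ‖U t z‖ + max (1 / ((n : ℝ) + 1) - D t z) 0 = 0} := by
    ext t
    simp only [mem_ofPred_eq, mem_iUnion]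
    constructor
    · rintro ⟨z, ⟨h0, hpos⟩, hz⟩
      obtain ⟨n, hn⟩ := exists_nat_one_div_lt hpos
      refine ⟨n, z, hz, ?_⟩
      rw [h0, norm_zero, zero_add, max_eq_right (by linarith)]
    · rintro ⟨n, z, hz, h⟩
      have h1 := norm_nonneg (U t z)
      have h2 := le_max_right (1 / ((n : ℝ) + 1) - D t z) 0
      have h3 := le_max_left (1 / ((n : ℝ) + 1) - D t z) 0
      have h4 : (0 : ℝ) < 1 / ((n : ℝ) + 1) := by positivity
      exact ⟨z, ⟨norm_eq_zero.1 (by linarith), by linarith⟩, hz⟩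
  rw [e]
  refine MeasurableSet.iUnion fun n => measurableSet_exists_zero (fun t => ?_) (fun z => ?_) hK
  · exact (hU t).norm.add ((continuous_const.sub (hD t)).max continuous_const)
  · exact (hUm z).norm.add ((measurable_const.sub (hDm z)).max measurable_const)

end Counting

/-! ### From open sets to Borel sets -/

section Intensity

variable {T : Type*} [MeasurableSpace T]

instance : IsFiniteMeasureOnCompacts ν :=
  ⟨fun K hK => by
    rw [ν, Measure.smul_apply, smul_eq_mul]
    exact ENNReal.mul_lt_top (by simp [Real.pi_pos]) hK.measure_lt_top⟩

/-- A π-λ argument from open to Borel sets inside each ball, followed by monotone convergence along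
balls exhausting the plane. Only almost everywhere measurability survives complements. -/
lemma hasIntensity_of_isOpen {P : Measure T} [IsProbabilityMeasure P] {X : T → Set ℂ} {ρ : ℝ≥0}
    (hX : ∀ t, MeasurableSet (X t))
    (hm : ∀ B, IsOpen B → Measurable fun t => ((X t ∩ B).encard : ℝ≥0∞))
    (hE : ∀ B, IsOpen B → ∫⁻ t, ((X t ∩ B).encard : ℝ≥0∞) ∂P = ρ * ν B) :
    HasIntensity P X (fun _ => ρ) := by
  have hcount : ∀ t B, MeasurableSet B →
      ((X t ∩ B).encard : ℝ≥0∞) = Measure.count.restrict (X t) B := fun t B hB => by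
    rw [Measure.restrict_apply hB, inter_comm, Measure.count_apply (hB.inter (hX t))]
  set N : T → Measure ℂ := fun t => Measure.count.restrict (X t) with hN
  have hbdd : ∀ n : ℕ, ∀ B, MeasurableSet B → AEMeasurable (fun t => N t (B ∩ Metric.ball 0 n)) P ∧
      ∫⁻ t, N t (B ∩ Metric.ball 0 n) ∂P = ρ * ν (B ∩ Metric.ball 0 n) := by
    intro n
    set W : Set ℂ := Metric.ball 0 n with hW
    have hWo : IsOpen W := Metric.isOpen_ball
    have hfinν : ∀ B, ν (B ∩ W) ≠ ∞ := fun B =>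
      ((measure_mono (inter_subset_right.trans Metric.ball_subset_closedBall)).trans_lt
        (isCompact_closedBall (0 : ℂ) n).measure_lt_top).ne
    have hopen : ∀ B, IsOpen B → Measurable (fun t => N t B) ∧ ∫⁻ t, N t B ∂P = ρ * ν B := by
      intro B hB
      have e : (fun t => N t B) = fun t => ((X t ∩ B).encard : ℝ≥0∞) := by
        ext t; rw [hcount t B hB.measurableSet]
      exact ⟨e ▸ hm B hB, by rw [e]; exact hE B hB⟩
    -- The complement step subtracts counts, which requires finiteness; the finite expectation in a
    -- ball provides it almost surely.
    have hfin : ∀ᵐ t ∂P, N t W < ∞ := by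
      refine ae_lt_top (hopen W hWo).1 ?_
      rw [(hopen W hWo).2]
      have := hfinν univ
      rw [univ_inter] at this
      exact ENNReal.mul_ne_top ENNReal.coe_ne_top this
    intro B hB
    induction B, hB using MeasurableSpace.induction_on_inter
      ((BorelSpace.measurable_eq (α := ℂ)).trans rfl) isPiSystem_isOpen with
    | empty => simp
    | basic B hB =>
      have hB' : IsOpen B := hB
      exact ⟨(hopen _ (hB'.inter hWo)).1.aemeasurable, (hopen _ (hB'.inter hWo)).2⟩
    | compl B hB ih =>
      have e : Bᶜ ∩ W = W \ (B ∩ W) := by ext x; simp; tauto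
      have e1 : ∀ᵐ t ∂P, N t (Bᶜ ∩ W) = N t W - N t (B ∩ W) := by
        filter_upwards [hfin] with t ht
        rw [e, measure_sdiff inter_subset_right (hB.inter hWo.measurableSet).nullMeasurableSet
          ((measure_mono inter_subset_right).trans_lt ht).ne]
      refine ⟨((hopen W hWo).1.aemeasurable.sub ih.1).congr (e1.mono fun t h => h.symm), ?_⟩
      rw [lintegral_congr_ae e1, lintegral_sub' ih.1 (by
          rw [ih.2]; exact ENNReal.mul_ne_top ENNReal.coe_ne_top (hfinν B))
        (Eventually.of_forall fun t => measure_mono inter_subset_right), (hopen W hWo).2, ih.2, e,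
        measure_sdiff inter_subset_right (hB.inter hWo.measurableSet).nullMeasurableSet (hfinν B),
        ENNReal.mul_sub fun _ _ => ENNReal.coe_ne_top]
    | iUnion f hd hf ih =>
      have hd' : Pairwise (Function.onFun Disjoint fun i => f i ∩ W) := fun i j hij =>
        (hd hij).mono inter_subset_left inter_subset_left
      have hf' : ∀ i, MeasurableSet (f i ∩ W) := fun i => (hf i).inter hWo.measurableSet
      simp only [iUnion_inter, measure_iUnion hd' hf']
      refine ⟨AEMeasurable.tsum fun i => (ih i).1, ?_⟩
      rw [lintegral_tsum fun i => (ih i).1, ← ENNReal.tsum_mul_left]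
      simp only [(ih _).2]
  intro B hB
  have hmono : Monotone fun n : ℕ => B ∩ Metric.ball (0 : ℂ) n := fun m n hmn =>
    inter_subset_inter_right _ (Metric.ball_subset_ball (by exact_mod_cast hmn))
  have hU : B = ⋃ n : ℕ, B ∩ Metric.ball (0 : ℂ) n := by
    rw [← inter_iUnion, Metric.iUnion_ball_nat, inter_univ]
  have e : (fun t => ((X t ∩ B).encard : ℝ≥0∞)) = fun t => ⨆ n : ℕ, N t (B ∩ Metric.ball 0 n) := by
    ext t
    rw [hcount t B hB]
    conv_lhs => rw [hU]
    exact hmono.measure_iUnion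
  rw [e]
  refine ⟨AEMeasurable.iSup fun n => (hbdd n B hB).1, ?_⟩
  rw [lintegral_iSup' (fun n => (hbdd n B hB).1)
    (Eventually.of_forall fun t m n hmn => measure_mono (hmono hmn))]
  simp only [(hbdd _ B hB).2]
  rw [← ENNReal.mul_iSup, ← hmono.measure_iUnion, ← hU, setLIntegral_const]

end Intensity

end GEF

end

noncomputable section

namespace GEF

open Set Filter Topology

/-! ### The standard complex Gaussian law -/

/-- The Lebesgue density of the standard complex Gaussian law. -/
def gaussDensity (z : ℂ) : ℝ := Real.exp (-‖z‖ ^ 2) / Real.pi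

lemma gaussDensity_nonneg (z : ℂ) : 0 ≤ gaussDensity z := by
  have := Real.pi_pos
  unfold gaussDensity; positivity

lemma continuous_gaussDensity : Continuous gaussDensity := by unfold gaussDensity; fun_prop

lemma measurable_complex_mk : Measurable fun p : ℝ × ℝ => (⟨p.1, p.2⟩ : ℂ) :=
  Complex.measurableEquivRealProd.symm.measurable

instance : IsProbabilityMeasure stdComplexGaussian :=
  Measure.isProbabilityMeasure_map measurable_complex_mk.aemeasurable

lemma stdComplexGaussian_eq :
    stdComplexGaussian = volume.withDensity fun z => ENNReal.ofReal (gaussDensity z) := by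
  have hv : (1 / 2 : ℝ≥0) ≠ 0 := by norm_num
  have hpdf : ∀ p : ℝ × ℝ, gaussianPDF 0 (1 / 2) p.1 * gaussianPDF 0 (1 / 2) p.2 =
      ENNReal.ofReal (gaussDensity ⟨p.1, p.2⟩) := by
    intro p
    rw [gaussianPDF, gaussianPDF, ← ENNReal.ofReal_mul (gaussianPDFReal_nonneg _ _ _)]
    congr 1
    have e : ‖(⟨p.1, p.2⟩ : ℂ)‖ ^ 2 = p.1 ^ 2 + p.2 ^ 2 := by
      rw [← Complex.normSq_eq_norm_sq, Complex.normSq_apply]; ring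
    have h2 : Real.sqrt (2 * Real.pi * ((1 / 2 : ℝ≥0) : ℝ)) = Real.sqrt Real.pi := by
      congr 1; push_cast; ring
    rw [gaussianPDFReal, gaussianPDFReal, gaussDensity, e, h2, mul_mul_mul_comm, ← mul_inv,
      Real.mul_self_sqrt Real.pi_pos.le, ← Real.exp_add, div_eq_mul_inv, mul_comm]
    congr 2
    rw [show (2 : ℝ) * ((1 / 2 : ℝ≥0) : ℝ) = 1 by push_cast; norm_num]
    ring
  have hm : Measurable fun z : ℂ => ENNReal.ofReal (gaussDensity z) :=
    continuous_gaussDensity.measurable.ennreal_ofReal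
  rw [stdComplexGaussian, gaussianReal_of_var_ne_zero 0 hv,
    prod_withDensity (measurable_gaussianPDF _ _) (measurable_gaussianPDF _ _)]
  ext s hs
  rw [Measure.map_apply measurable_complex_mk hs,
    withDensity_apply _ (measurable_complex_mk hs), withDensity_apply _ hs]
  simp only [hpdf]
  exact (Complex.volume_preserving_equiv_real_prod.symm).setLIntegral_comp_preimage hs hm

lemma lintegral_stdComplexGaussian {f : ℂ → ℝ≥0∞} (hf : Measurable f) :
    ∫⁻ z, f z ∂stdComplexGaussian = ∫⁻ z, ENNReal.ofReal (gaussDensity z) * f z := by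
  rw [stdComplexGaussian_eq, lintegral_withDensity_eq_lintegral_mul _
    continuous_gaussDensity.measurable.ennreal_ofReal hf]
  rfl

lemma stdComplexGaussian_absolutelyContinuous : stdComplexGaussian ≪ volume := by
  rw [stdComplexGaussian_eq]; exact withDensity_absolutelyContinuous _ _

/-- Polar coordinates and the substitution t = r²: the squared modulus is exponentially distributed
with mean 1. -/
lemma lintegral_norm_sq_stdComplexGaussian {f : ℝ → ℝ≥0∞} (hf : Measurable f) :
    ∫⁻ z, f (‖z‖ ^ 2) ∂stdComplexGaussian = ∫⁻ t in Ioi 0, f t * ENNReal.ofReal (Real.exp (-t)) := by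
  have hpi := Real.pi_pos
  rw [lintegral_stdComplexGaussian (f := fun z => f (‖z‖ ^ 2)) (hf.comp (by fun_prop)), ← Complex.lintegral_comp_polarCoord_symm,
    polarCoord_target]
  have e1 : ∀ p : ℝ × ℝ, ENNReal.ofReal p.1 •
      (ENNReal.ofReal (gaussDensity (Complex.polarCoord.symm p)) *
        f (‖Complex.polarCoord.symm p‖ ^ 2)) =
      (ENNReal.ofReal p.1 * (ENNReal.ofReal (Real.exp (-p.1 ^ 2) / Real.pi) * f (p.1 ^ 2))) := by
    intro p
    rw [gaussDensity, Complex.norm_polarCoord_symm, sq_abs, smul_eq_mul]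
  simp only [e1]
  rw [Measure.volume_eq_prod, ← Measure.prod_restrict, lintegral_prod _ (by fun_prop)]
  simp only [lintegral_const, Measure.restrict_apply MeasurableSet.univ, univ_inter, Real.volume_Ioo]
  have him : (fun r : ℝ => r ^ 2) '' Ioi 0 = Ioi 0 := by
    ext t
    simp only [mem_image, mem_Ioi]
    constructor
    · rintro ⟨r, hr, rfl⟩; positivity
    · intro ht; exact ⟨Real.sqrt t, Real.sqrt_pos.2 ht, Real.sq_sqrt ht.le⟩
  conv_rhs => rw [← him]
  rw [lintegral_image_eq_lintegral_abs_deriv_mul (f := fun r : ℝ => r ^ 2) (f' := fun r => 2 * r)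
    measurableSet_Ioi (fun x _ => by simpa using (hasDerivAt_pow 2 x).hasDerivWithinAt)]
  · refine setLIntegral_congr_fun measurableSet_Ioi fun r hr => ?_
    have hr' : (0 : ℝ) < r := hr
    rw [abs_of_pos (by positivity), div_eq_mul_inv, ENNReal.ofReal_mul (Real.exp_pos _).le,
      ENNReal.ofReal_mul zero_le_two]
    have h3 : ENNReal.ofReal Real.pi⁻¹ * ENNReal.ofReal (Real.pi - -Real.pi) = ENNReal.ofReal 2 := by
      rw [← ENNReal.ofReal_mul (by positivity)]; congr 1; field_simp; ring
    calc _ = ENNReal.ofReal r * ENNReal.ofReal (Real.exp (-r ^ 2)) * f (r ^ 2) *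
          (ENNReal.ofReal Real.pi⁻¹ * ENNReal.ofReal (Real.pi - -Real.pi)) := by ring
      _ = _ := by rw [h3]; ring
  · intro x hx y hy hxy
    exact (sq_eq_sq₀ (le_of_lt hx) (le_of_lt hy)).1 hxy

lemma lintegral_mul_exp_neg : ∫⁻ t : ℝ in Ioi 0, ENNReal.ofReal t * ENNReal.ofReal (Real.exp (-t)) = 1 := by
  have h1 := Real.Gamma_eq_integral (s := 2) (by norm_num)
  have h2 := Real.GammaIntegral_convergent (s := 2) (by norm_num)
  have e : ∀ t : ℝ, Real.exp (-t) * t ^ ((2 : ℝ) - 1) = t * Real.exp (-t) := by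
    intro t; norm_num; ring
  simp only [e] at h1 h2
  rw [Real.Gamma_two] at h1
  have h3 := ofReal_integral_eq_lintegral_ofReal h2
    ((ae_restrict_iff' measurableSet_Ioi).2 (Eventually.of_forall fun t ht =>
      mul_nonneg (le_of_lt ht) (Real.exp_pos _).le))
  rw [← h1, ENNReal.ofReal_one] at h3
  rw [h3]
  refine setLIntegral_congr_fun measurableSet_Ioi fun t ht => ?_
  rw [ENNReal.ofReal_mul (le_of_lt ht)]

/-- The lack of memory of the exponential law. Since a ≥ 0, the integrand vanishes for t ≤ 0, so the
integral extends to the line, where it can be translated by a. -/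
lemma lintegral_sub_mul_exp_neg {a : ℝ} (ha : 0 ≤ a) :
    ∫⁻ t : ℝ in Ioi 0, ENNReal.ofReal (t - a) * ENNReal.ofReal (Real.exp (-t)) =
      ENNReal.ofReal (Real.exp (-a)) := by
  have full : ∀ b : ℝ, 0 ≤ b →
      ∫⁻ t : ℝ in Ioi 0, ENNReal.ofReal (t - b) * ENNReal.ofReal (Real.exp (-t)) =
      ∫⁻ t : ℝ, ENNReal.ofReal (t - b) * ENNReal.ofReal (Real.exp (-t)) := by
    intro b hb
    rw [← lintegral_indicator measurableSet_Ioi]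
    congr 1; ext t
    by_cases ht : t ∈ Ioi (0 : ℝ)
    · rw [indicator_of_mem ht]
    · have : t ≤ 0 := not_lt.1 ht
      rw [indicator_of_notMem ht, ENNReal.ofReal_of_nonpos (by linarith), zero_mul]
  have h0 := full 0 le_rfl
  simp only [sub_zero] at h0
  rw [full a ha]
  have h1 := lintegral_sub_right_eq_self (μ := (volume : Measure ℝ))
    (fun t : ℝ => ENNReal.ofReal t * ENNReal.ofReal (Real.exp (-(t + a)))) a
  simp only [sub_add_cancel] at h1
  rw [h1]
  have e : ∀ t : ℝ, ENNReal.ofReal t * ENNReal.ofReal (Real.exp (-(t + a))) =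
      ENNReal.ofReal t * ENNReal.ofReal (Real.exp (-t)) * ENNReal.ofReal (Real.exp (-a)) := by
    intro t
    rw [neg_add, Real.exp_add, ENNReal.ofReal_mul (Real.exp_pos _).le, mul_assoc]
  simp only [e]
  rw [lintegral_mul_const _ (by fun_prop), ← h0, lintegral_mul_exp_neg, one_mul]

lemma lintegral_exp_neg_three :
    ∫⁻ t : ℝ in Ioi 0, ENNReal.ofReal (Real.exp (-(2 * t))) * ENNReal.ofReal (Real.exp (-t)) = 1 / 3 := by
  have e : ∀ t : ℝ, ENNReal.ofReal (Real.exp (-(2 * t))) * ENNReal.ofReal (Real.exp (-t)) =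
      ENNReal.ofReal (Real.exp (-3 * t)) := by
    intro t
    rw [← ENNReal.ofReal_mul (Real.exp_pos _).le, ← Real.exp_add]
    congr 2; ring
  simp only [e]
  rw [← ofReal_integral_eq_lintegral_ofReal (integrableOn_exp_mul_Ioi (by norm_num) 0)
    (Eventually.of_forall fun t => (Real.exp_pos _).le), integral_exp_mul_Ioi (by norm_num)]
  norm_num
  rw [ENNReal.ofReal_div_of_pos (by norm_num)]
  simp

lemma lintegral_norm_sq : ∫⁻ z, ENNReal.ofReal (‖z‖ ^ 2) ∂stdComplexGaussian = 1 := by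
  rw [lintegral_norm_sq_stdComplexGaussian ENNReal.measurable_ofReal, lintegral_mul_exp_neg]

lemma lintegral_lintegral_norm_sq_sub_two :
    ∫⁻ y₂, ∫⁻ y₁, ENNReal.ofReal (‖y₁‖ ^ 2 - 2 * ‖y₂‖ ^ 2) ∂stdComplexGaussian ∂stdComplexGaussian
      = 1 / 3 := by
  have h : ∀ y₂ : ℂ, ∫⁻ y₁, ENNReal.ofReal (‖y₁‖ ^ 2 - 2 * ‖y₂‖ ^ 2) ∂stdComplexGaussian =
      ENNReal.ofReal (Real.exp (-(2 * ‖y₂‖ ^ 2))) := fun y₂ => by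
    rw [lintegral_norm_sq_stdComplexGaussian (f := fun t => ENNReal.ofReal (t - 2 * ‖y₂‖ ^ 2))
      (by fun_prop), lintegral_sub_mul_exp_neg (by positivity)]
  simp only [h]
  rw [lintegral_norm_sq_stdComplexGaussian
    (f := fun t => ENNReal.ofReal (Real.exp (-(2 * t)))) (by fun_prop), lintegral_exp_neg_three]

/-- Integrating the identity (2s - t)₊ + t = (t - 2s)₊ + 2s reduces this to the previous integral:
1/3 + 2 - 1 = 4/3. The identity is kept in additive form to avoid subtraction in `ℝ≥0∞`. -/
lemma lintegral_lintegral_two_norm_sq_sub :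
    ∫⁻ y₂, ∫⁻ y₁, ENNReal.ofReal (2 * ‖y₂‖ ^ 2 - ‖y₁‖ ^ 2) ∂stdComplexGaussian ∂stdComplexGaussian
      = 4 / 3 := by
  have e : ∀ y₁ y₂ : ℂ, ENNReal.ofReal (2 * ‖y₂‖ ^ 2 - ‖y₁‖ ^ 2) + ENNReal.ofReal (‖y₁‖ ^ 2) =
      ENNReal.ofReal (‖y₁‖ ^ 2 - 2 * ‖y₂‖ ^ 2) + 2 * ENNReal.ofReal (‖y₂‖ ^ 2) := by
    intro y₁ y₂
    have h2 : (2 : ℝ≥0∞) = ENNReal.ofReal 2 := by simp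
    rw [h2, ← ENNReal.ofReal_mul zero_le_two]
    rcases le_total (‖y₁‖ ^ 2) (2 * ‖y₂‖ ^ 2) with h | h
    · rw [ENNReal.ofReal_of_nonpos (p := ‖y₁‖ ^ 2 - 2 * ‖y₂‖ ^ 2) (by linarith), zero_add,
        ← ENNReal.ofReal_add (by linarith) (by positivity)]
      congr 1; ring
    · rw [ENNReal.ofReal_of_nonpos (p := 2 * ‖y₂‖ ^ 2 - ‖y₁‖ ^ 2) (by linarith), zero_add,
        ← ENNReal.ofReal_add (by linarith) (by positivity)]
      congr 1; ring
  have e1 : ∀ y₂ : ℂ,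
      ∫⁻ y₁, ENNReal.ofReal (2 * ‖y₂‖ ^ 2 - ‖y₁‖ ^ 2) ∂stdComplexGaussian + 1 =
      ∫⁻ y₁, ENNReal.ofReal (‖y₁‖ ^ 2 - 2 * ‖y₂‖ ^ 2) ∂stdComplexGaussian +
        2 * ENNReal.ofReal (‖y₂‖ ^ 2) := by
    intro y₂
    conv_lhs => rw [← lintegral_norm_sq]
    rw [← lintegral_add_right _ (by fun_prop)]
    simp only [e]
    rw [lintegral_add_right _ measurable_const, lintegral_const, measure_univ, mul_one]
  have e2 := lintegral_congr (μ := stdComplexGaussian) e1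
  rw [lintegral_add_right _ measurable_const, lintegral_const, measure_univ, mul_one,
    lintegral_add_right _ (by fun_prop), lintegral_const_mul _ (by fun_prop), lintegral_norm_sq,
    lintegral_lintegral_norm_sq_sub_two] at e2
  have e3 : (1 / 3 : ℝ≥0∞) + 2 * 1 = 4 / 3 + 1 := by
    rw [mul_one, ← ENNReal.toReal_eq_toReal_iff' (by finiteness) (by finiteness),
      ENNReal.toReal_add (by finiteness) (by finiteness),
      ENNReal.toReal_add (by finiteness) (by finiteness)]
    norm_num
  rw [e3] at e2
  exact (ENNReal.add_left_inj ENNReal.one_ne_top).1 e2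

lemma integral_exp_re_mul_I (m : ℂ) :
    ∫ x, Complex.exp (((m * x).re : ℂ) * Complex.I) ∂stdComplexGaussian =
      Complex.exp (-(‖m‖ ^ 2 / 4 : ℝ)) := by
  rw [stdComplexGaussian, integral_map measurable_complex_mk.aemeasurable (by fun_prop)]
  have e : ∀ p : ℝ × ℝ, Complex.exp (((m * (⟨p.1, p.2⟩ : ℂ)).re : ℂ) * Complex.I) =
      Complex.exp ((m.re : ℂ) * p.1 * Complex.I) * Complex.exp (((-m.im : ℝ) : ℂ) * p.2 * Complex.I) := by
    intro p
    rw [← Complex.exp_add]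
    congr 1
    rw [Complex.mul_re]
    push_cast
    ring
  simp only [e]
  rw [integral_prod_mul (f := fun x : ℝ => Complex.exp ((m.re : ℂ) * x * Complex.I))
    (g := fun x : ℝ => Complex.exp (((-m.im : ℝ) : ℂ) * x * Complex.I)), ← charFun_apply_real,
    ← charFun_apply_real, charFun_gaussianReal, charFun_gaussianReal, ← Complex.exp_add]
  congr 1
  rw [← Complex.normSq_eq_norm_sq, Complex.normSq_apply]
  push_cast
  ring

end GEF

end

noncomputable section

namespace GEF

open Set Filter Topology

/-! ### The coefficient space -/

/-- A measurable set of sequences of at most exponential growth which has full Gaussian measure. -/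
def tameSet : Set (ℕ → ℂ) := {c | ∑' k, ‖c k‖ₑ * 2⁻¹ ^ k ≠ ∞}

open Classical in
/-- Replace the sequences outside of `tameSet` by zero. -/
def trunc (c : ℕ → ℂ) : ℕ → ℂ := if c ∈ tameSet then c else fun _ => 0

lemma measurableSet_tameSet : MeasurableSet tameSet := by
  have h : Measurable fun c : ℕ → ℂ => ∑' k, ‖c k‖ₑ * (2⁻¹ : ℝ≥0∞) ^ k :=
    Measurable.tsum fun k => (measurable_pi_apply k).enorm.mul_const _
  exact (h (measurableSet_singleton ∞)).compl

lemma ExpBounded.of_mem_tameSet {c : ℕ → ℂ} (hc : c ∈ tameSet) : ExpBounded c := by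
  have hc' : ∑' k, ‖c k‖ₑ * (2⁻¹ : ℝ≥0∞) ^ k ≠ ∞ := hc
  refine ⟨(∑' k, ‖c k‖ₑ * (2⁻¹ : ℝ≥0∞) ^ k).toReal, 2, ENNReal.toReal_nonneg, zero_le_two,
    fun k => ?_⟩
  have h := ENNReal.toReal_mono hc' (ENNReal.le_tsum (f := fun k => ‖c k‖ₑ * (2⁻¹ : ℝ≥0∞) ^ k) k)
  rw [ENNReal.toReal_mul, toReal_enorm, ENNReal.toReal_pow, ENNReal.toReal_inv,
    ENNReal.toReal_ofNat, inv_pow, ← div_eq_mul_inv, div_le_iff₀ (by positivity)] at h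
  exact h

/-- Allows the first coefficient to be varied freely once the remaining sequence is tame. -/
lemma cons_mem_tameSet {c : ℕ → ℂ} (hc : c ∈ tameSet) (x : ℂ) : cons x c ∈ tameSet := by
  have hc' : ∑' k, ‖c k‖ₑ * (2⁻¹ : ℝ≥0∞) ^ k ≠ ∞ := hc
  change ∑' k, ‖cons x c k‖ₑ * (2⁻¹ : ℝ≥0∞) ^ k ≠ ∞
  rw [tsum_eq_zero_add' ENNReal.summable]
  simp only [cons, pow_succ, ← mul_assoc, ENNReal.tsum_mul_right]
  finiteness

lemma trunc_of_mem {c : ℕ → ℂ} (hc : c ∈ tameSet) : trunc c = c := if_pos hc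

lemma expBounded_trunc (c : ℕ → ℂ) : ExpBounded (trunc c) := by
  unfold trunc
  split_ifs with h
  · exact .of_mem_tameSet h
  · exact expBounded_zero

lemma measurable_trunc : Measurable trunc :=
  Measurable.ite measurableSet_tameSet measurable_id measurable_const

lemma measurable_cons : Measurable fun p : ℂ × (ℕ → ℂ) => cons p.1 p.2 := by
  refine measurable_pi_iff.2 fun k => ?_
  cases k with
  | zero => exact measurable_fst
  | succ k => exact (measurable_pi_apply k).comp measurable_snd

lemma measurable_cons_left (c : ℕ → ℂ) : Measurable fun x => cons x c :=
  measurable_cons.comp (measurable_id.prodMk measurable_const)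

lemma measurable_cons_right (x : ℂ) : Measurable (cons x) :=
  measurable_cons.comp (measurable_const.prodMk measurable_id)

lemma measurable_derivCoeff : Measurable derivCoeff :=
  measurable_pi_iff.2 fun k => (measurable_pi_apply (k + 1)).const_mul _

section Measurability

variable {T : Type*} [MeasurableSpace T] {c : T → ℕ → ℂ}

lemma measurable_F (hc : ∀ t, ExpBounded (c t)) (hm : Measurable c) (z : ℂ) :
    Measurable fun t => F (c t) z := by
  refine measurable_of_tendsto_metrizable
    (f := fun n t => ∑ k ∈ Finset.range n, term (c t) z k) (fun n => ?_) ?_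
  · refine Finset.measurable_fun_sum _ fun k _ => ?_
    exact (((measurable_pi_apply k).comp hm).mul_const _).div_const _
  · exact tendsto_pi_nhds.2 fun t => ((hc t).summable_term z).hasSum.tendsto_sum_nat

lemma measurable_chern1 (hc : ∀ t, ExpBounded (c t)) (hm : Measurable c) (z : ℂ) :
    Measurable fun t => chern1 (c t) z :=
  (measurable_F (fun t => (hc t).derivCoeff) (measurable_derivCoeff.comp hm) z).sub
    ((measurable_F hc hm z).const_mul _)

lemma measurable_chern2 (hc : ∀ t, ExpBounded (c t)) (hm : Measurable c) (z : ℂ) :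
    Measurable fun t => chern2 (c t) z :=
  ((measurable_F (fun t => (hc t).derivCoeff.derivCoeff)
    (measurable_derivCoeff.comp (measurable_derivCoeff.comp hm)) z).sub
    ((measurable_F (fun t => (hc t).derivCoeff) (measurable_derivCoeff.comp hm) z).const_mul _)).add
    ((measurable_F hc hm z).const_mul _)

end Measurability

/-! ### The law of the coefficients -/

/-- The law of a sequence of independent standard complex Gaussian variables. -/
def coeffLaw : Measure (ℕ → ℂ) := Measure.infinitePi fun _ => stdComplexGaussian

instance : IsProbabilityMeasure coeffLaw := by unfold coeffLaw; infer_instance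

/-- Prepending an independent Gaussian reproduces the law of the sequence. This is how a₀ is
separated from the other coefficients throughout. -/
lemma map_cons_coeffLaw :
    (stdComplexGaussian.prod coeffLaw).map (fun p => cons p.1 p.2) = coeffLaw := by
  refine Measure.eq_infinitePi _ fun s t ht => ?_
  classical
  rw [Measure.map_apply measurable_cons (MeasurableSet.pi s.countable_toSet fun i _ => ht i)]
  have key : ∀ t : ℕ → Set ℂ, (∀ i, MeasurableSet (t i)) → ∀ n : ℕ,
      (stdComplexGaussian.prod coeffLaw)
        ((fun p : ℂ × (ℕ → ℂ) => cons p.1 p.2) ⁻¹' Set.pi (Finset.range (n + 1)) t) =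
      ∏ i ∈ Finset.range (n + 1), stdComplexGaussian (t i) := by
    intro t ht n
    have e : (fun p : ℂ × (ℕ → ℂ) => cons p.1 p.2) ⁻¹' Set.pi (Finset.range (n + 1)) t =
        t 0 ×ˢ Set.pi (Finset.range n) fun i => t (i + 1) := by
      ext p
      simp only [mem_preimage, Set.mem_pi, mem_prod, Finset.coe_range, mem_Iio]
      constructor
      · intro h
        exact ⟨h 0 (by omega), fun i hi => h (i + 1) (by omega)⟩
      · rintro ⟨h0, h⟩ i hi
        cases i with
        | zero => exact h0
        | succ i => exact h i (by omega)
    rw [e, Measure.prod_prod, coeffLaw, Measure.infinitePi_pi _ fun i _ => ht (i + 1),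
      Finset.prod_range_succ', mul_comm]
  obtain ⟨n, hn⟩ := s.exists_nat_subset_range
  -- A box over an arbitrary finite index set becomes a box over an initial segment when the missing
  -- factors are the whole plane, of mass 1.
  let t' : ℕ → Set ℂ := fun i => if i ∈ s then t i else univ
  have ht' : ∀ i, MeasurableSet (t' i) := fun i => by
    simp only [t']; split_ifs
    · exact ht i
    · exact MeasurableSet.univ
  have hs : s ⊆ Finset.range (n + 1) := hn.trans (Finset.range_mono (Nat.le_succ n))
  have e1 : Set.pi (s : Set ℕ) t = Set.pi (Finset.range (n + 1)) t' := by
    ext c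
    simp only [Set.mem_pi, t', Finset.mem_coe]
    constructor
    · intro h i _
      split_ifs with hi
      · exact h i hi
      · trivial
    · intro h i hi
      have := h i (hs hi)
      rwa [if_pos hi] at this
  rw [e1, key t' ht' n, ← Finset.prod_subset hs]
  · exact Finset.prod_congr rfl fun i hi => by simp [t', hi]
  · intro i _ hi
    simp [t', hi]

lemma lintegral_coeffLaw {f : (ℕ → ℂ) → ℝ≥0∞} (hf : Measurable f) :
    ∫⁻ c, f c ∂coeffLaw = ∫⁻ c, ∫⁻ x, f (cons x c) ∂stdComplexGaussian ∂coeffLaw := by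
  conv_lhs => rw [← map_cons_coeffLaw]
  rw [lintegral_map hf measurable_cons]
  exact lintegral_prod_symm _ (hf.comp measurable_cons).aemeasurable

lemma ae_coeffLaw_of_cons {s : Set (ℕ → ℂ)} (hs : MeasurableSet s)
    (h : ∀ᵐ c ∂coeffLaw, ∀ᵐ x ∂stdComplexGaussian, cons x c ∈ s) : ∀ᵐ c ∂coeffLaw, c ∈ s := by
  have e : coeffLaw sᶜ = 0 := by
    rw [← lintegral_indicator_one hs.compl,
      lintegral_coeffLaw (measurable_one.indicator hs.compl),
      lintegral_eq_zero_iff' (by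
        exact ((measurable_one.indicator hs.compl).comp measurable_cons).lintegral_prod_left'.aemeasurable)]
    filter_upwards [h] with c hc
    rw [Pi.zero_apply]
    refine (lintegral_eq_zero_iff
      ((measurable_one.indicator hs.compl).comp (measurable_cons_left c))).2 ?_
    filter_upwards [hc] with x hx
    simp [hx]
  exact e

lemma ae_cons_of_ae_coeffLaw {p : (ℕ → ℂ) → Prop} (h : ∀ᵐ c ∂coeffLaw, p c) :
    ∀ᵐ c ∂coeffLaw, ∀ᵐ x ∂stdComplexGaussian, p (cons x c) := by
  rw [← map_cons_coeffLaw] at h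
  have h1 := ae_of_ae_map measurable_cons.aemeasurable h
  rw [← Measure.prod_swap] at h1
  have h2 := ae_of_ae_map measurable_swap.aemeasurable h1
  exact Measure.ae_ae_of_ae_prod h2

lemma lintegral_eval_coeffLaw {f : ℂ → ℝ≥0∞} (hf : Measurable f) (k : ℕ) :
    ∫⁻ c, f (c k) ∂coeffLaw = ∫⁻ x, f x ∂stdComplexGaussian := by
  have h := (measurePreserving_eval_infinitePi (fun _ : ℕ => stdComplexGaussian) k)
  exact h.lintegral_comp hf

/-- The expectation of the defining series is E|a₀| times a geometric sum, hence finite; E|a₀| ≤ 2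
follows from |x| ≤ 1 + |x|². -/
lemma ae_mem_tameSet : ∀ᵐ c ∂coeffLaw, c ∈ tameSet := by
  have hm : ∀ k, Measurable fun c : ℕ → ℂ => ‖c k‖ₑ * (2⁻¹ : ℝ≥0∞) ^ k := fun k =>
    (measurable_pi_apply k).enorm.mul_const _
  have hE : ∫⁻ x, ‖x‖ₑ ∂stdComplexGaussian ≤ 2 := by
    calc ∫⁻ x, ‖x‖ₑ ∂stdComplexGaussian ≤ ∫⁻ x : ℂ, 1 + ENNReal.ofReal (‖x‖ ^ 2) ∂stdComplexGaussian := by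
          refine lintegral_mono fun x => ?_
          rw [← ofReal_norm, ← ENNReal.ofReal_one, ← ENNReal.ofReal_add zero_le_one (by positivity)]
          exact ENNReal.ofReal_le_ofReal (by nlinarith [sq_nonneg (‖x‖ - 1)])
      _ = 2 := by
          rw [lintegral_add_left measurable_const, lintegral_norm_sq]
          simp; norm_num
  have h : ∫⁻ c, ∑' k, ‖c k‖ₑ * (2⁻¹ : ℝ≥0∞) ^ k ∂coeffLaw ≠ ∞ := by
    rw [lintegral_tsum fun k => (hm k).aemeasurable]
    have : ∀ k : ℕ, ∫⁻ c, ‖c k‖ₑ * (2⁻¹ : ℝ≥0∞) ^ k ∂coeffLaw =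
        (∫⁻ x, ‖x‖ₑ ∂stdComplexGaussian) * (2⁻¹ : ℝ≥0∞) ^ k := fun k => by
      rw [lintegral_mul_const _ (measurable_pi_apply k).enorm,
        lintegral_eval_coeffLaw measurable_enorm]
    simp only [this]
    rw [ENNReal.tsum_mul_left, ENNReal.tsum_geometric, ENNReal.one_sub_inv_two, inv_inv]
    exact ENNReal.mul_ne_top (hE.trans_lt ENNReal.ofNat_lt_top).ne ENNReal.ofNat_ne_top
  filter_upwards [ae_lt_top (Measurable.tsum hm) h] with c hc
  exact hc.ne

end GEF

end

noncomputable section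

namespace GEF

open Set Filter Topology

/-! ### The characteristic function of a linear functional of the coefficients -/

/-- The weights `m` define a linear functional on the sequences of at most exponential growth. -/
def IsWeight (m : ℕ → ℂ) : Prop := ∀ c, ExpBounded c → Summable fun k => m k * c k

lemma IsWeight.shift {m : ℕ → ℂ} (hm : IsWeight m) : IsWeight fun k => m (k + 1) := fun c hc =>
  (summable_nat_add_iff (f := fun k => m k * cons 0 c k) 1).2 (hm _ (hc.cons 0))

lemma expBounded_pow (r : ℝ) (hr : 0 ≤ r) : ExpBounded fun k => (r : ℂ) ^ k :=
  ⟨1, r, zero_le_one, hr, fun k => by simp [abs_of_nonneg hr]⟩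

/-- Weights can thus serve as coefficients of entire functions themselves, which is used to compute
their ℓ² norms by the reproducing kernel. -/
lemma IsWeight.expBounded {m : ℕ → ℂ} (hm : IsWeight m) : ExpBounded m := by
  have h := (hm _ (expBounded_pow 1 zero_le_one)).norm
  simp only [Complex.ofReal_one, one_pow, mul_one] at h
  exact ⟨∑' k, ‖m k‖, 1, tsum_nonneg fun _ => norm_nonneg _, zero_le_one, fun k => by
    simpa using h.le_tsum k fun _ _ => norm_nonneg _⟩

lemma ExpBounded.conj {c : ℕ → ℂ} (hc : ExpBounded c) : ExpBounded fun k => conj (c k) := by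
  obtain ⟨C, r, hC, hr, h⟩ := hc
  exact ⟨C, r, hC, hr, fun k => by simpa using h k⟩

lemma IsWeight.tendsto_tail {m : ℕ → ℂ} (hm : IsWeight m) {c : ℕ → ℂ} (hc : ExpBounded c) :
    Tendsto (fun n => ∑' k, m (k + n) * c k) atTop (𝓝 0) := by
  obtain ⟨C, r, hC, hr, h⟩ := hc
  -- With base r + 1 ≥ 1 one has r ^ k ≤ (r + 1) ^ (k + n), so the shifted sums are dominated by
  -- tails of one convergent series.
  have h1 : Summable fun k => ‖m k‖ * (r + 1) ^ k := by
    have := (hm _ (expBounded_pow (r + 1) (by linarith))).norm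
    refine this.congr fun k => ?_
    rw [norm_mul, norm_pow, Complex.norm_real, Real.norm_eq_abs, abs_of_nonneg (by linarith)]
  have h2 := (tendsto_sum_nat_add fun k => ‖m k‖ * (r + 1) ^ k).const_mul C
  rw [mul_zero] at h2
  refine squeeze_zero_norm (fun n => ?_) h2
  rw [← tsum_mul_left]
  refine tsum_of_norm_bounded (((summable_nat_add_iff n).2 h1).mul_left C).hasSum fun k => ?_
  rw [norm_mul]
  calc ‖m (k + n)‖ * ‖c k‖ ≤ ‖m (k + n)‖ * (C * r ^ k) := by gcongr; exact h k
    _ ≤ ‖m (k + n)‖ * (C * (r + 1) ^ (k + n)) := by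
      gcongr
      exact (pow_le_pow_left₀ hr (by linarith) k).trans
        (pow_le_pow_right₀ (by linarith) (Nat.le_add_right k n))
    _ = _ := by ring

lemma measurable_tsum_mul_trunc {m : ℕ → ℂ} (hm : IsWeight m) :
    Measurable fun c => ∑' k, m k * trunc c k := by
  refine measurable_of_tendsto_metrizable
    (f := fun n c => ∑ k ∈ Finset.range n, m k * trunc c k) (fun n => ?_) ?_
  · exact Finset.measurable_fun_sum _ fun k _ =>
      ((measurable_pi_apply k).comp measurable_trunc).const_mul _
  · exact tendsto_pi_nhds.2 fun c => (hm _ (expBounded_trunc c)).hasSum.tendsto_sum_nat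

/-- The integrand of the characteristic function. -/
def charIntegrand (m : ℕ → ℂ) (c : ℕ → ℂ) : ℂ :=
  Complex.exp (((∑' k, m k * trunc c k).re : ℂ) * Complex.I)

lemma measurable_charIntegrand {m : ℕ → ℂ} (hm : IsWeight m) : Measurable (charIntegrand m) := by
  have := measurable_tsum_mul_trunc hm
  unfold charIntegrand
  fun_prop

lemma integral_charIntegrand_succ {m : ℕ → ℂ} (hm : IsWeight m) :
    ∫ c, charIntegrand m c ∂coeffLaw =
      Complex.exp (-(‖m 0‖ ^ 2 / 4 : ℝ)) * ∫ c, charIntegrand (fun k => m (k + 1)) c ∂coeffLaw := by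
  conv_lhs => rw [← map_cons_coeffLaw]
  rw [integral_map measurable_cons.aemeasurable (measurable_charIntegrand hm).aestronglyMeasurable,
    ← integral_exp_re_mul_I, ← integral_prod_mul]
  refine integral_congr_ae ?_
  have h : ∀ᵐ p ∂stdComplexGaussian.prod coeffLaw, p.2 ∈ tameSet :=
    Measure.quasiMeasurePreserving_snd.ae ae_mem_tameSet
  filter_upwards [h] with p hp
  rw [charIntegrand, charIntegrand, trunc_of_mem (cons_mem_tameSet hp p.1), trunc_of_mem hp,
    (hm _ (ExpBounded.of_mem_tameSet (cons_mem_tameSet hp p.1))).tsum_eq_zero_add, ← Complex.exp_add]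
  congr 1
  rw [Complex.add_re]
  push_cast
  simp only [cons]
  ring

lemma integral_charIntegrand_add {m : ℕ → ℂ} (hm : IsWeight m) (n : ℕ) :
    ∫ c, charIntegrand m c ∂coeffLaw =
      Complex.exp (-((∑ k ∈ Finset.range n, ‖m k‖ ^ 2) / 4 : ℝ)) *
        ∫ c, charIntegrand (fun k => m (k + n)) c ∂coeffLaw := by
  induction n generalizing m with
  | zero => simp
  | succ n ih =>
    rw [integral_charIntegrand_succ hm, ih hm.shift, ← mul_assoc, ← Complex.exp_add,
      Finset.sum_range_succ']
    congr 2
    push_cast; ring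

/-- Independence peels off the first n coefficients, each contributing a Gaussian factor. The
functional of the rest tends to 0 pointwise, so its characteristic function tends to 1 by dominated
convergence. -/
lemma integral_charIntegrand {m : ℕ → ℂ} (hm : IsWeight m) {σ : ℝ}
    (hσ : HasSum (fun k => ‖m k‖ ^ 2) σ) :
    ∫ c, charIntegrand m c ∂coeffLaw = Complex.exp (-(σ / 4 : ℝ)) := by
  have hm' : ∀ n, IsWeight fun k => m (k + n) := fun n => by
    induction n with
    | zero => exact hm
    | succ n ih => simpa only [add_assoc, add_comm 1 n] using ih.shift
  have h1 : Tendsto (fun n => ∫ c, charIntegrand (fun k => m (k + n)) c ∂coeffLaw) atTop (𝓝 1) := by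
    have : (1 : ℂ) = ∫ _, (1 : ℂ) ∂coeffLaw := by simp
    rw [this]
    refine tendsto_integral_of_dominated_convergence (fun _ => 1)
      (fun n => (measurable_charIntegrand (hm' n)).aestronglyMeasurable) (integrable_const _)
      (fun n => Eventually.of_forall fun c => ?_) (Eventually.of_forall fun c => ?_)
    · rw [charIntegrand, Complex.norm_exp_ofReal_mul_I]
    · have h2 := hm.tendsto_tail (expBounded_trunc c)
      have h3 : Continuous fun w : ℂ => Complex.exp ((w.re : ℂ) * Complex.I) := by fun_prop
      have h4 := (h3.tendsto 0).comp h2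
      simp only [Complex.zero_re, Complex.ofReal_zero, zero_mul, Complex.exp_zero] at h4
      exact h4
  have h2 : Tendsto (fun n => Complex.exp (-((∑ k ∈ Finset.range n, ‖m k‖ ^ 2) / 4 : ℝ)))
      atTop (𝓝 (Complex.exp (-(σ / 4 : ℝ)))) := by
    have h3 : Continuous fun t : ℝ => Complex.exp (-(t / 4 : ℝ)) := by fun_prop
    exact (h3.tendsto σ).comp hσ.tendsto_sum_nat
  have h3 := h2.mul h1
  rw [mul_one] at h3
  refine tendsto_nhds_unique ?_ h3
  refine tendsto_const_nhds.congr fun n => ?_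
  exact integral_charIntegrand_add hm n

/-! ### The weights of the value and the derivatives at a point -/

lemma hasSum_of_eq {f g : ℕ → ℂ} {S : ℂ} (e : ∀ k, f k = g k) (h : HasSum f S) : HasSum g S :=
  funext e ▸ h

/-- The weights of the evaluation at `z`. -/
def evalWeight (z : ℂ) (k : ℕ) : ℂ := z ^ k / ((Real.sqrt (k.factorial : ℝ) : ℝ) : ℂ)

/-- The transpose of `derivCoeff`. -/
def raise (m : ℕ → ℂ) : ℕ → ℂ
  | 0 => 0
  | k + 1 => ((Real.sqrt ((k : ℝ) + 1) : ℝ) : ℂ) * m k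

lemma term_eq (c : ℕ → ℂ) (z : ℂ) (k : ℕ) : term c z k = evalWeight z k * c k := by
  rw [term, evalWeight]; ring

lemma hasSum_evalWeight {c : ℕ → ℂ} (hc : ExpBounded c) (z : ℂ) :
    HasSum (fun k => evalWeight z k * c k) (F c z) := by
  exact hasSum_of_eq (term_eq c z) (hc.summable_term z).hasSum

lemma hasSum_raise {m c : ℕ → ℂ} {S : ℂ} (h : HasSum (fun k => m k * derivCoeff c k) S) :
    HasSum (fun k => raise m k * c k) S := by
  rw [← hasSum_nat_add_iff' 1]
  simp only [Finset.range_one, Finset.sum_singleton, raise, zero_mul, sub_zero]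
  refine hasSum_of_eq (fun k => ?_) h
  rw [derivCoeff]; ring

lemma isWeight_evalWeight (z : ℂ) : IsWeight (evalWeight z) := fun _ hc =>
  (hasSum_evalWeight hc z).summable

lemma IsWeight.raise {m : ℕ → ℂ} (hm : IsWeight m) : IsWeight (raise m) := fun _ hc =>
  (hasSum_raise (hm _ hc.derivCoeff).hasSum).summable

lemma conj_evalWeight (z : ℂ) (k : ℕ) : conj (evalWeight z k) = evalWeight (conj z) k := by
  simp [evalWeight]

lemma conj_raise (m : ℕ → ℂ) (k : ℕ) : conj (raise m k) = raise (fun k => conj (m k)) k := by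
  cases k <;> simp [raise]

/-- The reproducing kernel of the Fock space. -/
lemma F_evalWeight (v w : ℂ) : F (evalWeight v) w = Complex.exp (v * w) := by
  have h := hasSum_evalWeight (isWeight_evalWeight v).expBounded w
  refine h.unique ?_
  have h2 := NormedSpace.expSeries_div_hasSum_exp (v * w)
  rw [← Complex.exp_eq_exp_ℂ] at h2
  refine hasSum_of_eq (fun k => ?_) h2
  have h3 : ((Real.sqrt (k.factorial : ℝ) : ℝ) : ℂ) * ((Real.sqrt (k.factorial : ℝ) : ℝ) : ℂ) =
      (k.factorial : ℂ) := by
    rw [← Complex.ofReal_mul, Real.mul_self_sqrt (by positivity)]; simp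
  rw [evalWeight, evalWeight, div_mul_div_comm, h3, mul_pow, mul_comm]

/-- In the Fock space, multiplication by w is the transpose of differentiation. -/
lemma F_raise {m : ℕ → ℂ} (hm : IsWeight m) (w : ℂ) : F (raise m) w = w * F m w := by
  have h1 := hasSum_evalWeight hm.raise.expBounded w
  have h2 := (hasSum_evalWeight hm.expBounded w).mul_left w
  rw [← hasSum_nat_add_iff' 1] at h1
  simp only [Finset.range_one, Finset.sum_singleton, raise, mul_zero, sub_zero] at h1
  refine h1.unique ?_
  refine hasSum_of_eq (fun k => ?_) h2
  have h3 : (0 : ℝ) < (k : ℝ) + 1 := by positivity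
  have h4 : ((Real.sqrt ((k : ℝ) + 1) : ℝ) : ℂ) ≠ 0 := by exact_mod_cast (Real.sqrt_pos.2 h3).ne'
  have h5 : ((Real.sqrt (k.factorial : ℝ) : ℝ) : ℂ) ≠ 0 := by
    exact_mod_cast (sqrt_factorial_pos k).ne'
  rw [evalWeight, evalWeight, Nat.factorial_succ]
  push_cast
  rw [Real.sqrt_mul h3.le]
  push_cast
  field_simp
  ring

/-- The weights of the functional `l₁ F + l₂ ∇'F + l₃ ∇'∇'F` at `z`. -/
def jetWeight (z l₁ l₂ l₃ : ℂ) (k : ℕ) : ℂ :=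
  l₁ * evalWeight z k + l₂ * (raise (evalWeight z) k - conj z * evalWeight z k) +
    l₃ * (raise (raise (evalWeight z)) k - 2 * conj z * raise (evalWeight z) k +
      conj z ^ 2 * evalWeight z k)

lemma hasSum_jetWeight {c : ℕ → ℂ} (hc : ExpBounded c) (z l₁ l₂ l₃ : ℂ) :
    HasSum (fun k => jetWeight z l₁ l₂ l₃ k * c k)
      (l₁ * F c z + l₂ * chern1 c z + l₃ * chern2 c z) := by
  have h0 := hasSum_evalWeight hc z
  have h1 := hasSum_raise (hasSum_evalWeight hc.derivCoeff z)
  have h2 := hasSum_raise (hasSum_raise (hasSum_evalWeight hc.derivCoeff.derivCoeff z))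
  have h := ((h0.mul_left l₁).add ((h1.sub (h0.mul_left (conj z))).mul_left l₂)).add
    (((h2.sub (h1.mul_left (2 * conj z))).add (h0.mul_left (conj z ^ 2))).mul_left l₃)
  refine hasSum_of_eq (fun k => ?_) h
  rw [jetWeight]; ring

lemma isWeight_jetWeight (z l₁ l₂ l₃ : ℂ) : IsWeight (jetWeight z l₁ l₂ l₃) := fun _ hc =>
  (hasSum_jetWeight hc z l₁ l₂ l₃).summable

lemma F_conj_jetWeight (z l₁ l₂ l₃ w : ℂ) :
    F (fun k => conj (jetWeight z l₁ l₂ l₃ k)) w =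
      (conj l₁ + conj l₂ * (w - z) + conj l₃ * (w - z) ^ 2) * Complex.exp (conj z * w) := by
  have hw := isWeight_evalWeight (conj z)
  have h0 := hasSum_evalWeight hw.expBounded w
  have h1 := hasSum_evalWeight hw.raise.expBounded w
  have h2 := hasSum_evalWeight hw.raise.raise.expBounded w
  rw [F_raise hw.raise, F_raise hw] at h2
  rw [F_raise hw] at h1
  rw [F_evalWeight] at h0 h1 h2
  have h := ((h0.mul_left (conj l₁)).add ((h1.sub (h0.mul_left z)).mul_left (conj l₂))).add
    (((h2.sub (h1.mul_left (2 * z))).add (h0.mul_left (z ^ 2))).mul_left (conj l₃))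
  have e := (hasSum_evalWeight (isWeight_jetWeight z l₁ l₂ l₃).expBounded.conj w).unique
    (hasSum_of_eq (fun k => ?_) h)
  · rw [e]; ring
  · simp only [jetWeight, map_add, map_mul, map_sub, map_pow, conj_evalWeight, conj_raise,
      Complex.conj_conj, map_ofNat]
    ring

/-- The sum of |m k|² is the functional with weights m evaluated on the entire function with
coefficients conj (m k). By `F_conj_jetWeight` this function is a polynomial in w - z times
exp(z̄w), and its value and first two ∇' derivatives at z are exp(|z|²) times conj l₁, conj l₂ and 2
conj l₃. The absence of mixed terms gives independence of the jet, and 2 = 2! is the variance of the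
second derivative. -/
lemma hasSum_norm_jetWeight_sq (z l₁ l₂ l₃ : ℂ) :
    HasSum (fun k => ‖jetWeight z l₁ l₂ l₃ k‖ ^ 2)
      (Real.exp (‖z‖ ^ 2) * (‖l₁‖ ^ 2 + ‖l₂‖ ^ 2 + 2 * ‖l₃‖ ^ 2)) := by
  set c : ℕ → ℂ := fun k => conj (jetWeight z l₁ l₂ l₃ k) with hcdef
  have hc : ExpBounded c := (isWeight_jetWeight z l₁ l₂ l₃).expBounded.conj
  have hE : ∀ w, HasDerivAt (fun w => Complex.exp (conj z * w))
      (Complex.exp (conj z * w) * conj z) w := fun w => by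
    simpa using ((hasDerivAt_id w).const_mul (conj z)).cexp
  have hl : ∀ w, HasDerivAt (fun w => w - z) 1 w := fun w => (hasDerivAt_id w).sub_const z
  have hF : F c = fun w =>
      (conj l₁ + conj l₂ * (w - z) + conj l₃ * (w - z) ^ 2) * Complex.exp (conj z * w) :=
    funext (F_conj_jetWeight z l₁ l₂ l₃)
  have hF1 : F (derivCoeff c) = fun w =>
      (conj l₂ + 2 * conj l₃ * (w - z)) * Complex.exp (conj z * w) +
      conj z * ((conj l₁ + conj l₂ * (w - z) + conj l₃ * (w - z) ^ 2) * Complex.exp (conj z * w)) := by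
    ext w
    have h := hasDerivAt_F hc w
    rw [hF] at h
    refine h.unique ?_
    refine (((((hl w).const_mul (conj l₂)).const_add (conj l₁)).add
      (((hl w).pow 2).const_mul (conj l₃))).mul (hE w)).congr_deriv ?_
    simp; ring
  have hF2 : F (derivCoeff (derivCoeff c)) z = 2 * conj l₃ * Complex.exp (conj z * z) +
      2 * conj z * conj l₂ * Complex.exp (conj z * z) +
      conj z ^ 2 * conj l₁ * Complex.exp (conj z * z) := by
    have h := hasDerivAt_F hc.derivCoeff z
    rw [hF1] at h
    refine h.unique ?_
    refine (((((hl z).const_mul (2 * conj l₃)).const_add (conj l₂)).mul (hE z)).add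
      (((((((hl z).const_mul (conj l₂)).const_add (conj l₁)).add
      (((hl z).pow 2).const_mul (conj l₃))).mul (hE z))).const_mul (conj z))).congr_deriv ?_
    simp; ring
  have h := hasSum_jetWeight hc z l₁ l₂ l₃
  have hz : Complex.exp (conj z * z) = ((Real.exp (‖z‖ ^ 2) : ℝ) : ℂ) := by
    rw [mul_comm, Complex.mul_conj, Complex.normSq_eq_norm_sq]; push_cast; rfl
  have e : l₁ * F c z + l₂ * chern1 c z + l₃ * chern2 c z =
      ((Real.exp (‖z‖ ^ 2) * (‖l₁‖ ^ 2 + ‖l₂‖ ^ 2 + 2 * ‖l₃‖ ^ 2) : ℝ) : ℂ) := by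
    have n1 := Complex.mul_conj l₁
    have n2 := Complex.mul_conj l₂
    have n3 := Complex.mul_conj l₃
    rw [Complex.normSq_eq_norm_sq] at n1 n2 n3
    rw [chern1, chern2, hF2, hF1, hF]
    simp only [sub_self, mul_zero, add_zero, ne_eq, OfNat.ofNat_ne_zero, not_false_eq_true, zero_pow]
    rw [hz]
    push_cast at n1 n2 n3 ⊢
    linear_combination (Complex.exp (‖z‖ ^ 2)) * (n1 + n2 + 2 * n3)
  rw [e] at h
  rw [← Complex.hasSum_ofReal]
  refine hasSum_of_eq (fun k => ?_) h
  rw [hcdef]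
  simp only
  rw [Complex.mul_conj, Complex.normSq_eq_norm_sq]

lemma exists_re_mul_eq (M : ℂ →L[ℝ] ℝ) : ∃ l : ℂ, ∀ v, M v = (l * v).re := by
  refine ⟨⟨M 1, -M Complex.I⟩, fun v => ?_⟩
  have : v = v.re • (1 : ℂ) + v.im • Complex.I := by
    simp [Complex.re_add_im]
  conv_lhs => rw [this]
  rw [map_add, map_smul, map_smul, Complex.mul_re]
  simp only [smul_eq_mul]
  ring

/-- The joint law of the value and the first two translation-invariant derivatives at a point. -/
lemma map_jet (z : ℂ) :
    coeffLaw.map (fun c => (F (trunc c) z, chern1 (trunc c) z, chern2 (trunc c) z)) =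
      (stdComplexGaussian.prod (stdComplexGaussian.prod stdComplexGaussian)).map
        (fun p => ((Real.exp (‖z‖ ^ 2 / 2) : ℂ) * p.1, (Real.exp (‖z‖ ^ 2 / 2) : ℂ) * p.2.1,
          (Real.exp (‖z‖ ^ 2 / 2) : ℂ) * ((Real.sqrt 2 : ℂ) * p.2.2))) := by
  have hm : Measurable (fun c => (F (trunc c) z, chern1 (trunc c) z, chern2 (trunc c) z)) :=
    (measurable_F expBounded_trunc measurable_trunc z).prodMk
      ((measurable_chern1 expBounded_trunc measurable_trunc z).prodMk
        (measurable_chern2 expBounded_trunc measurable_trunc z))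
  have hm' : Measurable (fun p : ℂ × ℂ × ℂ => ((Real.exp (‖z‖ ^ 2 / 2) : ℂ) * p.1,
      (Real.exp (‖z‖ ^ 2 / 2) : ℂ) * p.2.1,
      (Real.exp (‖z‖ ^ 2 / 2) : ℂ) * ((Real.sqrt 2 : ℂ) * p.2.2))) := by fun_prop
  have := Measure.isProbabilityMeasure_map (μ := coeffLaw) hm.aemeasurable
  have := Measure.isProbabilityMeasure_map
    (μ := stdComplexGaussian.prod (stdComplexGaussian.prod stdComplexGaussian)) hm'.aemeasurable
  refine Measure.ext_of_charFunDual ?_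
  ext L
  -- Every real functional on ℂ³ is Re(l₁v₁ + l₂v₂ + l₃v₃), so on jets it is the real part of the
  -- weighted sum with `jetWeight`.
  obtain ⟨l₁, h₁⟩ := exists_re_mul_eq (L.comp (ContinuousLinearMap.inl ℝ ℂ (ℂ × ℂ)))
  obtain ⟨l₂, h₂⟩ := exists_re_mul_eq (L.comp ((ContinuousLinearMap.inr ℝ ℂ (ℂ × ℂ)).comp
    (ContinuousLinearMap.inl ℝ ℂ ℂ)))
  obtain ⟨l₃, h₃⟩ := exists_re_mul_eq (L.comp ((ContinuousLinearMap.inr ℝ ℂ (ℂ × ℂ)).comp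
    (ContinuousLinearMap.inr ℝ ℂ ℂ)))
  have hL : ∀ v : ℂ × ℂ × ℂ, L v = (l₁ * v.1 + l₂ * v.2.1 + l₃ * v.2.2).re := by
    intro v
    have : v = ContinuousLinearMap.inl ℝ ℂ (ℂ × ℂ) v.1 +
        ContinuousLinearMap.inr ℝ ℂ (ℂ × ℂ) (ContinuousLinearMap.inl ℝ ℂ ℂ v.2.1) +
        ContinuousLinearMap.inr ℝ ℂ (ℂ × ℂ) (ContinuousLinearMap.inr ℝ ℂ ℂ v.2.2) := by
      ext <;> simp
    conv_lhs => rw [this]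
    rw [map_add, map_add, Complex.add_re, Complex.add_re, ← h₁, ← h₂, ← h₃]
    rfl
  have hLm : ∀ {ρ : Measure (ℂ × ℂ × ℂ)},
      AEStronglyMeasurable (fun v => Complex.exp ((L v : ℂ) * Complex.I)) ρ := fun {ρ} =>
    Continuous.aestronglyMeasurable (by fun_prop)
  set s : ℂ := (Real.exp (‖z‖ ^ 2 / 2) : ℂ) with hs
  rw [charFunDual_apply, charFunDual_apply, integral_map hm.aemeasurable hLm,
    integral_map hm'.aemeasurable hLm]
  have e1 : ∀ c, Complex.exp ((L (F (trunc c) z, chern1 (trunc c) z, chern2 (trunc c) z) : ℂ) *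
      Complex.I) = charIntegrand (jetWeight z l₁ l₂ l₃) c := by
    intro c
    rw [charIntegrand, (hasSum_jetWeight (expBounded_trunc c) z l₁ l₂ l₃).tsum_eq, hL]
  simp only [e1]
  rw [integral_charIntegrand (isWeight_jetWeight z l₁ l₂ l₃) (hasSum_norm_jetWeight_sq z l₁ l₂ l₃)]
  have e2 : ∀ p : ℂ × ℂ × ℂ,
      Complex.exp ((L (s * p.1, s * p.2.1, s * ((Real.sqrt 2 : ℂ) * p.2.2)) : ℂ) * Complex.I) =
      Complex.exp (((l₁ * s * p.1).re : ℂ) * Complex.I) *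
        (Complex.exp (((l₂ * s * p.2.1).re : ℂ) * Complex.I) *
          Complex.exp (((l₃ * s * (Real.sqrt 2 : ℂ) * p.2.2).re : ℂ) * Complex.I)) := by
    intro p
    rw [hL, ← Complex.exp_add, ← Complex.exp_add]
    congr 1
    simp only [Complex.add_re]
    push_cast
    simp only [mul_assoc]
    ring
  simp only [e2]
  rw [integral_prod_mul (f := fun x : ℂ => Complex.exp (((l₁ * s * x).re : ℂ) * Complex.I))
    (g := fun q : ℂ × ℂ => Complex.exp (((l₂ * s * q.1).re : ℂ) * Complex.I) *
          Complex.exp (((l₃ * s * (Real.sqrt 2 : ℂ) * q.2).re : ℂ) * Complex.I)),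
    integral_prod_mul (f := fun x : ℂ => Complex.exp (((l₂ * s * x).re : ℂ) * Complex.I))
    (g := fun x : ℂ => Complex.exp (((l₃ * s * (Real.sqrt 2 : ℂ) * x).re : ℂ) * Complex.I)),
    integral_exp_re_mul_I, integral_exp_re_mul_I, integral_exp_re_mul_I, ← Complex.exp_add,
    ← Complex.exp_add]
  congr 1
  have hs2 : ‖s‖ ^ 2 = Real.exp (‖z‖ ^ 2) := by
    rw [hs, Complex.norm_real, Real.norm_eq_abs, abs_of_pos (Real.exp_pos _), ← Real.exp_nat_mul]
    congr 1; push_cast; ring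
  have h22 : ‖((Real.sqrt 2 : ℝ) : ℂ)‖ ^ 2 = 2 := by
    rw [Complex.norm_real, Real.norm_eq_abs, sq_abs, Real.sq_sqrt zero_le_two]
  simp only [norm_mul, mul_pow, hs2, h22]
  push_cast
  ring

end GEF

end

noncomputable section

namespace GEF

open Set Filter Topology

/-! ### Real determinants on the plane -/

lemma det_eq_of_forall {L : ℂ →L[ℝ] ℂ} {α β : ℂ} (h : ∀ w, L w = α * w + β * conj w) :
    L.det = ‖α‖ ^ 2 - ‖β‖ ^ 2 := by
  rw [ContinuousLinearMap.det, ← LinearMap.det_toMatrix Complex.basisOneI, Matrix.det_fin_two]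
  simp only [LinearMap.toMatrix_apply, Complex.coe_basisOneI, Complex.coe_basisOneI_repr,
    ContinuousLinearMap.coe_coe, h]
  rw [← Complex.normSq_eq_norm_sq, ← Complex.normSq_eq_norm_sq, Complex.normSq_apply,
    Complex.normSq_apply]
  simp
  ring

lemma lintegral_comp_affine {v : ℂ} (hv : v ≠ 0) (b : ℂ) (g : ℂ → ℝ≥0∞) :
    ∫⁻ u, g u = ∫⁻ x, ENNReal.ofReal (‖v‖ ^ 2) * g (v * x + b) := by
  let L : ℂ →L[ℝ] ℂ := (ContinuousLinearMap.mul ℝ ℂ v)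
  have hL : L.det = ‖v‖ ^ 2 := by
    rw [det_eq_of_forall (α := v) (β := 0) fun w => by simp [L]]; simp
  have hder : ∀ x ∈ (univ : Set ℂ), HasFDerivWithinAt (fun x => v * x + b) L univ x := fun x _ =>
    (L.hasFDerivAt.add_const b).hasFDerivWithinAt
  have h := lintegral_image_eq_lintegral_abs_det_fderiv_mul volume MeasurableSet.univ hder
    (fun x _ y _ hxy => by simpa [hv] using hxy) g
  have him : (fun x => v * x + b) '' univ = univ := by
    rw [image_univ, range_eq_univ]
    exact fun u => ⟨(u - b) / v, by field_simp; ring⟩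
  rw [him, hL, Measure.restrict_univ, abs_of_nonneg (by positivity)] at h
  exact h

/-! ### The conditional density -/

section CondDensity

variable {T : Type*} [MeasurableSpace T] {P : Measure T}

lemma gaussDensity_le_one (w : ℂ) : gaussDensity w ≤ 1 := by
  have h1 : Real.exp (-‖w‖ ^ 2) ≤ 1 := Real.exp_le_one_iff.2 (by nlinarith [sq_nonneg ‖w‖])
  rw [gaussDensity, div_le_one Real.pi_pos]
  linarith [Real.pi_gt_three]

lemma gaussDensity_mul_norm_sq_le_one (w : ℂ) : gaussDensity w * ‖w‖ ^ 2 ≤ 1 := by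
  have h1 := Real.add_one_le_exp (‖w‖ ^ 2)
  have h2 : Real.exp (-‖w‖ ^ 2) * ‖w‖ ^ 2 ≤ 1 := by
    rw [Real.exp_neg, inv_mul_le_iff₀ (Real.exp_pos _)]; linarith
  rw [gaussDensity, div_mul_eq_mul_div, div_le_one Real.pi_pos]
  linarith [Real.pi_gt_three]

lemma norm_mul_add_sq_le (v w y : ℂ) : ‖v * w + y‖ ^ 2 ≤ 2 * ‖v‖ ^ 2 * ‖w‖ ^ 2 + 2 * ‖y‖ ^ 2 := by
  have h := norm_add_le (v * w) y
  rw [norm_mul] at h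
  have h0 := norm_nonneg (v * w + y)
  nlinarith [sq_nonneg (‖v‖ * ‖w‖ - ‖y‖)]

lemma integrable_norm_sq {Y : T → ℂ} (hY : Measurable Y)
    (hI : ∫⁻ t, ENNReal.ofReal (‖Y t‖ ^ 2) ∂P ≠ ∞) : Integrable (fun t => ‖Y t‖ ^ 2) P := by
  have hm : AEStronglyMeasurable (fun t => ‖Y t‖ ^ 2) P :=
    (hY.norm.pow_const 2).aestronglyMeasurable
  have h0 : 0 ≤ᵐ[P] fun t => ‖Y t‖ ^ 2 := Eventually.of_forall fun t => sq_nonneg _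
  exact (lintegral_ofReal_ne_top_iff_integrable hm h0).1 hI

/-- If the joint law of `v x + U` and of `d` at `(v₁ x + Y₁, v₂ x + Y₂)`, with `x` standard
Gaussian and independent of `(U, Y₁, Y₂)`, has a continuous density in the first variable, then its
value at zero is given by the expectation on the event `v x + U = 0`. -/
lemma lintegral_conditional_density [IsProbabilityMeasure P] {U Y₁ Y₂ : T → ℂ} (hU : Measurable U) (hY₁ : Measurable Y₁)
    (hY₂ : Measurable Y₂) (hI₁ : ∫⁻ t, ENNReal.ofReal (‖Y₁ t‖ ^ 2) ∂P ≠ ∞)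
    (hI₂ : ∫⁻ t, ENNReal.ofReal (‖Y₂ t‖ ^ 2) ∂P ≠ ∞) {v : ℂ} (hv : v ≠ 0) (v₁ v₂ : ℂ)
    {d : ℂ × ℂ → ℝ} (hd : Continuous d) {C : ℝ} (hC : ∀ y, d y ≤ C * (‖y.1‖ ^ 2 + ‖y.2‖ ^ 2))
    {M : ℝ≥0} {q : ℂ → ℝ} (hq : Continuous q) (hq0 : ∀ u, 0 ≤ q u)
    (H : ∀ ψ : ℂ → ℝ≥0∞, Measurable ψ →
      ∫⁻ t, ∫⁻ x, ENNReal.ofReal (d (v₁ * x + Y₁ t, v₂ * x + Y₂ t)) * ψ (v * x + U t)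
        ∂stdComplexGaussian ∂P = M * ∫⁻ u, ENNReal.ofReal (q u) * ψ u) :
    ∫⁻ t, ENNReal.ofReal (gaussDensity (-U t / v)) *
      ENNReal.ofReal (d (v₁ * (-U t / v) + Y₁ t, v₂ * (-U t / v) + Y₂ t) / ‖v‖ ^ 2) ∂P =
      M * ENNReal.ofReal (q 0) := by
  -- The value of x solving v x + U t = u. Up to the constant ‖v‖², averaging Φ over t gives the
  -- density at u of the left side of `H`.
  let w : ℂ → T → ℂ := fun u t => (u - U t) / v
  let Φ : ℂ → T → ℝ := fun u t =>
    gaussDensity (w u t) * max (d (v₁ * w u t + Y₁ t, v₂ * w u t + Y₂ t)) 0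
  have hv2 : 0 < ‖v‖ ^ 2 := by positivity
  have hΦm : Measurable (Function.uncurry fun t u => Φ u t) := by
    have hw : Measurable fun p : T × ℂ => w p.2 p.1 :=
      (measurable_snd.sub (hU.comp measurable_fst)).div_const v
    have h1 : Measurable fun p : T × ℂ => v₁ * w p.2 p.1 + Y₁ p.1 :=
      (hw.const_mul _).add (hY₁.comp measurable_fst)
    have h2 : Measurable fun p : T × ℂ => v₂ * w p.2 p.1 + Y₂ p.1 :=
      (hw.const_mul _).add (hY₂.comp measurable_fst)
    exact (continuous_gaussDensity.measurable.comp hw).mul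
      ((hd.measurable.comp (h1.prodMk h2)).max measurable_const)
  have hΦ0 : ∀ u t, 0 ≤ Φ u t := fun u t => mul_nonneg (gaussDensity_nonneg _) (le_max_right _ _)
  have hC0 : 0 ≤ |C| := abs_nonneg C
  -- Both γ(w) and γ(w)|w|² are at most 1 for the Gaussian density γ, so the quadratic growth of d
  -- is dominated uniformly in u. This gives continuity in u.
  let bound : T → ℝ := fun t => 2 * |C| * (‖v₁‖ ^ 2 + ‖v₂‖ ^ 2 + (‖Y₁ t‖ ^ 2 + ‖Y₂ t‖ ^ 2))
  have hbound : ∀ u t, ‖Φ u t‖ ≤ bound t := by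
    intro u t
    rw [Real.norm_eq_abs, abs_of_nonneg (hΦ0 u t)]
    have h1 := norm_mul_add_sq_le v₁ (w u t) (Y₁ t)
    have h2 := norm_mul_add_sq_le v₂ (w u t) (Y₂ t)
    have h3 := gaussDensity_le_one (w u t)
    have h4 := gaussDensity_mul_norm_sq_le_one (w u t)
    have h5 := gaussDensity_nonneg (w u t)
    have h6 : max (d (v₁ * w u t + Y₁ t, v₂ * w u t + Y₂ t)) 0 ≤
        |C| * (2 * (‖v₁‖ ^ 2 + ‖v₂‖ ^ 2) * ‖w u t‖ ^ 2 + 2 * (‖Y₁ t‖ ^ 2 + ‖Y₂ t‖ ^ 2)) := by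
      refine max_le ((hC _).trans ?_) (by positivity)
      refine (mul_le_mul_of_nonneg_right (le_abs_self C) (by positivity)).trans ?_
      refine mul_le_mul_of_nonneg_left ?_ hC0
      simp only
      linarith
    calc Φ u t ≤ gaussDensity (w u t) *
          (|C| * (2 * (‖v₁‖ ^ 2 + ‖v₂‖ ^ 2) * ‖w u t‖ ^ 2 + 2 * (‖Y₁ t‖ ^ 2 + ‖Y₂ t‖ ^ 2))) :=
          mul_le_mul_of_nonneg_left h6 h5
      _ = 2 * |C| * ((‖v₁‖ ^ 2 + ‖v₂‖ ^ 2) * (gaussDensity (w u t) * ‖w u t‖ ^ 2) +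
          gaussDensity (w u t) * (‖Y₁ t‖ ^ 2 + ‖Y₂ t‖ ^ 2)) := by ring
      _ ≤ 2 * |C| * ((‖v₁‖ ^ 2 + ‖v₂‖ ^ 2) * 1 + 1 * (‖Y₁ t‖ ^ 2 + ‖Y₂ t‖ ^ 2)) := by gcongr
      _ = bound t := by simp only [bound]; ring
  have hbi : Integrable bound P :=
    (((integrable_const (‖v₁‖ ^ 2 + ‖v₂‖ ^ 2)).add ((integrable_norm_sq hY₁ hI₁).add (integrable_norm_sq hY₂ hI₂)))).const_mul (2 * |C|)
  have hΦmu : ∀ u, Measurable (Φ u) := fun u => hΦm.of_uncurry_right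
  have hΦi : ∀ u, Integrable (Φ u) P := fun u =>
    hbi.mono' (hΦmu u).aestronglyMeasurable (Eventually.of_forall (hbound u))
  have hJc : Continuous fun u => ∫ t, Φ u t ∂P := by
    refine continuous_of_dominated (fun u => (hΦmu u).aestronglyMeasurable)
      (fun u => Eventually.of_forall (hbound u)) hbi (Eventually.of_forall fun t => ?_)
    have hw : Continuous fun u => w u t := (continuous_id.sub continuous_const).div_const v
    exact (continuous_gaussDensity.comp hw).mul ((hd.comp (((continuous_const.mul hw).add
      continuous_const).prodMk ((continuous_const.mul hw).add continuous_const))).max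
      continuous_const)
  have hJ : ∀ u, ENNReal.ofReal (∫ t, Φ u t ∂P) = ∫⁻ t, ENNReal.ofReal (Φ u t) ∂P := fun u =>
    ofReal_integral_eq_lintegral_ofReal (hΦi u) (Eventually.of_forall (hΦ0 u))
  have hofReal : ∀ u t, ENNReal.ofReal (Φ u t) = ENNReal.ofReal (gaussDensity (w u t)) *
      ENNReal.ofReal (d (v₁ * w u t + Y₁ t, v₂ * w u t + Y₂ t)) := by
    intro u t
    rw [ENNReal.ofReal_mul (gaussDensity_nonneg _)]
    congr 1
    rcases le_total (d (v₁ * w u t + Y₁ t, v₂ * w u t + Y₂ t)) 0 with h | h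
    · rw [max_eq_right h, ENNReal.ofReal_zero, ENNReal.ofReal_of_nonpos h]
    · rw [max_eq_left h]
  -- Testing against indicators determines the density only almost everywhere; continuity of both
  -- sides then extends the equality to u = 0.
  have hae : (fun u => ENNReal.ofReal (∫ t, Φ u t ∂P)) =ᵐ[volume]
      fun u => ENNReal.ofReal (‖v‖ ^ 2 * M * q u) := by
    refine ae_eq_of_forall_setLIntegral_eq_of_sigmaFinite (hJc.measurable.ennreal_ofReal)
      ((hq.measurable.const_mul _).ennreal_ofReal) fun s hs _ => ?_
    let ψ : ℂ → ℝ≥0∞ := s.indicator 1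
    have hψ : Measurable ψ := measurable_one.indicator hs
    have h1 := H ψ hψ
    have h2 : ∀ t, ENNReal.ofReal (‖v‖ ^ 2) *
        ∫⁻ x, ENNReal.ofReal (d (v₁ * x + Y₁ t, v₂ * x + Y₂ t)) * ψ (v * x + U t)
        ∂stdComplexGaussian = ∫⁻ u, ENNReal.ofReal (Φ u t) * ψ u := by
      intro t
      have hm : Measurable fun x => ENNReal.ofReal (d (v₁ * x + Y₁ t, v₂ * x + Y₂ t)) *
          ψ (v * x + U t) := by
        have : Measurable fun x => d (v₁ * x + Y₁ t, v₂ * x + Y₂ t) :=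
          hd.measurable.comp (by fun_prop)
        exact this.ennreal_ofReal.mul (hψ.comp (by fun_prop))
      rw [lintegral_stdComplexGaussian hm, 
        lintegral_comp_affine hv (U t) (fun u => ENNReal.ofReal (Φ u t) * ψ u),
        ← lintegral_const_mul' _ _ ENNReal.ofReal_ne_top]
      refine lintegral_congr fun x => ?_
      have hw : w (v * x + U t) t = x := by simp only [w]; field_simp; ring
      rw [hofReal, hw]
      ring
    have h3 : ENNReal.ofReal (‖v‖ ^ 2) * (M * ∫⁻ u, ENNReal.ofReal (q u) * ψ u) =
        ∫⁻ u, (∫⁻ t, ENNReal.ofReal (Φ u t) ∂P) * ψ u := by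
      rw [← h1, ← lintegral_const_mul']
      · simp only [h2]
        rw [lintegral_lintegral_swap]
        · refine lintegral_congr fun u => ?_
          rw [lintegral_mul_const _ (hΦmu u).ennreal_ofReal]
        · exact (hΦm.ennreal_ofReal.mul (hψ.comp measurable_snd)).aemeasurable
      · exact ENNReal.ofReal_ne_top
    have h4 : ∀ g : ℂ → ℝ≥0∞, ∫⁻ u, g u * ψ u = ∫⁻ u in s, g u := by
      intro g
      rw [← lintegral_indicator hs]
      refine lintegral_congr fun u => ?_
      by_cases hu : u ∈ s <;> simp [ψ, hu]
    rw [h4, h4] at h3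
    simp only [hJ]
    rw [← h3, ← mul_assoc, ← lintegral_const_mul _ hq.measurable.ennreal_ofReal]
    refine lintegral_congr fun u => ?_
    rw [ENNReal.ofReal_mul (by positivity), ENNReal.ofReal_mul (by positivity),
      ENNReal.ofReal_coe_nnreal]
  have heq := ((ENNReal.continuous_ofReal.comp hJc).ae_eq_iff_eq volume
    (ENNReal.continuous_ofReal.comp (continuous_const.mul hq))).1 hae
  have h0 : ENNReal.ofReal (∫ t, Φ 0 t ∂P) = ENNReal.ofReal (‖v‖ ^ 2 * M * q 0) := congrFun heq 0
  rw [hJ] at h0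
  have e : ∀ t, ENNReal.ofReal (gaussDensity (-U t / v)) *
      ENNReal.ofReal (d (v₁ * (-U t / v) + Y₁ t, v₂ * (-U t / v) + Y₂ t) / ‖v‖ ^ 2) =
      ENNReal.ofReal (Φ 0 t) * ENNReal.ofReal (‖v‖ ^ 2)⁻¹ := by
    intro t
    rw [hofReal, div_eq_mul_inv (d _), ENNReal.ofReal_mul' (by positivity)]
    simp only [w, zero_sub]
    ring
  simp only [e]
  rw [lintegral_mul_const _ (hΦmu 0).ennreal_ofReal, h0,
    ← ENNReal.ofReal_mul (mul_nonneg (by positivity) (hq0 0)), ← ENNReal.ofReal_coe_nnreal,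
    ← ENNReal.ofReal_mul M.coe_nonneg]
  congr 1
  field_simp

end CondDensity

end GEF

end

noncomputable section

namespace GEF

open Set Filter Topology

/-! ### Zeros of fields which are affine in the first coefficient -/

/-- A random field which is continuous in space, measurable in the coefficients, and affine in the
first coefficient with slope `v`. -/
structure IsAffineField (U : (ℕ → ℂ) → ℂ → ℂ) (v : ℂ → ℂ) : Prop where
  continuous_slope : Continuous v
  continuous : ∀ {c : ℕ → ℂ}, ExpBounded c → Continuous (U c)
  measurable : ∀ {T : Type} [MeasurableSpace T] {c : T → ℕ → ℂ}, (∀ t, ExpBounded (c t)) →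
    Measurable c → ∀ z, Measurable fun t => U (c t) z
  map_cons : ∀ {c : ℕ → ℂ}, ExpBounded c → ∀ x z, U (cons x c) z = v z * x + U (cons 0 c) z

/-- The value of the first coefficient for which `U` vanishes at `z`. -/
def level (U : (ℕ → ℂ) → ℂ → ℂ) (v : ℂ → ℂ) (c : ℕ → ℂ) (z : ℂ) : ℂ := -U (cons 0 c) z / v z

/-- The data of a Kac-Rice computation: a random field `U` whose Jacobian determinant at its zeros
is `± d (Y₁, Y₂)`. -/
structure IsKacRice (U Y₁ Y₂ : (ℕ → ℂ) → ℂ → ℂ) (v v₁ v₂ : ℂ → ℂ) (d : ℂ × ℂ → ℝ) (M : ℝ≥0) :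
    Prop where
  field : IsAffineField U v
  field₁ : IsAffineField Y₁ v₁
  field₂ : IsAffineField Y₂ v₂
  slope_ne_zero : ∀ z, z ≠ 0 → v z ≠ 0
  continuous_d : Continuous d
  d_le : ∃ C : ℝ, ∀ y, d y ≤ C * (‖y.1‖ ^ 2 + ‖y.2‖ ^ 2)
  hasFDerivAt : ∀ c, ExpBounded c → ∀ z, z ≠ 0 → ∃ L : ℂ →L[ℝ] ℂ,
    HasFDerivAt (level U v c) L z ∧
      |L.det| = |d (Y₁ (cons (level U v c z) c) z, Y₂ (cons (level U v c z) c) z)| / ‖v z‖ ^ 2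
  -- The slope may vanish at the origin, where `level` then does not describe the zeros; the origin
  -- is excluded as a zero instead.
  ne_zero : ∀ᵐ c ∂coeffLaw, U (trunc c) 0 ≠ 0
  moment₁ : ∀ z, ∫⁻ c, ENNReal.ofReal (‖Y₁ (trunc c) z‖ ^ 2) ∂coeffLaw ≠ ∞
  moment₂ : ∀ z, ∫⁻ c, ENNReal.ofReal (‖Y₂ (trunc c) z‖ ^ 2) ∂coeffLaw ≠ ∞
  -- For the fields used, d scales by exp(|z|²) and the normalization of the density of U by
  -- exp(-|z|²). These cancel, so M does not depend on z.
  law : ∀ z, ∀ ψ : ℂ → ℝ≥0∞, Measurable ψ →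
    ∫⁻ c, ENNReal.ofReal (d (Y₁ (trunc c) z, Y₂ (trunc c) z)) * ψ (U (trunc c) z) ∂coeffLaw =
      M * ∫⁻ u, ENNReal.ofReal (gaussDensity ((Real.exp (-(‖z‖ ^ 2 / 2)) : ℂ) * u)) * ψ u

lemma trunc_cons {c : ℕ → ℂ} (hc : c ∈ tameSet) (x : ℂ) : trunc (cons x c) = cons x (trunc c) := by
  rw [trunc_of_mem hc, trunc_of_mem (cons_mem_tameSet hc x)]

section AffineField

variable {U : (ℕ → ℂ) → ℂ → ℂ} {v : ℂ → ℂ}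

lemma IsAffineField.measurable_trunc (h : IsAffineField U v) (z : ℂ) :
    Measurable fun c => U (trunc c) z := h.measurable expBounded_trunc GEF.measurable_trunc z

lemma IsAffineField.measurable_cons (h : IsAffineField U v) (z : ℂ) :
    Measurable fun c => U (cons 0 (trunc c)) z :=
  h.measurable (fun c => (expBounded_trunc c).cons 0)
    ((measurable_cons_right 0).comp GEF.measurable_trunc) z

lemma IsAffineField.measurable_uncurry (h : IsAffineField U v) :
    Measurable fun p : (ℕ → ℂ) × ℂ => U (cons 0 (trunc p.1)) p.2 := by
  have h1 : Measurable (Function.uncurry fun (z : ℂ) (c : ℕ → ℂ) => U (cons 0 (trunc c)) z) :=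
    measurable_uncurry_of_continuous_of_measurable
      (fun c => h.continuous ((expBounded_trunc c).cons 0)) h.measurable_cons
  have h2 := h1.comp (measurable_swap (α := ℕ → ℂ) (β := ℂ))
  exact h2

/-- The field with first coefficient 0 differs from the field with first coefficient x by v(z)x,
which has finite second moment; the bound is averaged over x. -/
lemma IsAffineField.moment_cons (h : IsAffineField U v) {z : ℂ}
    (hI : ∫⁻ c, ENNReal.ofReal (‖U (trunc c) z‖ ^ 2) ∂coeffLaw ≠ ∞) :
    ∫⁻ c, ENNReal.ofReal (‖U (cons 0 (trunc c)) z‖ ^ 2) ∂coeffLaw ≠ ∞ := by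
  have hm : Measurable fun c => ENNReal.ofReal (‖U (trunc c) z‖ ^ 2) :=
    ((h.measurable_trunc z).norm.pow_const 2).ennreal_ofReal
  rw [lintegral_coeffLaw hm] at hI
  have hle : ∫⁻ c, ENNReal.ofReal (‖U (cons 0 (trunc c)) z‖ ^ 2) ∂coeffLaw ≤
      ∫⁻ c, (ENNReal.ofReal (2 * ‖v z‖ ^ 2) +
        2 * ∫⁻ x, ENNReal.ofReal (‖U (trunc (cons x c)) z‖ ^ 2) ∂stdComplexGaussian) ∂coeffLaw := by
    refine lintegral_mono_ae ?_
    filter_upwards [ae_mem_tameSet] with c hc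
    have e1 : ENNReal.ofReal (‖U (cons 0 (trunc c)) z‖ ^ 2) =
        ∫⁻ _, ENNReal.ofReal (‖U (cons 0 (trunc c)) z‖ ^ 2) ∂stdComplexGaussian := by simp
    have e2 : ENNReal.ofReal (2 * ‖v z‖ ^ 2) =
        ∫⁻ x, ENNReal.ofReal (2 * ‖v z‖ ^ 2) * ENNReal.ofReal (‖x‖ ^ 2) ∂stdComplexGaussian := by
      rw [lintegral_const_mul _ (by fun_prop), lintegral_norm_sq, mul_one]
    have hmc : Measurable fun x => ENNReal.ofReal (‖U (trunc (cons x c)) z‖ ^ 2) := by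
      have := hm.comp (measurable_cons_left c)
      exact this
    rw [e1, e2, ← lintegral_const_mul _ hmc,
      ← lintegral_add_left (by fun_prop)]
    refine lintegral_mono fun x => ?_
    simp only
    rw [trunc_cons hc, ← ENNReal.ofReal_mul (by positivity),
      show (2 : ℝ≥0∞) = ENNReal.ofReal 2 by simp, ← ENNReal.ofReal_mul zero_le_two,
      ← ENNReal.ofReal_add (by positivity) (by positivity)]
    refine ENNReal.ofReal_le_ofReal ?_
    have h3 := norm_mul_add_sq_le (-v z) x (U (cons x (trunc c)) z)
    rw [norm_neg] at h3
    have h4 : U (cons 0 (trunc c)) z = -v z * x + U (cons x (trunc c)) z := by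
      rw [h.map_cons (expBounded_trunc c) x z]; ring
    rw [h4]
    exact h3
  refine (hle.trans_lt ?_).ne
  rw [lintegral_add_left measurable_const, lintegral_const, measure_univ, mul_one,
    lintegral_const_mul' _ _ ENNReal.ofNat_ne_top]
  exact ENNReal.add_lt_top.2 ⟨ENNReal.ofReal_lt_top,
    ENNReal.mul_lt_top ENNReal.ofNat_lt_top hI.lt_top⟩

end AffineField

section KacRice

variable {U Y₁ Y₂ : (ℕ → ℂ) → ℂ → ℂ} {v v₁ v₂ : ℂ → ℂ} {d : ℂ × ℂ → ℝ} {M : ℝ≥0}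

/-- The Jacobian factor at `z` once the first coefficient is chosen such that `U` vanishes at
`z`. -/
def levelJacobian (U Y₁ Y₂ : (ℕ → ℂ) → ℂ → ℂ) (v : ℂ → ℂ) (d : ℂ × ℂ → ℝ) (c : ℕ → ℂ) (z : ℂ) : ℝ :=
  d (Y₁ (cons (level U v c z) c) z, Y₂ (cons (level U v c z) c) z)

/-- The zeros of `U` with positive Jacobian factor. -/
def positiveZeros (U Y₁ Y₂ : (ℕ → ℂ) → ℂ → ℂ) (d : ℂ × ℂ → ℝ) (c : ℕ → ℂ) : Set ℂ :=
  {z | U c z = 0 ∧ 0 < d (Y₁ c z, Y₂ c z)}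

lemma IsKacRice.levelJacobian_eq (h : IsKacRice U Y₁ Y₂ v v₁ v₂ d M) {c : ℕ → ℂ}
    (hc : ExpBounded c) (z : ℂ) :
    levelJacobian U Y₁ Y₂ v d c z = d (v₁ z * level U v c z + Y₁ (cons 0 c) z,
      v₂ z * level U v c z + Y₂ (cons 0 c) z) := by
  rw [levelJacobian, h.field₁.map_cons hc, h.field₂.map_cons hc]

lemma IsKacRice.lintegral_level (h : IsKacRice U Y₁ Y₂ v v₁ v₂ d M) {z : ℂ} (hz : z ≠ 0) :
    ∫⁻ c, ENNReal.ofReal (gaussDensity (level U v (trunc c) z)) *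
      ENNReal.ofReal (levelJacobian U Y₁ Y₂ v d (trunc c) z / ‖v z‖ ^ 2) ∂coeffLaw =
      M * ENNReal.ofReal Real.pi⁻¹ := by
  obtain ⟨C, hC⟩ := h.d_le
  have key := lintegral_conditional_density (P := coeffLaw) (h.field.measurable_cons z)
    (h.field₁.measurable_cons z) (h.field₂.measurable_cons z)
    (h.field₁.moment_cons (h.moment₁ z)) (h.field₂.moment_cons (h.moment₂ z))
    (h.slope_ne_zero z hz) (v₁ z) (v₂ z) h.continuous_d hC (M := M)
    (q := fun u => gaussDensity ((Real.exp (-(‖z‖ ^ 2 / 2)) : ℂ) * u))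
    (continuous_gaussDensity.comp (by fun_prop)) (fun u => gaussDensity_nonneg _) ?_
  · simp only [h.levelJacobian_eq (expBounded_trunc _)]
    rw [mul_zero] at key
    have e : gaussDensity 0 = Real.pi⁻¹ := by simp [gaussDensity]
    rw [e] at key
    exact key
  · intro ψ hψ
    have hm : Measurable fun c => ENNReal.ofReal (d (Y₁ (trunc c) z, Y₂ (trunc c) z)) *
        ψ (U (trunc c) z) :=
      ((h.continuous_d.measurable.comp ((h.field₁.measurable_trunc z).prodMk
        (h.field₂.measurable_trunc z))).ennreal_ofReal).mul (hψ.comp (h.field.measurable_trunc z))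
    refine Eq.trans ?_ ((lintegral_coeffLaw hm).symm.trans (h.law z ψ hψ))
    refine lintegral_congr_ae ?_
    filter_upwards [ae_mem_tameSet] with c hc
    refine lintegral_congr fun x => ?_
    rw [trunc_cons hc, h.field.map_cons (expBounded_trunc c) x,
      h.field₁.map_cons (expBounded_trunc c) x, h.field₂.map_cons (expBounded_trunc c) x]

lemma IsKacRice.cons_eq_zero_iff (h : IsKacRice U Y₁ Y₂ v v₁ v₂ d M) {c : ℕ → ℂ}
    (hc : ExpBounded c) {z : ℂ} (hz : z ≠ 0) (x : ℂ) :
    U (cons x c) z = 0 ↔ level U v c z = x := by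
  have hv := h.slope_ne_zero z hz
  rw [h.field.map_cons hc, level, div_eq_iff hv, add_eq_zero_iff_eq_neg, eq_comm, mul_comm x]

lemma IsKacRice.continuous_jacobian (h : IsKacRice U Y₁ Y₂ v v₁ v₂ d M) {c : ℕ → ℂ}
    (hc : ExpBounded c) : Continuous fun z => d (Y₁ c z, Y₂ c z) :=
  h.continuous_d.comp ((h.field₁.continuous hc).prodMk (h.field₂.continuous hc))

lemma IsKacRice.measurable_jacobian (h : IsKacRice U Y₁ Y₂ v v₁ v₂ d M) (z : ℂ) :
    Measurable fun c => d (Y₁ (trunc c) z, Y₂ (trunc c) z) :=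
  h.continuous_d.measurable.comp ((h.field₁.measurable_trunc z).prodMk
    (h.field₂.measurable_trunc z))

lemma IsKacRice.measurable_encard (h : IsKacRice U Y₁ Y₂ v v₁ v₂ d M) {B : Set ℂ}
    (hB : IsOpen B) :
    Measurable fun c => ((positiveZeros U Y₁ Y₂ d (trunc c) ∩ B).encard : ℝ≥0∞) :=
  measurable_encard_inter (fun _ hK => measurableSet_zero_pos_inter_nonempty
    (fun c => h.field.continuous (expBounded_trunc c)) h.field.measurable_trunc
    (fun c => h.continuous_jacobian (expBounded_trunc c)) h.measurable_jacobian hK) hB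

lemma IsKacRice.measurable_level (h : IsKacRice U Y₁ Y₂ v v₁ v₂ d M) :
    Measurable fun p : (ℕ → ℂ) × ℂ => level U v (trunc p.1) p.2 :=
  h.field.measurable_uncurry.neg.div (h.field.continuous_slope.measurable.comp measurable_snd)

lemma IsKacRice.measurable_levelJacobian (h : IsKacRice U Y₁ Y₂ v v₁ v₂ d M) :
    Measurable fun p : (ℕ → ℂ) × ℂ => levelJacobian U Y₁ Y₂ v d (trunc p.1) p.2 := by
  simp only [h.levelJacobian_eq (expBounded_trunc _)]
  have h1 := h.field₁.continuous_slope.measurable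
  have h2 := h.field₂.continuous_slope.measurable
  exact h.continuous_d.measurable.comp ((((h1.comp measurable_snd).mul h.measurable_level).add
    h.field₁.measurable_uncurry).prodMk (((h2.comp measurable_snd).mul h.measurable_level).add
    h.field₂.measurable_uncurry))

lemma ae_volume_of_ae_stdComplexGaussian {p : ℂ → Prop} (h : ∀ᵐ x ∂stdComplexGaussian, p x) :
    ∀ᵐ x ∂(volume : Measure ℂ), p x := by
  rw [stdComplexGaussian_eq, ae_withDensity_iff
    continuous_gaussDensity.measurable.ennreal_ofReal] at h
  filter_upwards [h] with x hx
  refine hx (ENNReal.ofReal_pos.2 ?_).ne'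
  have := Real.pi_pos
  unfold gaussDensity; positivity

/-- Integration over the first coefficient by means of the area formula. -/
lemma IsKacRice.lintegral_encard_cons (h : IsKacRice U Y₁ Y₂ v v₁ v₂ d M) {c : ℕ → ℂ}
    (hc : c ∈ tameSet) (h0 : ∀ᵐ x ∂stdComplexGaussian, U (trunc (cons x c)) 0 ≠ 0) {B : Set ℂ}
    (hB : IsOpen B) :
    ∫⁻ x, ((positiveZeros U Y₁ Y₂ d (trunc (cons x c)) ∩ B).encard : ℝ≥0∞) ∂stdComplexGaussian =
      ∫⁻ z in B, ENNReal.ofReal (gaussDensity (level U v (trunc c) z)) *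
        ENNReal.ofReal (levelJacobian U Y₁ Y₂ v d (trunc c) z / ‖v z‖ ^ 2) := by
  have hcb := expBounded_trunc c
  set Ψ := level U v (trunc c) with hΨ
  set D := levelJacobian U Y₁ Y₂ v d (trunc c) with hD
  have hΨm : Measurable Ψ := (h.field.continuous (hcb.cons 0)).measurable.neg.div
    h.field.continuous_slope.measurable
  have hDm : Measurable D := by
    rw [hD, funext (h.levelJacobian_eq hcb)]
    exact h.continuous_d.measurable.comp
      (((h.field₁.continuous_slope.measurable.mul hΨm).add
        (h.field₁.continuous (hcb.cons 0)).measurable).prodMk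
      ((h.field₂.continuous_slope.measurable.mul hΨm).add
        (h.field₂.continuous (hcb.cons 0)).measurable))
  -- On this set the level map is differentiable with nonzero determinant, and for almost every x
  -- its fibre over x consists of the zeros counted in B.
  set s : Set ℂ := B ∩ ({0}ᶜ ∩ {z | 0 < D z}) with hs
  have hsm : MeasurableSet s := hB.measurableSet.inter
    ((measurableSet_singleton 0).compl.inter (measurableSet_lt measurable_const hDm))
  choose! L hL hLdet using h.hasFDerivAt (trunc c) hcb
  have hdet : ∀ z ∈ s, |(L z).det| = D z / ‖v z‖ ^ 2 := by
    intro z hz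
    rw [hLdet z hz.2.1]
    congr 1
    exact abs_of_pos hz.2.2
  have hpos : ∀ z ∈ s, 0 < D z / ‖v z‖ ^ 2 := fun z hz => by
    have h1 := h.slope_ne_zero z hz.2.1
    have h2 : 0 < D z := hz.2.2
    positivity
  have hN : Measurable fun x =>
      ((positiveZeros U Y₁ Y₂ d (trunc (cons x c)) ∩ B).encard : ℝ≥0∞) := by
    have := (h.measurable_encard hB).comp (measurable_cons_left c)
    exact this
  rw [lintegral_stdComplexGaussian hN]
  have e1 : ∀ᵐ x ∂(volume : Measure ℂ), ENNReal.ofReal (gaussDensity x) *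
      ((positiveZeros U Y₁ Y₂ d (trunc (cons x c)) ∩ B).encard : ℝ≥0∞) =
      ((s ∩ Ψ ⁻¹' {x}).encard : ℝ≥0∞) * ENNReal.ofReal (gaussDensity x) := by
    filter_upwards [ae_volume_of_ae_stdComplexGaussian h0] with x hx
    rw [mul_comm]
    congr 3
    ext z
    rw [trunc_cons hc] at hx ⊢
    simp only [positiveZeros, hs, mem_inter_iff, mem_ofPred_eq, mem_compl_iff, mem_singleton_iff,
      mem_preimage]
    by_cases hz : z = 0
    · subst hz; simp [hx]
    · rw [h.cons_eq_zero_iff hcb hz, ← hΨ]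
      constructor
      · rintro ⟨⟨h1, h2⟩, h3⟩
        refine ⟨⟨h3, hz, ?_⟩, h1⟩
        rw [hD, levelJacobian, ← hΨ, h1]; exact h2
      · rintro ⟨⟨h3, -, h2⟩, h1⟩
        refine ⟨⟨h1, ?_⟩, h3⟩
        rw [hD, levelJacobian, ← hΨ, h1] at h2; exact h2
  rw [lintegral_congr_ae e1, lintegral_encard_fiber_mul volume hsm
    (fun z hz => (hL z hz.2.1).hasFDerivWithinAt)
    (fun z hz => by rw [← abs_ne_zero, hdet z hz]; exact (hpos z hz).ne')
    continuous_gaussDensity.measurable.ennreal_ofReal,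
    ← lintegral_indicator hsm, ← lintegral_indicator hB.measurableSet]
  refine lintegral_congr_ae ?_
  have hne : ∀ᵐ z ∂(volume : Measure ℂ), z ≠ 0 := by
    simp [ae_iff]
  filter_upwards [hne] with z hz
  by_cases hzs : z ∈ s
  · rw [indicator_of_mem hzs, indicator_of_mem hzs.1, hdet z hzs, mul_comm]
  · rw [indicator_of_notMem hzs]
    by_cases hzB : z ∈ B
    · have : D z ≤ 0 := by
        by_contra hlt
        exact hzs ⟨hzB, hz, not_le.1 hlt⟩
      rw [indicator_of_mem hzB, ENNReal.ofReal_of_nonpos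
        (div_nonpos_of_nonpos_of_nonneg this (by positivity)), mul_zero]
    · rw [indicator_of_notMem hzB]

/-- The expected density of the zeros of `U` with positive Jacobian factor. -/
theorem IsKacRice.hasIntensity (h : IsKacRice U Y₁ Y₂ v v₁ v₂ d M) :
    HasIntensity coeffLaw (fun c => positiveZeros U Y₁ Y₂ d (trunc c)) (fun _ => M) := by
  refine hasIntensity_of_isOpen (fun c => ?_) (fun B hB => h.measurable_encard hB) fun B hB => ?_
  · have h1 := h.field.continuous (expBounded_trunc c)
    have h2 := h.continuous_jacobian (expBounded_trunc c)
    exact ((isClosed_singleton.preimage h1).measurableSet).inter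
      (measurableSet_lt measurable_const h2.measurable)
  · rw [lintegral_coeffLaw (h.measurable_encard hB)]
    have h0 := ae_cons_of_ae_coeffLaw h.ne_zero
    have e : ∀ᵐ c ∂coeffLaw, ∫⁻ x,
        ((positiveZeros U Y₁ Y₂ d (trunc (cons x c)) ∩ B).encard : ℝ≥0∞) ∂stdComplexGaussian =
      ∫⁻ z in B, ENNReal.ofReal (gaussDensity (level U v (trunc c) z)) *
        ENNReal.ofReal (levelJacobian U Y₁ Y₂ v d (trunc c) z / ‖v z‖ ^ 2) := by
      filter_upwards [ae_mem_tameSet, h0] with c hc hc0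
      exact h.lintegral_encard_cons hc hc0 hB
    have hm : Measurable fun p : (ℕ → ℂ) × ℂ =>
        ENNReal.ofReal (gaussDensity (level U v (trunc p.1) p.2)) *
        ENNReal.ofReal (levelJacobian U Y₁ Y₂ v d (trunc p.1) p.2 / ‖v p.2‖ ^ 2) :=
      (continuous_gaussDensity.measurable.comp h.measurable_level).ennreal_ofReal.mul
        (h.measurable_levelJacobian.div
          ((h.field.continuous_slope.norm.pow 2).measurable.comp measurable_snd)).ennreal_ofReal
    rw [lintegral_congr_ae e, lintegral_lintegral_swap hm.aemeasurable]
    have e2 : ∀ᵐ z ∂(volume.restrict B : Measure ℂ),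
        ∫⁻ c, ENNReal.ofReal (gaussDensity (level U v (trunc c) z)) *
          ENNReal.ofReal (levelJacobian U Y₁ Y₂ v d (trunc c) z / ‖v z‖ ^ 2) ∂coeffLaw =
        M * ENNReal.ofReal Real.pi⁻¹ := by
      have hne : ∀ᵐ z ∂(volume : Measure ℂ), z ≠ 0 := by simp [ae_iff]
      filter_upwards [ae_restrict_of_ae hne] with z hz
      exact h.lintegral_level hz
    -- The factor 1/π is the Gaussian density at 0; it is exactly the normalization of `ν`.
    rw [lintegral_congr_ae e2, setLIntegral_const, ν, Measure.smul_apply, smul_eq_mul,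
      ENNReal.ofReal_inv_of_pos Real.pi_pos, mul_assoc]

/-- Almost surely, the Jacobian factor does not vanish at the zeros of `U`. -/
theorem IsKacRice.ae_nondegenerate (h : IsKacRice U Y₁ Y₂ v v₁ v₂ d M) :
    ∀ᵐ c ∂coeffLaw, ∀ z, U (trunc c) z = 0 → d (Y₁ (trunc c) z, Y₂ (trunc c) z) ≠ 0 := by
  -- The event is written through compact balls to obtain its measurability, which is needed to pass
  -- from conditional to full probability.
  set s : Set (ℕ → ℂ) := (⋃ n : ℕ, {c | ∃ z ∈ Metric.closedBall (0 : ℂ) n,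
    ‖U (trunc c) z‖ + |d (Y₁ (trunc c) z, Y₂ (trunc c) z)| = 0})ᶜ with hs
  have hsm : MeasurableSet s := by
    refine (MeasurableSet.iUnion fun n => measurableSet_exists_zero (fun c => ?_) (fun z => ?_)
      (isCompact_closedBall _ _)).compl
    · exact (h.field.continuous (expBounded_trunc c)).norm.add
        (h.continuous_jacobian (expBounded_trunc c)).abs
    · exact (h.field.measurable_trunc z).norm.add
        (continuous_abs.measurable.comp (h.measurable_jacobian z))
  have hmem : ∀ c, c ∈ s ↔
      ∀ z, U (trunc c) z = 0 → d (Y₁ (trunc c) z, Y₂ (trunc c) z) ≠ 0 := by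
    intro c
    have hz : ∀ z, ‖U (trunc c) z‖ + |d (Y₁ (trunc c) z, Y₂ (trunc c) z)| = 0 ↔
        U (trunc c) z = 0 ∧ d (Y₁ (trunc c) z, Y₂ (trunc c) z) = 0 := fun z => by
      rw [add_eq_zero_iff_of_nonneg (norm_nonneg _) (abs_nonneg _), norm_eq_zero, abs_eq_zero]
    simp only [hs, mem_compl_iff, mem_iUnion, mem_ofPred_eq, hz, not_exists]
    constructor
    · intro h1 z h2 h3
      obtain ⟨n, hn⟩ := exists_nat_ge ‖z‖
      exact h1 n z ⟨by simpa using hn, h2, h3⟩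
    · rintro h1 n z ⟨-, h2, h3⟩
      exact h1 z h2 h3
  have key : ∀ᵐ c ∂coeffLaw, c ∈ s := by
    refine ae_coeffLaw_of_cons hsm ?_
    filter_upwards [ae_mem_tameSet, ae_cons_of_ae_coeffLaw h.ne_zero] with c hc h0
    have hcb := expBounded_trunc c
    choose! L hL hLdet using h.hasFDerivAt (trunc c) hcb
    set t : Set ℂ := {z | z ≠ 0 ∧ levelJacobian U Y₁ Y₂ v d (trunc c) z = 0} with ht
    -- Sard's theorem: a degenerate zero away from the origin forces a₀ to be a critical value of
    -- the level map, and critical values form a null set.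
    have hsard : (volume : Measure ℂ) (level U v (trunc c) '' t) = 0 := by
      refine addHaar_image_eq_zero_of_det_fderivWithin_eq_zero volume
        (fun z hz => (hL z hz.1).hasFDerivWithinAt) fun z hz => ?_
      rw [← abs_eq_zero, hLdet z hz.1]
      have : d (Y₁ (cons (level U v (trunc c) z) (trunc c)) z,
        Y₂ (cons (level U v (trunc c) z) (trunc c)) z) = 0 := hz.2
      rw [this]; simp
    have h1 : ∀ᵐ x ∂stdComplexGaussian, x ∉ level U v (trunc c) '' t :=
      measure_eq_zero_iff_ae_notMem.1 (stdComplexGaussian_absolutelyContinuous hsard)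
    filter_upwards [h0, h1] with x hx0 hx1
    rw [hmem]
    intro z hz hdz
    rw [trunc_cons hc] at hx0 hz hdz
    have hz0 : z ≠ 0 := fun e => hx0 (e ▸ hz)
    have hl := (h.cons_eq_zero_iff hcb hz0 x).1 hz
    exact hx1 ⟨z, ⟨hz0, by rw [levelJacobian, hl]; exact hdz⟩, hl⟩
  filter_upwards [key] with c hc
  exact (hmem c).1 hc

end KacRice

end GEF

end

noncomputable section

namespace GEF

open Set Filter Topology

/-! ### The zeros of `F` and of its translation-invariant derivative -/

lemma isAffineField_F : IsAffineField F fun _ => 1 where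
  continuous_slope := continuous_const
  continuous := continuous_F
  measurable := measurable_F
  map_cons hc x z := by rw [F_cons hc, one_mul]

lemma isAffineField_chern1 : IsAffineField chern1 fun z => -conj z where
  continuous_slope := Complex.continuous_conj.neg
  continuous := continuous_chern1
  measurable := measurable_chern1
  map_cons := chern1_cons

lemma isAffineField_chern2 : IsAffineField chern2 fun z => conj z ^ 2 where
  continuous_slope := Complex.continuous_conj.pow 2
  continuous := continuous_chern2
  measurable := measurable_chern2
  map_cons := chern2_cons

lemma lintegral_jet (z : ℂ) {f : ℂ × ℂ × ℂ → ℝ≥0∞} (hf : Measurable f) :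
    ∫⁻ c, f (F (trunc c) z, chern1 (trunc c) z, chern2 (trunc c) z) ∂coeffLaw =
      ∫⁻ u₀, ∫⁻ u₁, ∫⁻ u₂, f ((Real.exp (‖z‖ ^ 2 / 2) : ℂ) * u₀, (Real.exp (‖z‖ ^ 2 / 2) : ℂ) * u₁,
        (Real.exp (‖z‖ ^ 2 / 2) : ℂ) * ((Real.sqrt 2 : ℂ) * u₂))
        ∂stdComplexGaussian ∂stdComplexGaussian ∂stdComplexGaussian := by
  have hm : Measurable (fun c => (F (trunc c) z, chern1 (trunc c) z, chern2 (trunc c) z)) :=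
    (measurable_F expBounded_trunc measurable_trunc z).prodMk
      ((measurable_chern1 expBounded_trunc measurable_trunc z).prodMk
        (measurable_chern2 expBounded_trunc measurable_trunc z))
  have hm' : Measurable (fun p : ℂ × ℂ × ℂ => ((Real.exp (‖z‖ ^ 2 / 2) : ℂ) * p.1,
      (Real.exp (‖z‖ ^ 2 / 2) : ℂ) * p.2.1,
      (Real.exp (‖z‖ ^ 2 / 2) : ℂ) * ((Real.sqrt 2 : ℂ) * p.2.2))) := by fun_prop
  have hfm := hf.comp hm'
  rw [← lintegral_map hf hm, map_jet, lintegral_map hf hm']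
  refine (lintegral_prod _ hfm.aemeasurable).trans (lintegral_congr fun u => ?_)
  exact lintegral_prod _ (hfm.comp measurable_prodMk_left).aemeasurable

lemma norm_exp_half (z : ℂ) : ‖(Real.exp (‖z‖ ^ 2 / 2) : ℂ)‖ = Real.exp (‖z‖ ^ 2 / 2) := by
  rw [Complex.norm_real, Real.norm_eq_abs, abs_of_pos (Real.exp_pos _)]

lemma norm_sqrt_two : ‖((Real.sqrt 2 : ℝ) : ℂ)‖ ^ 2 = 2 := by
  rw [Complex.norm_real, Real.norm_eq_abs, sq_abs, Real.sq_sqrt zero_le_two]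

lemma lintegral_scale_stdComplexGaussian (z : ℂ) {ψ : ℂ → ℝ≥0∞} (hψ : Measurable ψ) :
    ENNReal.ofReal (Real.exp (‖z‖ ^ 2 / 2) ^ 2) *
      ∫⁻ u, ψ ((Real.exp (‖z‖ ^ 2 / 2) : ℂ) * u) ∂stdComplexGaussian =
      ∫⁻ u, ENNReal.ofReal (gaussDensity ((Real.exp (-(‖z‖ ^ 2 / 2)) : ℂ) * u)) * ψ u := by
  have hs : (Real.exp (‖z‖ ^ 2 / 2) : ℂ) ≠ 0 := by exact_mod_cast (Real.exp_pos _).ne'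
  have hψ' : Measurable fun u => ψ ((Real.exp (‖z‖ ^ 2 / 2) : ℂ) * u) := hψ.comp (by fun_prop)
  rw [lintegral_stdComplexGaussian hψ', lintegral_comp_affine hs 0 (fun u => ENNReal.ofReal
      (gaussDensity ((Real.exp (-(‖z‖ ^ 2 / 2)) : ℂ) * u)) * ψ u), norm_exp_half,
    ← lintegral_const_mul' _ _ ENNReal.ofReal_ne_top]
  refine lintegral_congr fun u => ?_
  have e : (Real.exp (-(‖z‖ ^ 2 / 2)) : ℂ) * ((Real.exp (‖z‖ ^ 2 / 2) : ℂ) * u + 0) = u := by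
    rw [add_zero, ← mul_assoc, ← Complex.ofReal_mul, ← Real.exp_add]; simp
  rw [e, add_zero]

lemma lintegral_norm_F_sq_ne_top (z : ℂ) :
    ∫⁻ c, ENNReal.ofReal (‖F (trunc c) z‖ ^ 2) ∂coeffLaw ≠ ∞ := by
  have h := lintegral_jet z (f := fun p => ENNReal.ofReal (‖p.1‖ ^ 2)) (by fun_prop)
  simp only [lintegral_const, measure_univ, mul_one, norm_mul, mul_pow,
    ENNReal.ofReal_mul (sq_nonneg _)] at h
  rw [h, lintegral_const_mul _ (by fun_prop), lintegral_norm_sq]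
  finiteness

lemma lintegral_norm_chern1_sq_ne_top (z : ℂ) :
    ∫⁻ c, ENNReal.ofReal (‖chern1 (trunc c) z‖ ^ 2) ∂coeffLaw ≠ ∞ := by
  have h := lintegral_jet z (f := fun p => ENNReal.ofReal (‖p.2.1‖ ^ 2)) (by fun_prop)
  simp only [lintegral_const, measure_univ, mul_one, norm_mul, mul_pow,
    ENNReal.ofReal_mul (sq_nonneg _)] at h
  rw [h, lintegral_const_mul _ (by fun_prop), lintegral_norm_sq]
  finiteness

lemma lintegral_norm_chern2_sq_ne_top (z : ℂ) :
    ∫⁻ c, ENNReal.ofReal (‖chern2 (trunc c) z‖ ^ 2) ∂coeffLaw ≠ ∞ := by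
  have h := lintegral_jet z (f := fun p => ENNReal.ofReal (‖p.2.2‖ ^ 2)) (by fun_prop)
  simp only [lintegral_const, measure_univ, mul_one, norm_mul, mul_pow,
    ENNReal.ofReal_mul (sq_nonneg _)] at h
  rw [h, lintegral_const_mul _ (by fun_prop), lintegral_const_mul _ (by fun_prop),
    lintegral_norm_sq]
  finiteness

lemma F_zero (c : ℕ → ℂ) : F c 0 = c 0 := by
  rw [F, tsum_eq_single 0]
  · simp [term]
  · intro k hk
    simp [term, hk]

lemma ae_eval_ne_zero (k : ℕ) : ∀ᵐ c ∂coeffLaw, c k ≠ 0 := by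
  have h := (measurePreserving_eval_infinitePi (fun _ : ℕ => stdComplexGaussian) k)
  refine h.quasiMeasurePreserving.ae (p := fun x => x ≠ 0) ?_
  have h0 : ∀ᵐ x ∂(volume : Measure ℂ), x ≠ 0 := by simp [ae_iff]
  exact stdComplexGaussian_absolutelyContinuous.ae_le h0

/-- The level map is holomorphic with Jacobian |F'|², and F' = ∇'F at a zero of F. Independence of F
and ∇'F gives the constant E|N₁|² = 1; `chern2` only fills the second slot, since d depends on the
first. -/
lemma isKacRice_F : IsKacRice F chern1 chern2 (fun _ => 1) (fun z => -conj z) (fun z => conj z ^ 2)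
    (fun y => ‖y.1‖ ^ 2) 1 where
  field := isAffineField_F
  field₁ := isAffineField_chern1
  field₂ := isAffineField_chern2
  slope_ne_zero _ _ := one_ne_zero
  continuous_d := by fun_prop
  d_le := ⟨1, fun y => by nlinarith [sq_nonneg ‖y.2‖]⟩
  hasFDerivAt c hc z _ := by
    have h0 := (hasDerivAt_F (hc.cons 0) z).neg
    have e : level F (fun _ => 1) c = -F (cons 0 c) := by
      ext w; simp [level]
    refine ⟨_, e ▸ h0.hasFDerivAt.restrictScalars ℝ, ?_⟩
    rw [det_eq_of_forall (α := -F (derivCoeff (cons 0 c)) z) (β := 0) fun w => by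
      simp [mul_comm], chern1, F_cons hc, derivCoeff_cons, e]
    simp
    rfl
  ne_zero := by
    filter_upwards [ae_mem_tameSet, ae_eval_ne_zero 0] with c hc h
    rwa [trunc_of_mem hc, F_zero]
  moment₁ := lintegral_norm_chern1_sq_ne_top
  moment₂ := lintegral_norm_chern2_sq_ne_top
  law z ψ hψ := by
    have h := lintegral_jet z (f := fun p => ENNReal.ofReal (‖p.2.1‖ ^ 2) * ψ p.1)
      ((by fun_prop : Measurable fun p : ℂ × ℂ × ℂ => ENNReal.ofReal (‖p.2.1‖ ^ 2)).mul
        (hψ.comp measurable_fst))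
    have hψ' : Measurable fun u => ψ ((Real.exp (‖z‖ ^ 2 / 2) : ℂ) * u) := hψ.comp (by fun_prop)
    simp only [lintegral_const, measure_univ, mul_one, norm_mul, mul_pow,
      ENNReal.ofReal_mul (sq_nonneg _)] at h
    refine h.trans ?_
    rw [ENNReal.coe_one, one_mul, ← lintegral_scale_stdComplexGaussian z hψ,
      ← lintegral_const_mul _ hψ']
    refine lintegral_congr fun u => ?_
    rw [lintegral_mul_const _ (by fun_prop), lintegral_const_mul _ (by fun_prop),
      lintegral_norm_sq, mul_one, norm_exp_half]

/-- Let f be the series with zero constant coefficient. Away from the origin the level map is f'/w̄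
- f, with Wirtinger derivatives f''/z̄ - f' and -f'/z̄². When a₀ equals this level, F = f'/z̄ and
∇'∇'F = z̄(f''/z̄ - f'), so these derivatives have moduli |∇'∇'F|/|z| and |F|/|z|. -/
lemma hasFDerivAt_level_chern1 {c : ℕ → ℂ} (hc : ExpBounded c) {z : ℂ} (hz : z ≠ 0) :
    ∃ L : ℂ →L[ℝ] ℂ, HasFDerivAt (level chern1 (fun z => -conj z) c) L z ∧
      L.det = (‖chern2 (cons (level chern1 (fun z => -conj z) c z) c) z‖ ^ 2 -
        ‖F (cons (level chern1 (fun z => -conj z) c z) c) z‖ ^ 2) / ‖-conj z‖ ^ 2 := by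
  have hc0 := hc.cons 0
  set f := cons 0 c with hf
  have hz' : conj z ≠ 0 := (map_ne_zero _).2 hz
  have hconj : HasFDerivAt (fun w : ℂ => conj w) (Complex.conjCLE : ℂ →L[ℝ] ℂ) z :=
    Complex.conjCLE.hasFDerivAt
  have hinv := ((hasDerivAt_inv hz').hasFDerivAt.restrictScalars ℝ).comp z hconj
  have h0 := (hasDerivAt_F hc0 z).hasFDerivAt.restrictScalars ℝ
  have h1 := (hasDerivAt_F hc0.derivCoeff z).hasFDerivAt.restrictScalars ℝ
  have h2 := (h1.mul hinv).sub h0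
  have e : ∀ w, w ≠ 0 → level chern1 (fun z => -conj z) c w =
      F (derivCoeff f) w * (conj w)⁻¹ - F f w := by
    intro w hw
    have hw' : conj w ≠ 0 := (map_ne_zero _).2 hw
    rw [level, chern1, ← hf]
    field_simp
  have hev : level chern1 (fun z => -conj z) c =ᶠ[𝓝 z]
      fun w => F (derivCoeff f) w * (conj w)⁻¹ - F f w := by
    filter_upwards [isOpen_ne.mem_nhds hz] with w hw
    exact e w hw
  refine ⟨_, HasFDerivAt.congr_of_eventuallyEq h2 hev, ?_⟩
  rw [det_eq_of_forall
    (α := F (derivCoeff (derivCoeff f)) z / conj z - F (derivCoeff f) z)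
    (β := -F (derivCoeff f) z / conj z ^ 2) fun w => by
      simp
      field_simp
      ring]
  have hF : F (cons (level chern1 (fun z => -conj z) c z) c) z = F (derivCoeff f) z / conj z := by
    rw [F_cons hc, e z hz]; simp only [← hf]; field_simp; ring
  have hK : chern2 (cons (level chern1 (fun z => -conj z) c z) c) z =
      (F (derivCoeff (derivCoeff f)) z / conj z - F (derivCoeff f) z) * conj z := by
    rw [chern2_cons hc, e z hz, chern2]; simp only [← hf]; field_simp; ring
  rw [hF, hK]
  simp only [norm_mul, norm_div, norm_neg, norm_pow, RCLike.norm_conj]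
  field_simp

/-- Stated for an unspecified sign of the Jacobian, so that one choice of d counts the maxima and
the opposite one the saddles. The law factors because ∇'F is independent of (F, ∇'∇'F). -/
lemma isKacRice_chern1 {d : ℂ × ℂ → ℝ} {M : ℝ≥0} (hd : Continuous d)
    (hdabs : ∀ y, |d y| = |‖y.2‖ ^ 2 - ‖y.1‖ ^ 2|)
    (hdscale : ∀ (r : ℝ) y₁ y₂, d ((r : ℂ) * y₁, (r : ℂ) * y₂) = r ^ 2 * d (y₁, y₂))
    (hM : ∫⁻ y₁, ∫⁻ y₂, ENNReal.ofReal (d (y₁, (Real.sqrt 2 : ℂ) * y₂))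
      ∂stdComplexGaussian ∂stdComplexGaussian = M) :
    IsKacRice chern1 F chern2 (fun z => -conj z) (fun _ => 1) (fun z => conj z ^ 2) d M where
  field := isAffineField_chern1
  field₁ := isAffineField_F
  field₂ := isAffineField_chern2
  slope_ne_zero z hz := neg_ne_zero.2 ((map_ne_zero _).2 hz)
  continuous_d := hd
  d_le := ⟨1, fun y => by
    refine (le_abs_self _).trans ?_
    rw [hdabs, one_mul, abs_le]
    constructor <;> nlinarith [sq_nonneg ‖y.1‖, sq_nonneg ‖y.2‖]⟩
  hasFDerivAt c hc z hz := by
    obtain ⟨L, hL, hdet⟩ := hasFDerivAt_level_chern1 hc hz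
    refine ⟨L, hL, ?_⟩
    rw [hdet, abs_div, hdabs, abs_of_nonneg (sq_nonneg ‖-conj z‖)]
  ne_zero := by
    -- At the origin ∇'F equals F'(0) = a₁.
    filter_upwards [ae_mem_tameSet, ae_eval_ne_zero 1] with c hc h
    rw [trunc_of_mem hc, chern1, F_zero]
    simpa [derivCoeff] using h
  moment₁ := lintegral_norm_F_sq_ne_top
  moment₂ := lintegral_norm_chern2_sq_ne_top
  law z ψ hψ := by
    have h := lintegral_jet z (f := fun p => ENNReal.ofReal (d (p.1, p.2.2)) * ψ p.2.1)
      ((hd.measurable.comp (by fun_prop : Measurable fun p : ℂ × ℂ × ℂ => (p.1, p.2.2))).ennreal_ofReal.mul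
        (hψ.comp (by fun_prop)))
    have hψ' : Measurable fun u => ψ ((Real.exp (‖z‖ ^ 2 / 2) : ℂ) * u) := hψ.comp (by fun_prop)
    refine h.trans ?_
    have hd2 : Measurable fun p : ℂ × ℂ => ENNReal.ofReal (d (p.1, (Real.sqrt 2 : ℂ) * p.2)) :=
      (hd.measurable.comp (by fun_prop)).ennreal_ofReal
    have hd1 : ∀ u₀, Measurable fun u₂ => ENNReal.ofReal (d (u₀, (Real.sqrt 2 : ℂ) * u₂)) :=
      fun u₀ => hd2.comp measurable_prodMk_left
    have hd3 : Measurable fun u₀ => ∫⁻ u₂, ENNReal.ofReal (d (u₀, (Real.sqrt 2 : ℂ) * u₂))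
        ∂stdComplexGaussian := hd2.lintegral_prod_right'
    simp only [hdscale, ENNReal.ofReal_mul (sq_nonneg _)]
    rw [← lintegral_scale_stdComplexGaussian z hψ, ← hM]
    have e : ∀ u₀, ∫⁻ u₁, ∫⁻ u₂, ENNReal.ofReal (Real.exp (‖z‖ ^ 2 / 2) ^ 2) *
        ENNReal.ofReal (d (u₀, (Real.sqrt 2 : ℂ) * u₂)) * ψ ((Real.exp (‖z‖ ^ 2 / 2) : ℂ) * u₁)
          ∂stdComplexGaussian ∂stdComplexGaussian =
        (∫⁻ u₂, ENNReal.ofReal (d (u₀, (Real.sqrt 2 : ℂ) * u₂)) ∂stdComplexGaussian) *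
        (ENNReal.ofReal (Real.exp (‖z‖ ^ 2 / 2) ^ 2) *
          ∫⁻ u, ψ ((Real.exp (‖z‖ ^ 2 / 2) : ℂ) * u) ∂stdComplexGaussian) := by
      intro u₀
      rw [← mul_assoc, ← lintegral_const_mul _ hψ']
      refine lintegral_congr fun u₁ => ?_
      rw [lintegral_mul_const _ ((hd1 u₀).const_mul _), lintegral_const_mul _ (hd1 u₀)]
      ring
    simp only [e]
    rw [lintegral_mul_const _ hd3]

lemma isKacRice_localMax : IsKacRice chern1 F chern2 (fun z => -conj z) (fun _ => 1)
    (fun z => conj z ^ 2) (fun y => ‖y.1‖ ^ 2 - ‖y.2‖ ^ 2) (1 / 3) := by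
  refine isKacRice_chern1 (by fun_prop) (fun y => abs_sub_comm _ _) (fun r y₁ y₂ => ?_) ?_
  · simp only [norm_mul, mul_pow, Complex.norm_real, Real.norm_eq_abs, sq_abs]; ring
  · simp only [norm_mul, mul_pow, norm_sqrt_two]
    rw [lintegral_lintegral_swap (by fun_prop), lintegral_lintegral_norm_sq_sub_two]
    rw [ENNReal.coe_div (by norm_num)]; simp

lemma isKacRice_saddle : IsKacRice chern1 F chern2 (fun z => -conj z) (fun _ => 1)
    (fun z => conj z ^ 2) (fun y => ‖y.2‖ ^ 2 - ‖y.1‖ ^ 2) (4 / 3) := by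
  refine isKacRice_chern1 (by fun_prop) (fun y => rfl) (fun r y₁ y₂ => ?_) ?_
  · simp only [norm_mul, mul_pow, Complex.norm_real, Real.norm_eq_abs, sq_abs]; ring
  · simp only [norm_mul, mul_pow, norm_sqrt_two]
    rw [lintegral_lintegral_swap (by fun_prop), lintegral_lintegral_two_norm_sq_sub]
    rw [ENNReal.coe_div (by norm_num)]; simp

end GEF

end

noncomputable section

namespace GEF

open Set Filter Topology

/-! ### The spectrogram of white noise -/

/-- The function `exp(-2πs²)` whose derivatives define the Hermite functions. -/
def gaussExp (s : ℝ) : ℝ := Real.exp (-2 * Real.pi * s ^ 2)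

lemma contDiff_gaussExp {n : WithTop ℕ∞} : ContDiff ℝ n gaussExp := by
  unfold gaussExp; fun_prop

lemma hasDerivAt_iteratedDeriv_gaussExp (k : ℕ) (t : ℝ) :
    HasDerivAt (iteratedDeriv k gaussExp) (iteratedDeriv (k + 1) gaussExp t) t := by
  rw [iteratedDeriv_succ]
  exact ((contDiff_gaussExp (n := (k + 1 : ℕ))).differentiable_iteratedDeriv k
    (by exact_mod_cast Nat.lt_succ_self k) t).hasDerivAt

lemma exists_iteratedDeriv_gaussExp (k : ℕ) :
    ∃ p : Polynomial ℝ, ∀ t, iteratedDeriv k gaussExp t = p.eval t * gaussExp t := by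
  induction k with
  | zero => exact ⟨1, by simp⟩
  | succ k ih =>
    obtain ⟨p, hp⟩ := ih
    refine ⟨p.derivative - Polynomial.C (4 * Real.pi) * Polynomial.X * p, fun t => ?_⟩
    have hg : HasDerivAt (fun t => gaussExp t) (gaussExp t * (-2 * Real.pi * (2 * t))) t := by
      have h := ((hasDerivAt_pow 2 t).const_mul (-2 * Real.pi)).exp
      simpa [gaussExp, Function.comp_def] using h
    have h1 := (p.hasDerivAt t).mul hg
    have h2 := hasDerivAt_iteratedDeriv_gaussExp k t
    rw [show iteratedDeriv k gaussExp = fun t => p.eval t * gaussExp t from funext hp] at h2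
    rw [h2.unique h1]
    simp only [Polynomial.eval_sub, Polynomial.eval_mul, Polynomial.eval_C, Polynomial.eval_X]
    ring

lemma integrable_gaussExp_mul_cexp (b : ℂ) :
    Integrable fun t : ℝ => (gaussExp t : ℂ) * Complex.exp (b * t) := by
  have h := integrable_cexp_quadratic (b := 2 * (Real.pi : ℂ)) (by simp [Real.pi_pos]) b 0
  refine h.congr (ae_of_all _ fun t => ?_)
  simp only [gaussExp, Complex.ofReal_exp, ← Complex.exp_add]
  congr 1
  push_cast
  ring

lemma abs_pow_le_factorial_mul (n : ℕ) (t : ℝ) :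
    |t| ^ n ≤ n.factorial * (Real.exp t + Real.exp (-t)) := by
  have h := Real.pow_div_factorial_le_exp |t| (abs_nonneg t) n
  rw [div_le_iff₀ (by positivity), mul_comm] at h
  refine h.trans (mul_le_mul_of_nonneg_left ?_ (by positivity))
  rcases abs_cases t with ⟨e, _⟩ | ⟨e, _⟩ <;> rw [e] <;>
    linarith [Real.exp_pos t, Real.exp_pos (-t)]

/-- The bound |t|^n ≤ n!(e^t + e^(-t)) trades a monomial for the exponents b ± 1, where the Gaussian
integral converges. -/
lemma integrable_eval_mul_gaussExp_mul_cexp (p : Polynomial ℝ) (b : ℂ) :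
    Integrable fun t : ℝ => ((p.eval t * gaussExp t : ℝ) : ℂ) * Complex.exp (b * t) := by
  induction p using Polynomial.induction_on' with
  | add p q hp hq =>
    refine (hp.add hq).congr (ae_of_all _ fun t => ?_)
    simp only [Pi.add_apply, Polynomial.eval_add]
    push_cast
    ring
  | monomial n a =>
    have h1 := (integrable_gaussExp_mul_cexp (b + 1)).norm
    have h2 := (integrable_gaussExp_mul_cexp (b - 1)).norm
    refine ((h1.add h2).const_mul (|a| * n.factorial)).mono' ?_ (ae_of_all _ fun t => ?_)
    · refine Continuous.aestronglyMeasurable ?_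
      have := (contDiff_gaussExp (n := 0)).continuous
      fun_prop
    · have e1 : ∀ s : ℝ, ‖Complex.exp ((b + s) * t)‖ = ‖Complex.exp (b * t)‖ * Real.exp (s * t) := by
        intro s
        rw [add_mul, Complex.exp_add, norm_mul, ← Complex.ofReal_mul, ← Complex.ofReal_exp,
          Complex.norm_real, Real.norm_eq_abs, abs_of_pos (Real.exp_pos _)]
      have e2 := e1 1
      have e3 := e1 (-1)
      simp only [Complex.ofReal_one, Complex.ofReal_neg, one_mul, neg_one_mul,
        ← sub_eq_add_neg] at e2 e3
      simp only [Pi.add_apply, norm_mul, e2, e3, Polynomial.eval_monomial, Complex.ofReal_mul,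
        Complex.norm_real, Real.norm_eq_abs, Complex.ofReal_pow, norm_pow]
      calc |a| * |t| ^ n * |gaussExp t| * ‖Complex.exp (b * t)‖
          ≤ |a| * (n.factorial * (Real.exp t + Real.exp (-t))) * |gaussExp t| *
            ‖Complex.exp (b * t)‖ := by gcongr; exact abs_pow_le_factorial_mul n t
        _ = _ := by ring

lemma integrable_iteratedDeriv_gaussExp_mul_cexp (k : ℕ) (b : ℂ) :
    Integrable fun t : ℝ => ((iteratedDeriv k gaussExp t : ℝ) : ℂ) * Complex.exp (b * t) := by
  obtain ⟨p, hp⟩ := exists_iteratedDeriv_gaussExp k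
  simp only [hp]
  exact integrable_eval_mul_gaussExp_mul_cexp p b

lemma integral_gaussExp_mul_cexp (b : ℂ) :
    ∫ t : ℝ, (gaussExp t : ℂ) * Complex.exp (b * t) =
      ((Real.sqrt 2 : ℝ) : ℂ)⁻¹ * Complex.exp (b ^ 2 / (8 * Real.pi)) := by
  have hpi : (Real.pi : ℂ) ≠ 0 := by exact_mod_cast Real.pi_ne_zero
  have h := integral_cexp_quadratic (b := -(2 * (Real.pi : ℂ))) (by simp [Real.pi_pos]) b 0
  have e : ((Real.pi : ℂ) / -(-(2 * (Real.pi : ℂ)))) ^ (1 / 2 : ℂ) = ((Real.sqrt 2 : ℝ) : ℂ)⁻¹ := by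
    rw [neg_neg, show (Real.pi : ℂ) / (2 * Real.pi) = ((2⁻¹ : ℝ) : ℂ) by push_cast; field_simp,
      show (1 / 2 : ℂ) = ((1 / 2 : ℝ) : ℂ) by push_cast; rfl,
      ← Complex.ofReal_cpow (by norm_num), ← Real.sqrt_eq_rpow, Real.sqrt_inv, Complex.ofReal_inv]
  rw [e] at h
  convert h using 1
  · refine integral_congr_ae (ae_of_all _ fun t => ?_)
    simp only [gaussExp, Complex.ofReal_exp, ← Complex.exp_add]
    congr 1
    push_cast
    ring
  · congr 2
    field_simp
    ring

/-- Each integration by parts moves one derivative onto the exponential and yields a factor -b;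
integrability of the products makes the boundary terms vanish. -/
lemma integral_iteratedDeriv_gaussExp_mul_cexp (k : ℕ) (b : ℂ) :
    ∫ t : ℝ, ((iteratedDeriv k gaussExp t : ℝ) : ℂ) * Complex.exp (b * t) =
      (-b) ^ k * (((Real.sqrt 2 : ℝ) : ℂ)⁻¹ * Complex.exp (b ^ 2 / (8 * Real.pi))) := by
  induction k with
  | zero => simpa using integral_gaussExp_mul_cexp b
  | succ k ih =>
    have hu : ∀ t : ℝ, HasDerivAt (fun t : ℝ => Complex.exp (b * t)) (Complex.exp (b * t) * b) t := by
      intro t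
      have := (((hasDerivAt_id (t : ℂ)).const_mul b).cexp).comp_ofReal
      simpa using this
    have hv : ∀ t : ℝ, HasDerivAt (fun t : ℝ => ((iteratedDeriv k gaussExp t : ℝ) : ℂ))
        ((iteratedDeriv (k + 1) gaussExp t : ℝ) : ℂ) t :=
      fun t => (hasDerivAt_iteratedDeriv_gaussExp k t).ofReal_comp
    have h1 := integrable_iteratedDeriv_gaussExp_mul_cexp k b
    have h2 := integrable_iteratedDeriv_gaussExp_mul_cexp (k + 1) b
    have h := integral_mul_deriv_eq_deriv_mul_of_integrable (fun t _ => hu t) (fun t _ => hv t)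
      (h2.congr (ae_of_all _ fun t => mul_comm _ _))
      ((h1.mul_const b).congr (ae_of_all _ fun t => by simp only [Pi.mul_apply]; ring))
      (h1.congr (ae_of_all _ fun t => mul_comm _ _))
    calc ∫ t : ℝ, ((iteratedDeriv (k + 1) gaussExp t : ℝ) : ℂ) * Complex.exp (b * t)
        = ∫ t : ℝ, Complex.exp (b * t) * ((iteratedDeriv (k + 1) gaussExp t : ℝ) : ℂ) :=
          integral_congr_ae (ae_of_all _ fun t => mul_comm _ _)
      _ = -∫ t : ℝ, Complex.exp (b * t) * b * ((iteratedDeriv k gaussExp t : ℝ) : ℂ) := h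
      _ = -∫ t : ℝ, b * (((iteratedDeriv k gaussExp t : ℝ) : ℂ) * Complex.exp (b * t)) := by
          congr 1
          exact integral_congr_ae (ae_of_all _ fun t => by simp only; ring)
      _ = _ := by
          rw [integral_const_mul, ih, pow_succ]
          ring

lemma sqrt_two_eq_sq : (2 : ℝ) ^ (1 / 4 : ℝ) * (2 : ℝ) ^ (1 / 4 : ℝ) = Real.sqrt 2 := by
  rw [← Real.rpow_add two_pos, Real.sqrt_eq_rpow]; norm_num

/-- The factor exp(πt²) of the Hermite function cancels the quadratic part of the translated window.
What remains is the k-th derivative of exp(-2πt²) integrated against exp(2√π z t). -/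
lemma whiteNoiseTerm_eq (c : ℕ → ℂ) (z : ℂ) (k : ℕ) :
    whiteNoiseTerm c z k = Complex.exp (z ^ 2 / 2 - (z.re : ℂ) ^ 2) * term c z k := by
  set s : ℝ := Real.sqrt Real.pi with hs
  have hs0 : s ≠ 0 := (Real.sqrt_pos.2 Real.pi_pos).ne'
  have hsc : (s : ℂ) ≠ 0 := by exact_mod_cast hs0
  have hss : s ^ 2 = Real.pi := Real.sq_sqrt Real.pi_pos.le
  have hssc : (Real.pi : ℂ) = (s : ℂ) ^ 2 := by rw [← hss]; push_cast; rfl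
  have hre : (conj z / (s : ℂ)).re = z.re / s := by simp
  have him : (conj z / (s : ℂ)).im = -z.im / s := by simp
  have hint : ∀ t : ℝ, (hermiteFn k t : ℂ) * conj ((gaussWindow (t - z.re / s) : ℝ) : ℂ) *
      Complex.exp (-2 * (Real.pi : ℂ) * Complex.I * ((-z.im / s : ℝ) : ℂ) * (t : ℂ)) =
      (((Real.sqrt 2 / Real.sqrt (k.factorial : ℝ) * (-1 / (2 * s)) ^ k : ℝ) : ℂ) *
        Complex.exp (-(z.re : ℂ) ^ 2)) *
        (((iteratedDeriv k gaussExp t : ℝ) : ℂ) * Complex.exp (2 * s * z * t)) := by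
    intro t
    have h1 : hermiteFn k t * gaussWindow (t - z.re / s) =
        (Real.sqrt 2 / Real.sqrt (k.factorial : ℝ) * (-1 / (2 * s)) ^ k) *
          Real.exp (-z.re ^ 2 + 2 * s * z.re * t) * iteratedDeriv k gaussExp t := by
      have h2 : Real.exp (Real.pi * t ^ 2) * Real.exp (-Real.pi * (t - z.re / s) ^ 2) =
          Real.exp (-z.re ^ 2 + 2 * s * z.re * t) := by
        rw [← Real.exp_add, ← hss]
        congr 1
        field_simp
        ring
      rw [← h2, ← sqrt_two_eq_sq, hermiteFn, gaussWindow, ← hs]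
      change _ * iteratedDeriv k gaussExp t * _ = _
      ring
    rw [Complex.conj_ofReal, ← Complex.ofReal_mul, h1]
    have h3 : Complex.exp (2 * s * z * t) = Complex.exp (2 * s * z.re * t) *
        Complex.exp (-2 * (Real.pi : ℂ) * Complex.I * ((-z.im / s : ℝ) : ℂ) * (t : ℂ)) := by
      rw [← Complex.exp_add]
      congr 1
      nth_rewrite 1 [← Complex.re_add_im z]
      rw [hssc]
      push_cast
      field_simp
    rw [h3]
    push_cast
    rw [Complex.exp_add]
    ring
  have hk : ((Real.sqrt (k.factorial : ℝ) : ℝ) : ℂ) ≠ 0 := by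
    exact_mod_cast (sqrt_factorial_pos k).ne'
  have h2 : ((Real.sqrt 2 : ℝ) : ℂ) ≠ 0 := by
    exact_mod_cast (Real.sqrt_pos.2 two_pos).ne'
  rw [whiteNoiseTerm, stft, ← hs, hre, him]
  simp only [hint]
  rw [integral_const_mul, integral_iteratedDeriv_gaussExp_mul_cexp, term,
    show (2 * (s : ℂ) * z) ^ 2 / (8 * (Real.pi : ℂ)) = z ^ 2 / 2 by rw [hssc]; field_simp; ring,
    sub_eq_add_neg, Complex.exp_add]
  -- The normalization of the Hermite functions is exactly what cancels the powers of -2√π from the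
  -- integrations by parts.
  have h4 : (((-1 / (2 * s)) ^ k : ℝ) : ℂ) * (-(2 * (s : ℂ) * z)) ^ k = z ^ k := by
    push_cast
    rw [← mul_pow]
    congr 1
    field_simp
  rw [← h4, Complex.ofReal_mul]
  push_cast
  field_simp

lemma ExpBounded.summable_whiteNoiseTerm {c : ℕ → ℂ} (hc : ExpBounded c) (z : ℂ) :
    Summable (whiteNoiseTerm c z) := by
  rw [show whiteNoiseTerm c z = _ from funext (whiteNoiseTerm_eq c z)]
  exact (hc.summable_term z).mul_left _

/-- With z = x + iy, the squared modulus of exp(z²/2 - x²) is exp(x² - y² - 2x²) = exp(-|z|²). -/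
lemma spectrogram_eq (c : ℕ → ℂ) (z : ℂ) : spectrogram c z = H c z := by
  rw [spectrogram, H, F, tsum_congr (whiteNoiseTerm_eq c z), tsum_mul_left, norm_mul, mul_pow,
    mul_comm, Complex.norm_exp, ← Real.exp_nat_mul]
  congr 2
  rw [← Complex.normSq_eq_norm_sq, Complex.normSq_apply]
  simp [pow_two]
  ring

end GEF

end

noncomputable section

namespace GEF

open Set Filter Topology

/-! ### Transfer of intensities -/

section Intensity

variable {Ω Ω' : Type*} [MeasurableSpace Ω] [MeasurableSpace Ω'] {P : Measure Ω}
  {X Y Z : Ω → Set ℂ}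

lemma HasIntensity.congr_ae {ρ : ℂ → ℝ≥0∞} (h : HasIntensity P X ρ) (e : ∀ᵐ ω ∂P, X ω = Y ω) :
    HasIntensity P Y ρ := by
  intro B hB
  have e' : (fun ω => ((X ω ∩ B).encard : ℝ≥0∞)) =ᵐ[P] fun ω => ((Y ω ∩ B).encard : ℝ≥0∞) := by
    filter_upwards [e] with ω hω
    rw [hω]
  exact ⟨(h B hB).1.congr e', (lintegral_congr_ae e').symm.trans (h B hB).2⟩

lemma HasIntensity.comp {A : Ω → Ω'} (hA : AEMeasurable A P) {X : Ω' → Set ℂ} {ρ : ℂ → ℝ≥0∞}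
    (h : HasIntensity (P.map A) X ρ) : HasIntensity P (fun ω => X (A ω)) ρ := by
  intro B hB
  refine ⟨(h B hB).1.comp_aemeasurable hA, ?_⟩
  rw [← (h B hB).2, lintegral_map' (h B hB).1 hA]

lemma HasIntensity.union {r s : ℝ≥0∞} (hX : HasIntensity P X fun _ => r)
    (hY : HasIntensity P Y fun _ => s) (hd : ∀ ω, Disjoint (X ω) (Y ω)) :
    HasIntensity P (fun ω => X ω ∪ Y ω) fun _ => r + s := by
  intro B hB
  have e : ∀ ω, (((X ω ∪ Y ω) ∩ B).encard : ℝ≥0∞) =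
      ((X ω ∩ B).encard : ℝ≥0∞) + ((Y ω ∩ B).encard : ℝ≥0∞) := by
    intro ω
    rw [union_inter_distrib_right, encard_union_eq ((hd ω).mono inter_subset_left inter_subset_left)]
    simp
  simp only [e]
  refine ⟨(hX B hB).1.add (hY B hB).1, ?_⟩
  rw [lintegral_add_left' (hX B hB).1, (hX B hB).2, (hY B hB).2, ← lintegral_add_left (by fun_prop)]

end Intensity

/-! ### The critical points of `H` for almost every coefficient sequence -/

/-- The coefficient sequences for which `F` has simple zeros and all critical points of `H` are
nondegenerate. -/
structure IsGeneric (c : ℕ → ℂ) : Prop where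
  expBounded : ExpBounded c
  simple : ∀ z, F c z = 0 → chern1 c z ≠ 0
  nondegenerate : ∀ z, chern1 c z = 0 → ‖F c z‖ ≠ ‖chern2 c z‖

/-- Both conditions are instances of `IsKacRice.ae_nondegenerate`: for F the Jacobian factor is
|∇'F|², for ∇'F it is |F|² - |∇'∇'F|². -/
lemma ae_isGeneric : ∀ᵐ c ∂coeffLaw, IsGeneric c ∧ trunc c = c := by
  filter_upwards [ae_mem_tameSet, isKacRice_F.ae_nondegenerate, isKacRice_localMax.ae_nondegenerate]
    with c hc h0 h1
  rw [trunc_of_mem hc] at h0 h1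
  refine ⟨⟨.of_mem_tameSet hc, fun z hz e => h0 z hz (by simp [e]), fun z hz e => h1 z hz ?_⟩,
    trunc_of_mem hc⟩
  simp [e]

lemma hasIntensity_zeros : HasIntensity coeffLaw (fun c => {z | F c z = 0}) fun _ => 1 := by
  refine isKacRice_F.hasIntensity.congr_ae ?_
  filter_upwards [ae_isGeneric] with c ⟨hc, e⟩
  ext z
  rw [e]
  refine ⟨fun h => h.1, fun h => ⟨h, ?_⟩⟩
  have := norm_pos_iff.2 (hc.simple z h)
  positivity

lemma hasIntensity_localMax :
    HasIntensity coeffLaw (fun c => {z | IsLocalMax (H c) z}) fun _ => 1 / 3 := by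
  have h := isKacRice_localMax.hasIntensity
  rw [ENNReal.coe_div (by norm_num)] at h
  refine HasIntensity.congr_ae (X := _) (by simpa using h) ?_
  filter_upwards [ae_isGeneric] with c ⟨hc, e⟩
  ext z
  rw [e]
  refine Iff.trans (and_congr_right fun _ => ?_)
    (isLocalMax_iff hc.expBounded hc.simple hc.nondegenerate z).symm
  rw [sub_pos, sq_lt_sq₀ (norm_nonneg _) (norm_nonneg _)]

lemma hasIntensity_saddlePoint :
    HasIntensity coeffLaw (fun c => {z | IsSaddlePoint (H c) z}) fun _ => 4 / 3 := by
  have h := isKacRice_saddle.hasIntensity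
  rw [ENNReal.coe_div (by norm_num)] at h
  refine HasIntensity.congr_ae (X := _) (by simpa using h) ?_
  filter_upwards [ae_isGeneric] with c ⟨hc, e⟩
  ext z
  rw [e]
  refine Iff.trans (and_congr_right fun _ => ?_)
    (isSaddlePoint_iff hc.expBounded hc.simple hc.nondegenerate z).symm
  rw [sub_pos, sq_lt_sq₀ (norm_nonneg _) (norm_nonneg _)]

lemma hasIntensity_criticalPoint_not_localMin :
    HasIntensity coeffLaw (fun c => {z | IsCriticalPoint (H c) z ∧ ¬ IsLocalMin (H c) z})
      fun _ => 5 / 3 := by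
  have h := hasIntensity_localMax.union hasIntensity_saddlePoint fun c =>
    Set.disjoint_left.2 fun z hz hz' => hz'.2.1 hz
  have e53 : (1 / 3 + 4 / 3 : ℝ≥0∞) = 5 / 3 := by
    rw [← ENNReal.add_div]; norm_num
  rw [e53] at h
  refine h.congr_ae ?_
  filter_upwards [ae_isGeneric] with c ⟨hc, _⟩
  ext z
  exact (criticalPoint_not_localMin_iff_max_or_saddle hc.expBounded hc.simple z).symm

lemma map_coeff_eq_coeffLaw {Ω : Type*} [MeasurableSpace Ω] {P : Measure Ω}
    [IsProbabilityMeasure P] {a : ℕ → Ω → ℂ} (hlaw : ∀ k, HasLaw (a k) stdComplexGaussian P)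
    (hindep : iIndepFun a P) : P.map (fun ω k => a k ω) = coeffLaw := by
  have h := hindep.map_fun_eq_infinitePi_map₀' fun k => (hlaw k).aemeasurable
  rw [h, coeffLaw]
  congr 1
  ext k
  rw [(hlaw k).map_eq]

end GEF

end

theorem theorem1 {Ω : Type*} [MeasurableSpace Ω] (P : Measure Ω) [IsProbabilityMeasure P]
    (a : ℕ → Ω → ℂ) (hlaw : ∀ k, HasLaw (a k) GEF.stdComplexGaussian P)
    (hindep : iIndepFun a P) :
    -- almost sure statements, with `c` the sequence of coefficients
    (∀ᵐ ω ∂P, ∀ c : ℕ → ℂ, c = (fun k => a k ω) →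
      (∀ z, Summable (GEF.term c z)) ∧
      Differentiable ℂ (GEF.F c) ∧
      (∀ z, IsLocalMin (GEF.H c) z → GEF.F c z = 0 ∧ GEF.chernDeriv (GEF.F c) z ≠ 0) ∧
      (∀ z, (GEF.IsCriticalPoint (GEF.H c) z ∧ ¬ IsLocalMin (GEF.H c) z) ↔
        GEF.chernDeriv (GEF.F c) z = 0) ∧
      (∀ z, (GEF.IsCriticalPoint (GEF.H c) z ∧ ¬ IsLocalMin (GEF.H c) z) ↔
        (IsLocalMax (GEF.H c) z ∨ GEF.IsSaddlePoint (GEF.H c) z)) ∧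
      (∀ z, Summable (GEF.whiteNoiseTerm c z)) ∧
      (∀ z, GEF.spectrogram c z = GEF.H c z)) ∧
    -- the expected densities
    GEF.HasIntensity P (fun ω => {z | GEF.F (fun k => a k ω) z = 0}) (fun _ => 1) ∧
    GEF.HasIntensity P
      (fun ω => {z | GEF.IsCriticalPoint (GEF.H (fun k => a k ω)) z ∧
        ¬ IsLocalMin (GEF.H (fun k => a k ω)) z}) (fun _ => 5 / 3) ∧
    GEF.HasIntensity P (fun ω => {z | IsLocalMax (GEF.H (fun k => a k ω)) z}) (fun _ => 1 / 3) ∧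
    GEF.HasIntensity P (fun ω => {z | GEF.IsSaddlePoint (GEF.H (fun k => a k ω)) z})
      (fun _ => 4 / 3) := by
  have hA : AEMeasurable (fun ω k => a k ω) P :=
    aemeasurable_pi_iff.2 fun k => (hlaw k).aemeasurable
  -- Independence and the common law determine the joint law of the coefficients, so every statement
  -- transfers from `coeffLaw`.
  have hmap := GEF.map_coeff_eq_coeffLaw hlaw hindep
  refine ⟨?_, (hmap ▸ GEF.hasIntensity_zeros).comp hA,
    (hmap ▸ GEF.hasIntensity_criticalPoint_not_localMin).comp hA,
    (hmap ▸ GEF.hasIntensity_localMax).comp hA, (hmap ▸ GEF.hasIntensity_saddlePoint).comp hA⟩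
  have hgen := GEF.ae_isGeneric
  rw [← hmap] at hgen
  filter_upwards [ae_of_ae_map hA hgen] with ω hω c hc
  rw [← hc] at hω
  have hb := hω.1.expBounded
  have hs := hω.1.simple
  refine ⟨hb.summable_term, fun z => (GEF.hasDerivAt_F hb z).differentiableAt, fun z hz => ?_,
    fun z => ?_, GEF.criticalPoint_not_localMin_iff_max_or_saddle hb hs, hb.summable_whiteNoiseTerm,
    GEF.spectrogram_eq c⟩
  · have h0 := GEF.F_eq_zero_of_isLocalMin hb hz
    exact ⟨h0, by rw [GEF.chernDeriv_F hb]; exact hs z h0⟩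
  · rw [GEF.chernDeriv_F hb]
    exact GEF.criticalPoint_not_localMin_iff hb hs z
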